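/- Let $X$ be a compact connected Riemann surface, $L$ a holomorphic line bundle on $X$, and $n\ge 1$. Let $(E,\Phi,\omega)$ be an $\mathrm{Sp}_{2n}$-Higgs bundle on $X$ with $L$-valued symplectic form: $E$ is a holomorphic vector bundle of rank $2n$, $\omega:E\otimes E\to L$ is a holomorphic alternating bilinear form, non-degenerate at every point, and $\Phi:E\to L\otimes E$ is a holomorphic homomorphism with $\omega(\Phi v,w)+\omega(v,\Phi w)=0$. Write $p(\lambda)=\det(\lambda-\Phi)=\lambda^{2n}+a_2\lambda^{2n-2}+\dots+a_{2n}$ with $a_k\in H^0(X,L^k)$ and $a_0=1$. Assume that the spectral curve $S=\{p(\lambda)=0\}\subset\operatorname{Tot}(L)$ is smooth (the differential of the equation $p(\lambda)=0$, in local coordinates of $\operatorname{Tot}(L)$, is non-zero at each point of $S$), and that $a_{2n-2}$ and $a_{2n}$ have no common zero. Let $D$ be the set of zeros of $a_{2n}$. Over $X\setminus D$ consider $W=L^{-1}E\oplus L^{-n}$ with the Higgs field $\phi(v,w)=(\Phi v,0)$ and the symmetric bilinear form $Q$ that is the polarisation of $Q((v,w),(v,w))=\omega(v,\Phi v)+w^2a_{2n}$.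 *Hecke data* are injective linear maps $i_x:L_x^{-n}\to L_x^{-1}E_x$, one for each $x\in D$, with $i_x(L_x^{-n})=\ker\Phi_x$ and $$\omega_x\bigl(i_xw,\Phi'_x(i_xw)\bigr)=-w^2a_{2n}'(x)\qquad(w\in L_x^{-n}),$$ where the derivatives are taken in a local coordinate at $x$ and local frames of $L$ and $E$. The associated *Hecke modification* is a holomorphic vector bundle $V$ of rank $2n+1$ with an isomorphism $V\cong W$ over $X\setminus D$ that identifies the sheaf $\mathcal O_X(V)$ with the sheaf of meromorphic sections of $W$ which are holomorphic off $D$ and have at each $x\in D$ at most a simple pole with residue in $\Gamma_x=\{(-i_xw,w):w\in L_x^{-n}\}$. An $\mathrm{SO}_{2n+1}$-Higgs bundle on $X$ is a triple $(V,\phi,Q)$ with $V$ a holomorphic vector bundle of rank $2n+1$ with $\det V\cong\mathcal O_X$, $Q:V\otimes V\to\mathcal O_X$ a holomorphic symmetric bilinear form, non-degenerate at every point, and $\phi:V\to L\otimes V$ a holomorphic homomorphism with $Q(\phi v,w)+Q(v,\phi w)=0$. The triple *constructed from* it is $(V/V_0,\bar\phi,\bar\omega)$, where $V_0\subset V$ is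 the subbundle induced by the kernel of the sheaf map $\phi$, $\bar\phi$ is the Higgs field induced by $\phi$, and $\bar\omega(v,w)=Q(\phi\tilde v,\tilde w)$ for lifts $\tilde v,\tilde w$ to $V$. Then: 1. Hecke data exist. 2. For all Hecke data the Hecke modification $V$ exists. On any such $V$, the Higgs field $\phi$ and the form $Q$ extend uniquely to a holomorphic homomorphism $\phi:V\to L\otimes V$ and a holomorphic form $Q:V\otimes V\to\mathcal O_X$ over $X$, and $Q_x:V_x\otimes V_x\to\mathbb C$ is non-degenerate for each $x\in D$. Consequently $(V,\phi,Q)$ is an $\mathrm{SO}_{2n+1}$-Higgs bundle over $X$, and its characteristic polynomial is $\lambda p(\lambda)$. 3. This inverts the construction of an $\mathrm{Sp}_{2n}$-Higgs bundle from an $\mathrm{SO}_{2n+1}$-Higgs bundle: the triple constructed from the $(V,\phi,Q)$ of part 2 is isomorphic to $(E,\Phi,\omega)$; conversely, every $\mathrm{SO}_{2n+1}$-Higgs bundle $(V,\phi,Q)$ on $X$ from which a triple isomorphic to $(E,\Phi,\omega)$ is constructed is, for suitable Hecke data, the Hecke modification above with the extended $\phi$ and $Q$. -/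

import Mathlib

open Set
open scoped Manifold ContDiff Topology

noncomputable section

namespace HeckeHiggs

universe u

/-- A holomorphic vector bundle on `X` with typical fibre `F`: an open cover of `X` with a
holomorphic cocycle of transition functions, in the form of Mathlib's `VectorBundleCore`.

Throughout, the fibre of `B` at `x` is `F`, a vector being written in the distinguished
local frame at `x`, which is that of index `B.core.indexAt x` (this is Mathlib's
`VectorBundleCore.Fiber`). -/
structure HolBundle (X : Type u) [TopologicalSpace X] [ChartedSpace ℂ X]
    (F : Type) [NormedAddCommGroup F] [NormedSpace ℂ F] where
  /-- the index set of the cover -/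
  ι : Type u
  /-- the cover and the transition functions -/
  core : VectorBundleCore ℂ X F ι
  /-- the transition functions are holomorphic -/
  hol : core.IsContMDiff 𝓘(ℂ) ω

section Bundles

variable {X : Type u} [TopologicalSpace X] [ChartedSpace ℂ X]
  {F : Type} [NormedAddCommGroup F] [NormedSpace ℂ F]
  {F' : Type} [NormedAddCommGroup F'] [NormedSpace ℂ F']

namespace HolBundle

/-- The components, in the local frame of index `a`, of a section `s`. -/
def coord (B : HolBundle X F) (a : B.ι) (s : X → F) (y : X) : F :=
  B.core.coordChange (B.core.indexAt y) a y (s y)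

/-- The local section whose components in the local frame of index `a` are constantly `v`. -/
def constSection (B : HolBundle X F) (a : B.ι) (v : F) (y : X) : F :=
  B.core.coordChange a (B.core.indexAt y) y v

/-- `s` is a holomorphic section of `B` over `U`: its components in every local frame are
holomorphic functions. -/
def IsHolSection (B : HolBundle X F) (U : Set X) (s : X → F) : Prop :=
  ∀ a : B.ι, ContMDiffOn 𝓘(ℂ) 𝓘(ℂ, F) ω (B.coord a s) (U ∩ B.core.baseSet a)

/-- The derivative at `x` of the components of a local section in the distinguished frame at `x`,
with respect to the distinguished coordinate `chartAt ℂ x`. -/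
def localDeriv (B : HolBundle X F) (x : X) (s : X → F) : F :=
  deriv (fun z : ℂ => B.coord (B.core.indexAt x) s ((chartAt ℂ x).symm z)) (chartAt ℂ x x)

end HolBundle

/-- The trivial line bundle `𝒪_X`. -/
def trivialLine (X : Type u) [TopologicalSpace X] [ChartedSpace ℂ X] : HolBundle X ℂ where
  ι := PUnit
  core := trivialVectorBundleCore ℂ X ℂ PUnit
  hol := ⟨fun _ _ => contMDiffOn_const⟩

theorem contMDiffOn_zpow_coordChange (L : HolBundle X ℂ) (k : ℤ) (a b : L.ι) :
    ContMDiffOn 𝓘(ℂ) 𝓘(ℂ) ω (fun x => (L.core.coordChange a b x 1) ^ k)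
      (L.core.baseSet a ∩ L.core.baseSet b) := by
  have hol : ∀ c d, ContMDiffOn 𝓘(ℂ) 𝓘(ℂ) ω (fun x => L.core.coordChange c d x (1 : ℂ))
      (L.core.baseSet c ∩ L.core.baseSet d) := fun c d =>
    (L.hol.contMDiffOn_coordChange c d).clm_apply contMDiffOn_const
  rcases k with k | k
  · simpa using (hol a b).pow k
  · have h := (hol b a).pow (k + 1)
    rw [inter_comm] at h
    refine h.congr fun x hx => ?_
    have e : L.core.coordChange b a x 1 * L.core.coordChange a b x 1 = 1 := by
      have h1 := L.core.coordChange_comp a b a x ⟨hx, hx.1⟩ 1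
      rw [L.core.coordChange_self a x hx.1] at h1
      have h2 := (L.core.coordChange b a x).map_smul (L.core.coordChange a b x 1) 1
      simp only [smul_eq_mul, mul_one] at h2
      rw [h2] at h1
      rw [mul_comm]; exact h1
    have e0 : L.core.coordChange a b x 1 ≠ 0 := right_ne_zero_of_mul_eq_one e
    have e1 : L.core.coordChange b a x 1 = (L.core.coordChange a b x 1)⁻¹ :=
      eq_inv_of_mul_eq_one_left e
    simp only [zpow_negSucc, e1, inv_pow]

/-- The bundle `L^k ⊗ B`, for an integer `k`: its transition functions are those of `B`
multiplied by the `k`-th power of those of `L`. -/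
def twist (L : HolBundle X ℂ) (k : ℤ) (B : HolBundle X F) : HolBundle X F where
  ι := L.ι × B.ι
  core :=
    { baseSet := fun a => L.core.baseSet a.1 ∩ B.core.baseSet a.2
      isOpen_baseSet := fun a => (L.core.isOpen_baseSet a.1).inter (B.core.isOpen_baseSet a.2)
      indexAt := fun x => (L.core.indexAt x, B.core.indexAt x)
      mem_baseSet_at := fun x => ⟨L.core.mem_baseSet_at x, B.core.mem_baseSet_at x⟩
      coordChange := fun a b x =>
        ((L.core.coordChange a.1 b.1 x 1) ^ k) • B.core.coordChange a.2 b.2 x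
      coordChange_self := fun a x hx v => by
        simp [L.core.coordChange_self a.1 x hx.1, B.core.coordChange_self a.2 x hx.2]
      continuousOn_coordChange := fun a b =>
        ((contMDiffOn_zpow_coordChange L k a.1 b.1).continuousOn.mono
          (fun _ h => ⟨h.1.1, h.2.1⟩)).smul
        ((B.core.continuousOn_coordChange a.2 b.2).mono (fun _ h => ⟨h.1.2, h.2.2⟩))
      coordChange_comp := fun a b c x hx v => by
        have h1 := L.core.coordChange_comp a.1 b.1 c.1 x
          ⟨⟨hx.1.1.1, hx.1.2.1⟩, hx.2.1⟩ 1
        have h2 := B.core.coordChange_comp a.2 b.2 c.2 x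
          ⟨⟨hx.1.1.2, hx.1.2.2⟩, hx.2.2⟩ v
        have h3 := (L.core.coordChange b.1 c.1 x).map_smul (L.core.coordChange a.1 b.1 x 1) 1
        simp only [smul_eq_mul, mul_one] at h3
        rw [h3] at h1
        simp only [smul_apply, map_smul, h2, smul_smul]
        rw [← mul_zpow, mul_comm, mul_comm, h1] }
  hol := ⟨fun a b =>
    ((contMDiffOn_zpow_coordChange L k a.1 b.1).mono (fun _ h => ⟨h.1.1, h.2.1⟩)).smul
      ((B.hol.contMDiffOn_coordChange a.2 b.2).mono (fun _ h => ⟨h.1.2, h.2.2⟩))⟩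

/-- The line bundle `L^k`, for an integer `k`. -/
def linePow (L : HolBundle X ℂ) (k : ℤ) : HolBundle X ℂ := twist L k (trivialLine X)

/-- The direct sum of two bundles. -/
def directSum (B : HolBundle X F) (B' : HolBundle X F') : HolBundle X (F × F') where
  ι := B.ι × B'.ι
  core :=
    { baseSet := fun a => B.core.baseSet a.1 ∩ B'.core.baseSet a.2
      isOpen_baseSet := fun a => (B.core.isOpen_baseSet a.1).inter (B'.core.isOpen_baseSet a.2)
      indexAt := fun x => (B.core.indexAt x, B'.core.indexAt x)
      mem_baseSet_at := fun x => ⟨B.core.mem_baseSet_at x, B'.core.mem_baseSet_at x⟩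
      coordChange := fun a b x =>
        (B.core.coordChange a.1 b.1 x).prodMap (B'.core.coordChange a.2 b.2 x)
      coordChange_self := fun a x hx v =>
        Prod.ext (B.core.coordChange_self a.1 x hx.1 v.1) (B'.core.coordChange_self a.2 x hx.2 v.2)
      continuousOn_coordChange := fun a b =>
        (((B.hol.contMDiffOn_coordChange a.1 b.1).mono
          (fun _ h => ⟨h.1.1, h.2.1⟩)).clm_prodMap
        ((B'.hol.contMDiffOn_coordChange a.2 b.2).mono
          (fun _ h => ⟨h.1.2, h.2.2⟩))).continuousOn
      coordChange_comp := fun a b c x hx v => by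
        have h1 := B.core.coordChange_comp a.1 b.1 c.1 x
          ⟨⟨hx.1.1.1, hx.1.2.1⟩, hx.2.1⟩ v.1
        have h2 := B'.core.coordChange_comp a.2 b.2 c.2 x
          ⟨⟨hx.1.1.2, hx.1.2.2⟩, hx.2.2⟩ v.2
        exact Prod.ext h1 h2 }
  hol := ⟨fun a b =>
    ((B.hol.contMDiffOn_coordChange a.1 b.1).mono (fun _ h => ⟨h.1.1, h.2.1⟩)).clm_prodMap
      ((B'.hol.contMDiffOn_coordChange a.2 b.2).mono (fun _ h => ⟨h.1.2, h.2.2⟩))⟩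

theorem contDiff_clm_det (r : ℕ) :
    ContDiff ℂ ω (fun A : (Fin r → ℂ) →L[ℂ] (Fin r → ℂ) => LinearMap.det (A : (Fin r → ℂ) →ₗ[ℂ] (Fin r → ℂ))) := by
  have h : (fun A : (Fin r → ℂ) →L[ℂ] (Fin r → ℂ) => LinearMap.det (A : (Fin r → ℂ) →ₗ[ℂ] (Fin r → ℂ))) =
      fun A => ∑ σ : Equiv.Perm (Fin r), (((Equiv.Perm.sign σ : ℤ) : ℂ)) *
        ∏ i, A (Pi.single i 1) (σ i) := by
    funext A
    rw [← LinearMap.det_toMatrix', Matrix.det_apply']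
    simp [LinearMap.toMatrix'_apply]
  rw [h]
  refine ContDiff.sum fun σ _ => contDiff_const.mul (contDiff_prod fun i _ => ?_)
  have : ContDiff ℂ ω (fun A : (Fin r → ℂ) →L[ℂ] (Fin r → ℂ) => A (Pi.single i 1)) :=
    contDiff_id.clm_apply contDiff_const
  exact contDiff_pi.1 this (σ i)

theorem contMDiffOn_det_coordChange {r : ℕ} (B : HolBundle X (Fin r → ℂ)) (a b : B.ι) :
    ContMDiffOn 𝓘(ℂ) 𝓘(ℂ, ℂ →L[ℂ] ℂ) ω
      (fun x => LinearMap.det (B.core.coordChange a b x : (Fin r → ℂ) →ₗ[ℂ] (Fin r → ℂ)) •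
        ContinuousLinearMap.id ℂ ℂ) (B.core.baseSet a ∩ B.core.baseSet b) :=
  (((contDiff_clm_det r).contMDiff).comp_contMDiffOn (B.hol.contMDiffOn_coordChange a b)).smul
    contMDiffOn_const

/-- The determinant line bundle `det B`: its transition functions are the determinants of those
of `B`. -/
def detBundle {r : ℕ} (B : HolBundle X (Fin r → ℂ)) : HolBundle X ℂ where
  ι := B.ι
  core :=
    { baseSet := B.core.baseSet
      isOpen_baseSet := B.core.isOpen_baseSet
      indexAt := B.core.indexAt
      mem_baseSet_at := B.core.mem_baseSet_at
      coordChange := fun a b x =>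
        LinearMap.det (B.core.coordChange a b x : (Fin r → ℂ) →ₗ[ℂ] (Fin r → ℂ)) •
          ContinuousLinearMap.id ℂ ℂ
      coordChange_self := fun a x hx v => by
        have h : (B.core.coordChange a a x : (Fin r → ℂ) →ₗ[ℂ] (Fin r → ℂ)) =
            LinearMap.id := by
          ext1 v
          exact LinearMap.ext fun w => B.core.coordChange_self a x hx _
        simp [h]
      continuousOn_coordChange := fun a b => (contMDiffOn_det_coordChange B a b).continuousOn
      coordChange_comp := fun a b c x hx v => by
        have h : (B.core.coordChange a c x : (Fin r → ℂ) →ₗ[ℂ] (Fin r → ℂ)) =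
            (B.core.coordChange b c x : (Fin r → ℂ) →ₗ[ℂ] (Fin r → ℂ)) ∘ₗ
              (B.core.coordChange a b x : (Fin r → ℂ) →ₗ[ℂ] (Fin r → ℂ)) :=
          LinearMap.ext fun w => (B.core.coordChange_comp a b c x hx w).symm
        simp [h, LinearMap.det_comp, mul_assoc] }
  hol := ⟨fun a b => contMDiffOn_det_coordChange B a b⟩

/-- A line bundle is isomorphic to `𝒪_X` if it has a nowhere vanishing holomorphic section
over `X`. -/
def IsTrivialLine (N : HolBundle X ℂ) : Prop :=
  ∃ s : X → ℂ, N.IsHolSection univ s ∧ ∀ x, s x ≠ 0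

/-- A holomorphic homomorphism of vector bundles: linear maps of the fibres that send holomorphic
sections to holomorphic sections. -/
@[ext] structure BundleHom (B : HolBundle X F) (B' : HolBundle X F') where
  /-- the linear maps of the fibres -/
  toFun : X → F →ₗ[ℂ] F'
  hol : ∀ (U : Set X) (s : X → F), IsOpen U → B.IsHolSection U s →
    B'.IsHolSection U (fun x => toFun x (s x))

instance (B : HolBundle X F) (B' : HolBundle X F') :
    CoeFun (BundleHom B B') (fun _ => X → F →ₗ[ℂ] F') := ⟨BundleHom.toFun⟩

/-- A holomorphic bilinear form `B ⊗ B → N` with values in the line bundle `N`. -/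
@[ext] structure BundleForm (B : HolBundle X F) (N : HolBundle X ℂ) where
  /-- the bilinear forms on the fibres -/
  toFun : X → F →ₗ[ℂ] F →ₗ[ℂ] ℂ
  hol : ∀ (U : Set X) (s t : X → F), IsOpen U → B.IsHolSection U s → B.IsHolSection U t →
    N.IsHolSection U (fun x => toFun x (s x) (t x))

instance (B : HolBundle X F) (N : HolBundle X ℂ) :
    CoeFun (BundleForm B N) (fun _ => X → F →ₗ[ℂ] F →ₗ[ℂ] ℂ) := ⟨BundleForm.toFun⟩

end Bundles

section Higgs

variable {X : Type u} [TopologicalSpace X] [ChartedSpace ℂ X] {L : HolBundle X ℂ}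

/-- `(E, Φ, ω)` is an `Sp_{2n}`-Higgs bundle, the symplectic form `ω : E ⊗ E → L` being
`L`-valued and the Higgs field `Φ : E → L ⊗ E` being skew for `ω`. -/
structure IsSpHiggs {n : ℕ} (E : HolBundle X (Fin (2 * n) → ℂ)) (Φ : BundleHom E (twist L 1 E))
    (om : BundleForm E L) : Prop where
  alt : ∀ x, (om x).IsAlt
  nondegenerate : ∀ x, (om x).Nondegenerate
  compat : ∀ x v w, om x (Φ x v) w + om x v (Φ x w) = 0

/-- `(V, φ, Q)` is an `SO_m`-Higgs bundle: `det V` is trivial, `Q : V ⊗ V → 𝒪_X` is symmetric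
and non-degenerate at every point, and the Higgs field `φ : V → L ⊗ V` is skew for `Q`. -/
structure IsSOHiggs {m : ℕ} (V : HolBundle X (Fin m → ℂ)) (φ : BundleHom V (twist L 1 V))
    (Q : BundleForm V (trivialLine X)) : Prop where
  det_trivial : IsTrivialLine (detBundle V)
  symm : ∀ x v w, Q x v w = Q x w v
  nondegenerate : ∀ x, (Q x).Nondegenerate
  compat : ∀ x v w, Q x (φ x v) w + Q x v (φ x w) = 0

/-- The characteristic polynomial `det (λ - Φ_x)`; its coefficients at `x` are written in the
distinguished frame of `L` at `x`. -/
def charPoly {r : ℕ} {E : HolBundle X (Fin r → ℂ)} (Φ : BundleHom E (twist L 1 E)) (x : X) :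
    Polynomial ℂ :=
  (Φ x).charpoly

/-- The characteristic coefficient `a_k`, the coefficient of `λ^(r-k)` in `det (λ - Φ)`, a section
of `L^k`. -/
def charCoeff {r : ℕ} {E : HolBundle X (Fin r → ℂ)} (Φ : BundleHom E (twist L 1 E)) (k : ℕ)
    (x : X) : ℂ :=
  (charPoly Φ x).coeff (r - k)

/-- The characteristic polynomial of `Φ_y`, for `y` near `x`, with coefficients written in the
local frame of `L` which is distinguished at `x`. -/
def localCharPoly {r : ℕ} {E : HolBundle X (Fin r → ℂ)} (Φ : BundleHom E (twist L 1 E))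
    (x y : X) : Polynomial ℂ :=
  (L.core.coordChange (L.core.indexAt y) (L.core.indexAt x) y 1 • Φ y).charpoly

/-- The spectral curve `S = {det (λ - Φ) = 0}` in the total space of `L` is smooth: at each of its
points `(x, l)`, the equation `det (λ - Φ) = 0`, written in the coordinates `(z, λ)` of `Tot L`
given by the chart of `X` and the frame of `L` at `x`, has a non-zero partial derivative. -/
def SmoothSpectralCurve {r : ℕ} {E : HolBundle X (Fin r → ℂ)}
    (Φ : BundleHom E (twist L 1 E)) : Prop :=
  ∀ (x : X) (l : ℂ), (localCharPoly Φ x x).eval l = 0 →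
    (localCharPoly Φ x x).derivative.eval l ≠ 0 ∨
      deriv (fun z : ℂ => (localCharPoly Φ x ((chartAt ℂ x).symm z)).eval l) (chartAt ℂ x x) ≠ 0

variable {n : ℕ} {E : HolBundle X (Fin (2 * n) → ℂ)}

/-- The set `D` of zeros of `a_{2n}`. -/
def zeroSet (Φ : BundleHom E (twist L 1 E)) : Set X := {x | charCoeff Φ (2 * n) x = 0}

/-- The bundle `L⁻¹E ⊕ L⁻ⁿ`. -/
def sumBundle (L : HolBundle X ℂ) (E : HolBundle X (Fin (2 * n) → ℂ)) :
    HolBundle X ((Fin (2 * n) → ℂ) × ℂ) :=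
  directSum (twist L (-1) E) (linePow L (-(n : ℤ)))

/-- The Higgs field `(v, w) ↦ (Φ v, 0)` of `L⁻¹E ⊕ L⁻ⁿ` on the fibre at `x`. -/
def sumHiggs (Φ : BundleHom E (twist L 1 E)) (x : X) (p : (Fin (2 * n) → ℂ) × ℂ) :
    (Fin (2 * n) → ℂ) × ℂ :=
  (Φ x p.1, 0)

/-- The symmetric bilinear form of `L⁻¹E ⊕ L⁻ⁿ` on the fibre at `x`, which is the
polarisation of `(v, w) ↦ ω(v, Φ v) + w² a_{2n}`. -/
def sumForm (Φ : BundleHom E (twist L 1 E)) (om : BundleForm E L) (x : X)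
    (p q : (Fin (2 * n) → ℂ) × ℂ) : ℂ :=
  (om x p.1 (Φ x q.1) + om x q.1 (Φ x p.1)) / 2 + p.2 * q.2 * charCoeff Φ (2 * n) x

/-- Hecke data: for each `x ∈ D` an injective linear map `i_x : L_x⁻ⁿ → L_x⁻¹E_x` with image
`ker Φ_x` such that `ω_x(i_x w, Φ'_x (i_x w)) = - w² a_{2n}'(x)` for all `w`. The derivatives
are taken in the distinguished coordinate and frames at `x`. The values of `i` off `D` are
irrelevant. -/
structure IsHeckeData (Φ : BundleHom E (twist L 1 E)) (om : BundleForm E L)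
    (i : X → ℂ →ₗ[ℂ] (Fin (2 * n) → ℂ)) : Prop where
  injective : ∀ x ∈ zeroSet Φ, Function.Injective (i x)
  range_eq : ∀ x ∈ zeroSet Φ, LinearMap.range (i x) = LinearMap.ker (Φ x)
  residue : ∀ x ∈ zeroSet Φ, ∀ w : ℂ,
    om x (i x w) ((twist L 1 E).localDeriv x
        (fun y => Φ y (E.constSection (E.core.indexAt x) (i x w) y))) =
      -(w ^ 2 * (linePow L (2 * n : ℕ)).localDeriv x (charCoeff Φ (2 * n)))

/-- `t` is, over `U`, a section of the Hecke-modified sheaf: a meromorphic section of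
`L⁻¹E ⊕ L⁻ⁿ` which is holomorphic off `D` and has at each `x ∈ D` at most a simple pole, with
residue in `Γ_x = {(-i_x w, w)}`. That is, near `x` it is `h / z` with `h` holomorphic,
`h(x) ∈ Γ_x` and `z` a coordinate centred at `x`. The values of `t` on `D` are irrelevant. -/
def IsHeckeSection (Φ : BundleHom E (twist L 1 E)) (i : X → ℂ →ₗ[ℂ] (Fin (2 * n) → ℂ))
    (U : Set X) (t : X → (Fin (2 * n) → ℂ) × ℂ) : Prop :=
  (sumBundle L E).IsHolSection (U \ zeroSet Φ) t ∧
  ∀ x ∈ U ∩ zeroSet Φ, ∃ N : Set X, IsOpen N ∧ x ∈ N ∧ N ⊆ U ∩ (chartAt ℂ x).source ∧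
    ∃ h : X → (Fin (2 * n) → ℂ) × ℂ, (sumBundle L E).IsHolSection N h ∧
      (∀ y ∈ N \ zeroSet Φ, t y = (chartAt ℂ x y - chartAt ℂ x x)⁻¹ • h y) ∧
      ∃ w : ℂ, h x = (-(i x w), w)

/-- The vector bundle `V` is the Hecke modification of `L⁻¹E ⊕ L⁻ⁿ` along `D` given by `i`, by
means of the isomorphism `j` from `V` to `L⁻¹E ⊕ L⁻ⁿ` over `X \ D`: for each open `U`, the map `j`
identifies the holomorphic sections of `V` over `U` with the sections over `U` of the
Hecke-modified sheaf. The values of `j` on `D` are irrelevant. -/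
structure IsHeckeModification (Φ : BundleHom E (twist L 1 E))
    (i : X → ℂ →ₗ[ℂ] (Fin (2 * n) → ℂ)) (V : HolBundle X (Fin (2 * n + 1) → ℂ))
    (j : X → (Fin (2 * n + 1) → ℂ) →ₗ[ℂ] (Fin (2 * n) → ℂ) × ℂ) : Prop where
  bijective : ∀ x ∉ zeroSet Φ, Function.Bijective (j x)
  maps : ∀ (U : Set X) (s : X → Fin (2 * n + 1) → ℂ), IsOpen U → V.IsHolSection U s →
    IsHeckeSection Φ i U (fun x => j x (s x))
  surj : ∀ (U : Set X) (t : X → (Fin (2 * n) → ℂ) × ℂ), IsOpen U → IsHeckeSection Φ i U t →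
    ∃ s, V.IsHolSection U s ∧ ∀ x ∈ U \ zeroSet Φ, j x (s x) = t x

/-- `φ : V → L ⊗ V` extends over `D` the Higgs field `(v, w) ↦ (Φ v, 0)` given over `X \ D`. -/
def ExtendsHiggs (Φ : BundleHom E (twist L 1 E)) (V : HolBundle X (Fin (2 * n + 1) → ℂ))
    (j : X → (Fin (2 * n + 1) → ℂ) →ₗ[ℂ] (Fin (2 * n) → ℂ) × ℂ)
    (φ : BundleHom V (twist L 1 V)) : Prop :=
  ∀ x ∉ zeroSet Φ, ∀ v, j x (φ x v) = sumHiggs Φ x (j x v)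

/-- `Q : V ⊗ V → 𝒪_X` extends over `D` the symmetric form of `L⁻¹E ⊕ L⁻ⁿ` given over `X \ D`. -/
def ExtendsForm (Φ : BundleHom E (twist L 1 E)) (om : BundleForm E L)
    (V : HolBundle X (Fin (2 * n + 1) → ℂ))
    (j : X → (Fin (2 * n + 1) → ℂ) →ₗ[ℂ] (Fin (2 * n) → ℂ) × ℂ)
    (Q : BundleForm V (trivialLine X)) : Prop :=
  ∀ x ∉ zeroSet Φ, ∀ v w, Q x v w = sumForm Φ om x (j x v) (j x w)

/-- `(E, Φ, ω)` is (isomorphic to) the triple constructed from `(V, φ, Q)`: the quotient `V / V₀`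
by the subbundle `V₀` induced by the kernel of the sheaf map `φ`, the Higgs field induced by `φ`,
and the form `ω(v, w) = Q(φ ṽ, w̃)`, where `ṽ` and `w̃` are lifts to `V`. Here `q` is the quotient
map `V → V / V₀ ≅ E`. -/
def IsAssociatedSp (V : HolBundle X (Fin (2 * n + 1) → ℂ)) (φ : BundleHom V (twist L 1 V))
    (Q : BundleForm V (trivialLine X)) (Φ : BundleHom E (twist L 1 E)) (om : BundleForm E L) :
    Prop :=
  ∃ q : BundleHom V E,
    (∀ x, Function.Surjective (q x)) ∧
    (∀ (U : Set X) (s : X → Fin (2 * n + 1) → ℂ), IsOpen U → V.IsHolSection U s →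
      ((∀ x ∈ U, q x (s x) = 0) ↔ ∀ x ∈ U, φ x (s x) = 0)) ∧
    (∀ x v, q x (φ x v) = Φ x (q x v)) ∧
    (∀ x v w, om x (q x v) (q x w) = Q x (φ x v) w)

end Higgs

end HeckeHiggs

end

open HeckeHiggs

open Set
open scoped Manifold ContDiff Topology

/-! Everything is local at a zero `x` of `a_{2n}`. The characteristic polynomial of a skew `Φ` is
even, so its `λ`-derivative vanishes at `λ = 0`, and smoothness of `S` at `(x, 0)` makes the zero
simple: `a_{2n} = zα` with `α(x) ≠ 0` (`exists_coeffAt_eq`). If `Φ_x u = 0`, then `Φu = zψ`, and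
cancelling `z` in `adj(Φ)Φu = a_{2n}u` gives `adj(Φ_x)ψ(x) = α(x)u` (`exists_higgsAt_eq`). For `u ≠
0` the adjugate is therefore non-zero, so `ker Φ_x` is a line, and `ω(u, ψ(x)) ≠ 0`, since otherwise
`ψ(x)` would lie in the image of `Φ_x`, which the adjugate kills (`form_ne_zero_of_adjugateMap`).
Rescaling `u` by a square root achieves `ω(u, ψ(x)) = -α(x)`, which is the condition on Hecke data
for `u = i_x(1)`.

The modified sheaf is free near `x`, with frame `(c, b) ↦ (c - bu/z, b/z)` (`isHeckeSection_iff`).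
In this frame the first component of `W` followed by `Φ` becomes `q(c, b) = Φc - bψ`, the Higgs
field becomes `(q, 0)`, and the only possible pole of `Q` is `bb'(ω(u, ψ) + α)/z`, which the residue
condition removes (`form_heckeFrame`). Pairing with `u` shows that the extended form has no radical
at `x` (`modelForm_nondegenerate`). Off `D` the same formulas hold with `z` replaced by `1` and `u`
by `0`, so all points are treated alike. Identities valid off `D` pass to `D` by continuity, which
yields uniqueness of the extensions, the characteristic polynomial and the identification of `V/V₀`
with `E` through `q`. The determinant is trivial because `det V = L⁻³ⁿ det E (D)`, the Pfaffian of
`ω` gives `det E ≅ Lⁿ`, and `a_{2n}` gives `𝒪(D) ≅ L²ⁿ` (`isTrivialLine_detBundle`).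

For the converse let `q : V → E` be the quotient map. The trivialisation of `det V` and the Pfaffian
turn the cross product of the rows of `q` into a nowhere zero section `e` of `Lⁿ ⊗ V` spanning `ker
q`. Now `Q(e, e)` vanishes on `D`, so `Q(e, e)/a_{2n}` is holomorphic on the compact `X`, hence a
constant, and the constant is not zero; rescaling gives `Q(e, e) = a_{2n}`
(`exists_isKernelSection`). Off `D` the map `v ↦ (Φ⁻¹qv, Q(e, v)/a_{2n})` identifies `V` with `W`.
At a zero it has a simple pole, and `adj(Φ_x)qv = -Q(e, v)u` for a unique `u`, so that `i_x(1) = u`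
is the required Hecke datum; comparing first-order terms gives its residue condition
(`exists_vector`). -/

namespace HeckeHiggs

universe u

/-! ### Germs of holomorphic functions and division by a local coordinate. -/

section HolAt

variable {X : Type u} [TopologicalSpace X] [ChartedSpace ℂ X]
  {A : Type*} [NormedAddCommGroup A] [NormedSpace ℂ A]
  {B : Type*} [NormedAddCommGroup B] [NormedSpace ℂ B]
  {C : Type*} [NormedAddCommGroup C] [NormedSpace ℂ C]

/-- `f` is holomorphic near `x`. -/
abbrev HolAt (f : X → A) (x : X) : Prop := ContMDiffAt 𝓘(ℂ) 𝓘(ℂ, A) ω f x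

/-- The distinguished coordinate at `x`, centred at `x`. -/
noncomputable def centredCoord (x y : X) : ℂ := chartAt ℂ x y - chartAt ℂ x x

theorem centredCoord_self (x : X) : centredCoord x x = 0 := sub_self _

theorem eventually_centredCoord_ne_zero (x : X) :
    ∀ᶠ y in 𝓝 x, y ≠ x → centredCoord x y ≠ 0 := by
  filter_upwards [(chartAt ℂ x).open_source.mem_nhds (mem_chart_source ℂ x)] with y hy hne h
  exact hne ((chartAt ℂ x).injOn hy (mem_chart_source ℂ x) (sub_eq_zero.1 h))

/-- A chart transports from `ℂ` the absence of isolated points. This is what lets identities off `D`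
be extended to `D` by continuity. -/
theorem neBot_nhdsWithin_compl (x : X) : (𝓝[≠] x).NeBot := by
  rw [← mem_closure_iff_nhdsWithin_neBot, mem_closure_iff_nhds]
  intro t ht
  have h1 : (chartAt ℂ x).symm ⁻¹' t ∩ (chartAt ℂ x).target ∈ 𝓝 (chartAt ℂ x x) := by
    refine Filter.inter_mem ?_ ((chartAt ℂ x).open_target.mem_nhds (mem_chart_target ℂ x))
    apply (chartAt ℂ x).continuousAt_symm (mem_chart_target ℂ x)
    rwa [(chartAt ℂ x).left_inv (mem_chart_source ℂ x)]
  have h2 : (chartAt ℂ x x) ∈ closure ({chartAt ℂ x x}ᶜ : Set ℂ) := by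
    rw [mem_closure_iff_nhdsWithin_neBot]; infer_instance
  obtain ⟨w, ⟨hw1, hw2⟩, hw3⟩ := mem_closure_iff_nhds.1 h2 _ h1
  refine ⟨(chartAt ℂ x).symm w, hw1, fun h => hw3 ?_⟩
  rw [mem_singleton_iff] at h ⊢
  rw [← (chartAt ℂ x).right_inv hw2, h]

/-- Two continuous functions which agree off `x` agree at `x`. -/
theorem eq_of_eventuallyEq_off {A : Type*} [TopologicalSpace A] [T2Space A] {f g : X → A} {x : X} (hf : ContinuousAt f x)
    (hg : ContinuousAt g x) (h : ∀ᶠ y in 𝓝 x, y ≠ x → f y = g y) : f x = g x := by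
  have := neBot_nhdsWithin_compl x
  refine tendsto_nhds_unique_of_eventuallyEq (l := 𝓝[≠] x) (hf.mono_left nhdsWithin_le_nhds)
    (hg.mono_left nhdsWithin_le_nhds) ?_
  rw [Filter.EventuallyEq, eventually_nhdsWithin_iff]
  filter_upwards [h] with y hy using hy

theorem HolAt.congr {f g : X → A} {x : X} (hf : HolAt f x) (h : ∀ᶠ y in 𝓝 x, g y = f y) :
    HolAt g x := ContMDiffAt.congr_of_eventuallyEq hf h

theorem holAt_const (v : A) (x : X) : HolAt (fun _ : X => v) x := contMDiffAt_const

theorem HolAt.add {f g : X → A} {x : X} (hf : HolAt f x) (hg : HolAt g x) :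
    HolAt (fun y => f y + g y) x := ContMDiffAt.add hf hg

theorem HolAt.sub {f g : X → A} {x : X} (hf : HolAt f x) (hg : HolAt g x) :
    HolAt (fun y => f y - g y) x := ContMDiffAt.sub hf hg

theorem HolAt.smul {c : X → ℂ} {f : X → A} {x : X} (hc : HolAt c x) (hf : HolAt f x) :
    HolAt (fun y => c y • f y) x := ContMDiffAt.smul hc hf

theorem HolAt.mul {f g : X → ℂ} {x : X} (hf : HolAt f x) (hg : HolAt g x) :
    HolAt (fun y => f y * g y) x := ContMDiffAt.mul hf hg

theorem HolAt.inv {f : X → ℂ} {x : X} (hf : HolAt f x) (h0 : f x ≠ 0) :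
    HolAt (fun y => (f y)⁻¹) x := ContMDiffAt.inv₀ hf h0

theorem HolAt.sum {ι : Type*} {s : Finset ι} {f : ι → X → A} {x : X}
    (hf : ∀ i ∈ s, HolAt (f i) x) : HolAt (fun y => ∑ i ∈ s, f i y) x :=
  contMDiffAt_finsetSum hf

theorem HolAt.prod' {ι : Type*} {s : Finset ι} {f : ι → X → ℂ} {x : X}
    (hf : ∀ i ∈ s, HolAt (f i) x) : HolAt (fun y => ∏ i ∈ s, f i y) x :=
  contMDiffAt_finsetProd hf

theorem HolAt.pair {f : X → A} {g : X → B} {x : X} (hf : HolAt f x) (hg : HolAt g x) :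
    HolAt (fun y => (f y, g y)) x := ContMDiffAt.prodMk_space hf hg

theorem HolAt.clm {f : X → A} {x : X} (T : A →L[ℂ] B) (hf : HolAt f x) :
    HolAt (fun y => T (f y)) x :=
  T.contMDiff.contMDiffAt.comp x hf

theorem HolAt.fst {f : X → A × B} {x : X} (hf : HolAt f x) : HolAt (fun y => (f y).1) x :=
  hf.clm (ContinuousLinearMap.fst ℂ A B)

theorem HolAt.snd {f : X → A × B} {x : X} (hf : HolAt f x) : HolAt (fun y => (f y).2) x :=
  hf.clm (ContinuousLinearMap.snd ℂ A B)

theorem holAt_pi {ι : Type*} [Fintype ι] {f : X → ι → ℂ} {x : X} :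
    HolAt f x ↔ ∀ i, HolAt (fun y => f y i) x := contMDiffAt_pi_space

theorem HolAt.det {ι : Type*} [Fintype ι] [DecidableEq ι] {f : X → Matrix ι ι ℂ} {x : X}
    (hf : ∀ i j, HolAt (fun y => f y i j) x) : HolAt (fun y => (f y).det) x := by
  simp only [Matrix.det_apply']
  exact HolAt.sum fun σ _ => (holAt_const _ x).mul (HolAt.prod' fun i _ => hf _ _)

variable [IsManifold 𝓘(ℂ) ω X]

theorem holAt_chart (x : X) : HolAt (fun y => chartAt ℂ x y) x :=
  contMDiffAt_of_mem_maximalAtlas (IsManifold.chart_mem_maximalAtlas x) (mem_chart_source ℂ x)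

theorem holAt_centredCoord (x : X) : HolAt (fun y => centredCoord x y) x :=
  (holAt_chart x).sub contMDiffAt_const

theorem HolAt.eventually {f : X → A} {x : X} (hf : HolAt f x) : ∀ᶠ y in 𝓝 x, HolAt f y :=
  (contMDiffAt_iff_contMDiffAt_nhds (by simp)).1 hf

theorem HolAt.analyticAt_chart {f : X → A} {x : X} (hf : HolAt f x) [CompleteSpace A] :
    AnalyticAt ℂ (fun z => f ((chartAt ℂ x).symm z)) (chartAt ℂ x x) := by
  refine ContDiffAt.analyticAt (contMDiffAt_iff_contDiffAt.1 ?_)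
  refine ContMDiffAt.comp (I' := 𝓘(ℂ)) (chartAt ℂ x x) (g := f) (f := (chartAt ℂ x).symm) ?_ ?_
  · rwa [(chartAt ℂ x).left_inv (mem_chart_source ℂ x)]
  · exact contMDiffAt_symm_of_mem_maximalAtlas (IsManifold.chart_mem_maximalAtlas x)
      (mem_chart_target ℂ x)

/-- A holomorphic function which vanishes at `x` is divisible by the centred coordinate, and the
value at `x` of the quotient is the derivative. -/
theorem HolAt.exists_eq_smul [CompleteSpace A] {f : X → A} {x : X} (hf : HolAt f x)
    (h0 : f x = 0) : ∃ g : X → A, HolAt g x ∧ (∀ᶠ y in 𝓝 x, f y = centredCoord x y • g y) ∧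
      g x = deriv (fun z => f ((chartAt ℂ x).symm z)) (chartAt ℂ x x) := by
  set F : ℂ → A := fun z => f ((chartAt ℂ x).symm z) with hF
  have hFx : F (chartAt ℂ x x) = 0 := by
    simp [hF, (chartAt ℂ x).left_inv (mem_chart_source ℂ x), h0]
  obtain ⟨p, hp⟩ := hf.analyticAt_chart
  -- `dslope` is the difference quotient with the derivative as its value at the centre, so one
  -- function serves both as the quotient and for the last clause.
  have h1 : AnalyticAt ℂ (dslope F (chartAt ℂ x x)) (chartAt ℂ x x) :=
    ⟨_, hp.has_fpower_series_dslope_fslope⟩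
  refine ⟨fun y => dslope F (chartAt ℂ x x) (chartAt ℂ x y), ?_, ?_, ?_⟩
  · have h2 := contMDiffAt_iff_contDiffAt.2 (h1.contDiffAt (n := ω))
    exact h2.comp x (holAt_chart x)
  · filter_upwards [(chartAt ℂ x).open_source.mem_nhds (mem_chart_source ℂ x)] with y hy
    have := sub_smul_dslope F (chartAt ℂ x x) (chartAt ℂ x y)
    rw [hFx, sub_zero] at this
    rw [centredCoord, this, hF]
    simp [(chartAt ℂ x).left_inv hy]
  · simp only [dslope_same, hF]

end HolAt

/-! ### Holomorphic families of linear maps and bilinear forms. -/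

section HolHomAt

variable {X : Type u} [TopologicalSpace X] [ChartedSpace ℂ X]
  {A : Type*} [NormedAddCommGroup A] [NormedSpace ℂ A]
  {B : Type*} [NormedAddCommGroup B] [NormedSpace ℂ B]
  {C : Type*} [NormedAddCommGroup C] [NormedSpace ℂ C]

/-- The family of linear maps `T y` is holomorphic near `x`: it maps holomorphic functions to
holomorphic functions. -/
def HolHomAt (T : X → A →ₗ[ℂ] B) (x : X) : Prop :=
  ∀ s : X → A, HolAt s x → HolAt (fun y => T y (s y)) x

theorem HolHomAt.congr {T T' : X → A →ₗ[ℂ] B} {x : X} (h : HolHomAt T x)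
    (e : ∀ᶠ y in 𝓝 x, T' y = T y) : HolHomAt T' x := fun s hs =>
  (h s hs).congr (e.mono fun y hy => by rw [hy])

theorem HolHomAt.comp {T : X → B →ₗ[ℂ] C} {T' : X → A →ₗ[ℂ] B} {x : X} (h : HolHomAt T x)
    (h' : HolHomAt T' x) : HolHomAt (fun y => T y ∘ₗ T' y) x := fun s hs => h _ (h' s hs)

/-- The coordinates of a holomorphic function are holomorphic, so a family of maps need only be
tested on finitely many constant vectors. -/
theorem HolHomAt.of_basis {ι : Type*} [Fintype ι] [FiniteDimensional ℂ A] (b : Module.Basis ι ℂ A)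
    {T : X → A →ₗ[ℂ] B} {x : X} (h : ∀ i, HolAt (fun y => T y (b i)) x) : HolHomAt T x := by
  intro s hs
  have e : ∀ y, T y (s y) = ∑ i, b.repr (s y) i • T y (b i) := fun y => by
    calc T y (s y) = T y (∑ i, b.repr (s y) i • b i) := by rw [b.sum_repr]
      _ = _ := by simp only [map_sum, map_smul]
  simp only [e]
  refine HolAt.sum fun i _ => HolAt.smul ?_ (h i)
  exact hs.clm (LinearMap.toContinuousLinearMap (b.coord i))

theorem holHomAt_clm (T : A →L[ℂ] B) (x : X) : HolHomAt (fun _ => (T : A →ₗ[ℂ] B)) x :=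
  fun _ hs => hs.clm T

/-- An expansion in rank-one maps turns the test on vectors into holomorphy with values in the
normed space `A →L[ℂ] B`, where inversion is known to be analytic. -/
theorem HolHomAt.clm_holAt [FiniteDimensional ℂ A] {T : X → A →ₗ[ℂ] B} {x : X}
    (h : HolHomAt T x) : HolAt (fun y => LinearMap.toContinuousLinearMap (T y)) x := by
  let b := Module.finBasis ℂ A
  have e : ∀ y, LinearMap.toContinuousLinearMap (T y) =
      ∑ i, ContinuousLinearMap.smulRightL ℂ A B (LinearMap.toContinuousLinearMap (b.coord i))
        (T y (b i)) := fun y => by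
    ext v
    calc T y v = T y (∑ i, b.repr v i • b i) := by rw [b.sum_repr]
      _ = _ := by simp [-Module.Basis.sum_repr, map_sum, map_smul]
  simp only [e]
  exact HolAt.sum fun i _ => (h _ (holAt_const (b i) x)).clm _

/-- A holomorphic family of linear maps which is bijective at `x` has a holomorphic inverse. -/
theorem HolHomAt.exists_inverse [FiniteDimensional ℂ A] [FiniteDimensional ℂ B]
    {T : X → A →ₗ[ℂ] B} {x : X}
    (h : HolHomAt T x) (hx : Function.Bijective (T x)) :
    ∃ S : X → B →ₗ[ℂ] A, HolHomAt S x ∧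
      (∀ᶠ y in 𝓝 x, T y ∘ₗ S y = LinearMap.id ∧ S y ∘ₗ T y = LinearMap.id) := by
  have := FiniteDimensional.complete ℂ A
  let e : A ≃L[ℂ] B := (LinearEquiv.ofBijective (T x) hx).toContinuousLinearEquiv
  have he : LinearMap.toContinuousLinearMap (T x) = (e : A →L[ℂ] B) := by ext v; rfl
  have h1 := h.clm_holAt
  have h2 : HolAt (fun y => (LinearMap.toContinuousLinearMap (T y)).inverse) x := by
    have : ContMDiffAt 𝓘(ℂ, A →L[ℂ] B) 𝓘(ℂ, B →L[ℂ] A) ω ContinuousLinearMap.inverse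
        (LinearMap.toContinuousLinearMap (T x)) := by
      rw [he]; exact contMDiffAt_iff_contDiffAt.2 (contDiffAt_map_inverse e)
    exact ContMDiffAt.comp x this h1
  refine ⟨fun y => ((LinearMap.toContinuousLinearMap (T y)).inverse : B →ₗ[ℂ] A),
    fun s hs => ContMDiffAt.clm_apply h2 hs, ?_⟩
  have h3 : ∀ᶠ y in 𝓝 x, LinearMap.toContinuousLinearMap (T y) ∈
      range ((↑) : (A ≃L[ℂ] B) → (A →L[ℂ] B)) :=
    h1.continuousAt.eventually (by beta_reduce; rw [he]; exact ContinuousLinearEquiv.nhds e)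
  filter_upwards [h3] with y ⟨f, hf⟩
  have e1 : ∀ v, T y v = f v := fun v => (congrArg (fun g : A →L[ℂ] B => g v) hf).symm
  constructor
  · ext v
    simp only [← hf, ContinuousLinearMap.inverse_equiv]
    simp [e1]
  · ext v
    simp only [← hf, ContinuousLinearMap.inverse_equiv]
    simp [e1]

/-- The family of bilinear forms `β y` is holomorphic near `x`. -/
def HolFormAt (β : X → A →ₗ[ℂ] A →ₗ[ℂ] ℂ) (x : X) : Prop :=
  ∀ s t : X → A, HolAt s x → HolAt t x → HolAt (fun y => β y (s y) (t y)) x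

theorem HolHomAt.det {r : ℕ} {T : X → (Fin r → ℂ) →ₗ[ℂ] (Fin r → ℂ)} {x : X} (h : HolHomAt T x) :
    HolAt (fun y => LinearMap.det (T y)) x := by
  simp only [← LinearMap.det_toMatrix']
  refine HolAt.det fun i j => ?_
  simp only [LinearMap.toMatrix'_apply]
  exact holAt_pi.1 (h _ (holAt_const _ x)) i

end HolHomAt

/-! ### Sections, homomorphisms and forms written in the distinguished frame at a point. -/

section Frames

variable {X : Type u} [TopologicalSpace X] [ChartedSpace ℂ X]
  {F : Type} [NormedAddCommGroup F] [NormedSpace ℂ F]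
  {F' : Type} [NormedAddCommGroup F'] [NormedSpace ℂ F']

namespace HolBundle

/-- The domain of the distinguished frame at `x`. -/
def frameSet (B : HolBundle X F) (x : X) : Set X := B.core.baseSet (B.core.indexAt x)

/-- From the distinguished frame at `y` to that at `x`, on the fibre at `y`. -/
def toFrame (B : HolBundle X F) (x y : X) : F →L[ℂ] F :=
  B.core.coordChange (B.core.indexAt y) (B.core.indexAt x) y

/-- From the distinguished frame at `x` to that at `y`, on the fibre at `y`. -/
def fromFrame (B : HolBundle X F) (x y : X) : F →L[ℂ] F :=
  B.core.coordChange (B.core.indexAt x) (B.core.indexAt y) y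

variable (B : HolBundle X F)

theorem frameSet_mem_nhds (x : X) : B.frameSet x ∈ 𝓝 x :=
  (B.core.isOpen_baseSet _).mem_nhds (B.core.mem_baseSet_at x)

theorem eventually_mem_frameSet (x : X) : ∀ᶠ y in 𝓝 x, y ∈ B.frameSet x := B.frameSet_mem_nhds x

theorem mem_frameSet_self (x : X) : x ∈ B.frameSet x := B.core.mem_baseSet_at x

@[simp] theorem toFrame_self (x : X) (v : F) : B.toFrame x x v = v :=
  B.core.coordChange_self _ x (B.core.mem_baseSet_at x) v

@[simp] theorem fromFrame_self (x : X) (v : F) : B.fromFrame x x v = v :=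
  B.core.coordChange_self _ x (B.core.mem_baseSet_at x) v

theorem toFrame_fromFrame {x y : X} (hy : y ∈ B.frameSet x) (v : F) :
    B.toFrame x y (B.fromFrame x y v) = v := by
  have hy' := B.core.mem_baseSet_at y
  rw [toFrame, fromFrame, B.core.coordChange_comp _ _ _ y ⟨⟨hy, hy'⟩, hy⟩,
    B.core.coordChange_self _ y hy]

theorem fromFrame_toFrame {x y : X} (hy : y ∈ B.frameSet x) (v : F) :
    B.fromFrame x y (B.toFrame x y v) = v := by
  have hy' := B.core.mem_baseSet_at y
  rw [toFrame, fromFrame, B.core.coordChange_comp _ _ _ y ⟨⟨hy', hy⟩, hy'⟩,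
    B.core.coordChange_self _ y hy']

theorem toFrame_injective {x y : X} (hy : y ∈ B.frameSet x) :
    Function.Injective (B.toFrame x y) :=
  Function.LeftInverse.injective (B.fromFrame_toFrame hy)

theorem holAt_coord {s : X → F} {x : X} {a b : B.ι} (ha : x ∈ B.core.baseSet a)
    (hb : x ∈ B.core.baseSet b) (h : HolAt (B.coord a s) x) : HolAt (B.coord b s) x := by
  have hn : B.core.baseSet a ∩ B.core.baseSet b ∈ 𝓝 x :=
    ((B.core.isOpen_baseSet a).inter (B.core.isOpen_baseSet b)).mem_nhds ⟨ha, hb⟩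
  have h1 : ContMDiffAt 𝓘(ℂ) 𝓘(ℂ, F →L[ℂ] F) ω (B.core.coordChange a b) x :=
    (B.hol.contMDiffOn_coordChange a b).contMDiffAt hn
  refine HolAt.congr (f := fun y => B.core.coordChange a b y (B.coord a s y))
    (h1.clm_apply h) ?_
  filter_upwards [hn] with y hy
  rw [coord, coord, B.core.coordChange_comp _ _ _ y ⟨⟨B.core.mem_baseSet_at y, hy.1⟩, hy.2⟩]

theorem isHolSection_iff {U : Set X} (hU : IsOpen U) {s : X → F} :
    B.IsHolSection U s ↔ ∀ x ∈ U, HolAt (fun y => B.toFrame x y (s y)) x := by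
  constructor
  · intro h x hx
    exact (h (B.core.indexAt x)).contMDiffAt ((hU.inter (B.core.isOpen_baseSet _)).mem_nhds
      ⟨hx, B.core.mem_baseSet_at x⟩)
  · intro h a x hx
    exact (B.holAt_coord (B.core.mem_baseSet_at x) hx.2 (h x hx.1)).contMDiffWithinAt

theorem IsHolSection.mono {B : HolBundle X F} {U U' : Set X} {s : X → F} (h : B.IsHolSection U s)
    (hU : U' ⊆ U) : B.IsHolSection U' s := fun a =>
  (h a).mono (inter_subset_inter_left _ hU)

variable [IsManifold 𝓘(ℂ) ω X]

/-- A holomorphic germ, read in the frame at `x`, is a holomorphic section near `x`. -/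
theorem exists_isHolSection {σ : X → F} {x : X} (hσ : HolAt σ x) {N : Set X} (hN : N ∈ 𝓝 x) :
    ∃ U : Set X, IsOpen U ∧ x ∈ U ∧ U ⊆ N ∧ U ⊆ B.frameSet x ∧
      B.IsHolSection U (fun y => B.fromFrame x y (σ y)) := by
  obtain ⟨U, hU, hUo, hxU⟩ := eventually_nhds_iff.1
    (hσ.eventually.and ((B.eventually_mem_frameSet x).and (Filter.eventually_mem_set.2 hN)))
  refine ⟨U, hUo, hxU, fun y hy => (hU y hy).2.2, fun y hy => (hU y hy).2.1,
    (B.isHolSection_iff hUo).2 fun y hy => ?_⟩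
  have hy' := (hU y hy).2.1
  refine B.holAt_coord (a := B.core.indexAt x) hy' (B.core.mem_baseSet_at y) ?_
  refine HolAt.congr (hU y hy).1 ?_
  filter_upwards [hUo.mem_nhds hy] with z hz
  exact B.toFrame_fromFrame (hU z hz).2.1 _

end HolBundle

/-- The transition function of the line bundle `L` from the frame at `y` to the frame at `x`. -/
noncomputable def lineFactor (L : HolBundle X ℂ) (x y : X) : ℂ := L.toFrame x y 1

theorem toFrame_line (L : HolBundle X ℂ) (x y : X) (c : ℂ) :
    L.toFrame x y c = lineFactor L x y * c := by
  rw [lineFactor, mul_comm, ← smul_eq_mul, ← map_smul, smul_eq_mul, mul_one]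

@[simp] theorem lineFactor_self (L : HolBundle X ℂ) (x : X) : lineFactor L x x = 1 := by
  simp [lineFactor]

theorem lineFactor_ne_zero (L : HolBundle X ℂ) {x y : X} (hy : y ∈ L.frameSet x) :
    lineFactor L x y ≠ 0 := by
  intro h
  have := L.fromFrame_toFrame hy 1
  rw [← lineFactor, h, map_zero] at this
  exact zero_ne_one this

/-- A family of linear maps of fibres, read in the frames at `x`. -/
noncomputable def locHom (B : HolBundle X F) (B' : HolBundle X F') (T : X → F →ₗ[ℂ] F') (x y : X) :
    F →ₗ[ℂ] F' :=
  (B'.toFrame x y : F' →ₗ[ℂ] F') ∘ₗ T y ∘ₗ (B.fromFrame x y : F →ₗ[ℂ] F)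

/-- A family of bilinear forms on the fibres, read in the frames at `x`. -/
noncomputable def locForm (B : HolBundle X F) (N : HolBundle X ℂ)
    (β : X → F →ₗ[ℂ] F →ₗ[ℂ] ℂ) (x y : X) : F →ₗ[ℂ] F →ₗ[ℂ] ℂ :=
  lineFactor N x y • (β y).compl₁₂ (B.fromFrame x y : F →ₗ[ℂ] F) (B.fromFrame x y : F →ₗ[ℂ] F)

theorem locForm_apply (B : HolBundle X F) (N : HolBundle X ℂ) (β : X → F →ₗ[ℂ] F →ₗ[ℂ] ℂ)
    (x y : X) (v w : F) : locForm B N β x y v w =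
      lineFactor N x y * β y (B.fromFrame x y v) (B.fromFrame x y w) := rfl

theorem locHom_apply (B : HolBundle X F) (B' : HolBundle X F') (T : X → F →ₗ[ℂ] F') (x y : X)
    (v : F) : locHom B B' T x y v = B'.toFrame x y (T y (B.fromFrame x y v)) := rfl

@[simp] theorem locHom_self (B : HolBundle X F) (B' : HolBundle X F') (T : X → F →ₗ[ℂ] F')
    (x : X) : locHom B B' T x x = T x := by
  ext v; simp [locHom_apply]

@[simp] theorem locForm_self (B : HolBundle X F) (N : HolBundle X ℂ)
    (β : X → F →ₗ[ℂ] F →ₗ[ℂ] ℂ) (x : X) : locForm B N β x x = β x := by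
  ext v w; simp [locForm_apply]

section Mk

theorem isHolSection_hom {B : HolBundle X F} {B' : HolBundle X F'} {T : X → F →ₗ[ℂ] F'}
    (hT : ∀ x, HolHomAt (locHom B B' T x) x) (U : Set X) (s : X → F) (hU : IsOpen U)
    (hs : B.IsHolSection U s) : B'.IsHolSection U (fun x => T x (s x)) := by
  rw [HolBundle.isHolSection_iff _ hU] at hs ⊢
  intro x hx
  refine (hT x _ (hs x hx)).congr ?_
  filter_upwards [B.eventually_mem_frameSet x] with y hy
  rw [locHom_apply, B.fromFrame_toFrame hy]

theorem isHolSection_form {B : HolBundle X F} {N : HolBundle X ℂ} {β : X → F →ₗ[ℂ] F →ₗ[ℂ] ℂ}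
    (hT : ∀ x, HolFormAt (locForm B N β x) x) (U : Set X) (s t : X → F) (hU : IsOpen U)
    (hs : B.IsHolSection U s) (ht : B.IsHolSection U t) :
    N.IsHolSection U (fun x => β x (s x) (t x)) := by
  rw [HolBundle.isHolSection_iff _ hU] at hs ht ⊢
  intro x hx
  refine (hT x _ _ (hs x hx) (ht x hx)).congr ?_
  filter_upwards [B.eventually_mem_frameSet x] with y hy
  rw [locForm_apply, B.fromFrame_toFrame hy, B.fromFrame_toFrame hy, toFrame_line]

variable [IsManifold 𝓘(ℂ) ω X]

theorem BundleHom.holHomAt {B : HolBundle X F} {B' : HolBundle X F'} (T : BundleHom B B') (x : X) :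
    HolHomAt (locHom B B' T x) x := by
  intro σ hσ
  obtain ⟨U, hUo, hxU, -, -, hU⟩ := B.exists_isHolSection hσ Filter.univ_mem
  exact (HolBundle.isHolSection_iff _ hUo).1 (T.hol U _ hUo hU) x hxU

theorem BundleForm.holFormAt {B : HolBundle X F} {N : HolBundle X ℂ} (β : BundleForm B N) (x : X) :
    HolFormAt (locForm B N β x) x := by
  intro σ τ hσ hτ
  obtain ⟨U, hUo, hxU, -, -, hU⟩ := B.exists_isHolSection hσ Filter.univ_mem
  obtain ⟨U', hUo', hxU', -, -, hU'⟩ := B.exists_isHolSection hτ Filter.univ_mem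
  refine ((HolBundle.isHolSection_iff _ (hUo.inter hUo')).1 (β.hol (U ∩ U') _ _ (hUo.inter hUo')
    (hU.mono inter_subset_left) (hU'.mono inter_subset_right)) x ⟨hxU, hxU'⟩).congr ?_
  exact Filter.Eventually.of_forall fun y => by rw [locForm_apply, toFrame_line]

end Mk

variable (L : HolBundle X ℂ) (k : ℤ) (B : HolBundle X F) (B' : HolBundle X F')

theorem toFrame_twist (x y : X) (v : F) :
    (twist L k B).toFrame x y v = lineFactor L x y ^ k • B.toFrame x y v := rfl

theorem toFrame_linePow (x y : X) (c : ℂ) :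
    (linePow L k).toFrame x y c = lineFactor L x y ^ k * c := rfl

theorem toFrame_directSum (x y : X) (p : F × F') :
    (directSum B B').toFrame x y p = (B.toFrame x y p.1, B'.toFrame x y p.2) := rfl

theorem toFrame_detBundle {r : ℕ} (B : HolBundle X (Fin r → ℂ)) (x y : X) (c : ℂ) :
    (detBundle B).toFrame x y c = LinearMap.det (B.toFrame x y : (Fin r → ℂ) →ₗ[ℂ] _) * c := rfl

end Frames

/-! ### The Pfaffian of an alternating form and its non-vanishing. -/

section Pfaffian

variable {M : Type*} [AddCommGroup M] [Module ℂ M] {n : ℕ}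

/-- Each vector enters exactly one factor of the product; this gives the multilinearity of
`pairingProd`. -/
theorem prod_pairing_update (β : M →ₗ[ℂ] M →ₗ[ℂ] ℂ) (m : Fin n × Fin 2 → M) (i : Fin n)
    (b : Fin 2) (z : M) :
    ∏ j, β (Function.update m (i, b) z (j, 0)) (Function.update m (i, b) z (j, 1)) =
      β (Function.update m (i, b) z (i, 0)) (Function.update m (i, b) z (i, 1)) *
        ∏ j ∈ Finset.univ.erase i, β (m (j, 0)) (m (j, 1)) := by
  rw [← Finset.mul_prod_erase _ _ (Finset.mem_univ i)]
  congr 1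
  refine Finset.prod_congr rfl fun j hj => ?_
  have hj' := Finset.ne_of_mem_erase hj
  rw [Function.update_of_ne (by simp [hj']), Function.update_of_ne (by simp [hj'])]

/-- The multilinear map `v ↦ ∏ i, β (v (i, 0)) (v (i, 1))`. -/
noncomputable def pairingProd (β : M →ₗ[ℂ] M →ₗ[ℂ] ℂ) (n : ℕ) :
    MultilinearMap ℂ (fun _ : Fin n × Fin 2 => M) ℂ where
  toFun v := ∏ i, β (v (i, 0)) (v (i, 1))
  map_update_add' := by
    intro inst m k x y
    obtain rfl : inst = instDecidableEqProd := Subsingleton.elim _ _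
    obtain ⟨i, b⟩ := k
    rw [prod_pairing_update, prod_pairing_update, prod_pairing_update, ← add_mul]
    congr 1
    fin_cases b <;> simp
  map_update_smul' := by
    intro inst m k c x
    obtain rfl : inst = instDecidableEqProd := Subsingleton.elim _ _
    obtain ⟨i, b⟩ := k
    rw [prod_pairing_update, prod_pairing_update, smul_eq_mul, ← mul_assoc]
    congr 1
    fin_cases b <;> simp

/-- The alternating form `ω ∧ ⋯ ∧ ω` of degree `2n`. -/
noncomputable def altForm (β : M →ₗ[ℂ] M →ₗ[ℂ] ℂ) (n : ℕ) : M [⋀^Fin n × Fin 2]→ₗ[ℂ] ℂ :=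
  MultilinearMap.alternatization (pairingProd β n)

theorem altForm_apply (β : M →ₗ[ℂ] M →ₗ[ℂ] ℂ) (n : ℕ) (v : Fin n × Fin 2 → M) :
    altForm β n v = ∑ σ : Equiv.Perm (Fin n × Fin 2), ((Equiv.Perm.sign σ : ℤ) : ℂ) *
      ∏ i, β (v (σ (i, 0))) (v (σ (i, 1))) := by
  rw [altForm, MultilinearMap.alternatization_apply]
  refine Finset.sum_congr rfl fun σ _ => ?_
  rw [Units.smul_def, zsmul_eq_mul]
  rfl

/-- The index of the standard basis of `ℂ²ⁿ` belonging to a pair `(i, b)`. -/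
def pairIndex (n : ℕ) : Fin n × Fin 2 ≃ Fin (2 * n) :=
  (Equiv.prodComm _ _).trans finProdFinEquiv

/-- A multiple of the Pfaffian of the bilinear form `β` on `ℂ²ⁿ`. -/
noncomputable def pfaffian (β : (Fin (2 * n) → ℂ) → (Fin (2 * n) → ℂ) → ℂ) : ℂ :=
  ∑ σ : Equiv.Perm (Fin n × Fin 2), ((Equiv.Perm.sign σ : ℤ) : ℂ) *
    ∏ i, β (Pi.single (pairIndex n (σ (i, 0))) 1) (Pi.single (pairIndex n (σ (i, 1))) 1)

/-- The standard basis of `ℂ²ⁿ`, indexed by pairs. -/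
noncomputable def pairBasis (n : ℕ) : Module.Basis (Fin n × Fin 2) ℂ (Fin (2 * n) → ℂ) :=
  (Pi.basisFun ℂ (Fin (2 * n))).reindex (pairIndex n).symm

theorem pairBasis_apply (k : Fin n × Fin 2) : pairBasis n k = Pi.single (pairIndex n k) 1 := by
  simp [pairBasis]

theorem pfaffian_eq (β : (Fin (2 * n) → ℂ) →ₗ[ℂ] (Fin (2 * n) → ℂ) →ₗ[ℂ] ℂ) :
    pfaffian (fun v w => β v w) = altForm β n (pairBasis n) := by
  simp only [altForm_apply, pairBasis_apply, pfaffian]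

/-- An alternating form of top degree is a multiple of the determinant. This law makes the Pfaffian
of an `L`-valued form a section of `Lⁿ ⊗ (det E)⁻¹`; the discriminant would give only its square. -/
theorem pfaffian_comp (β : (Fin (2 * n) → ℂ) →ₗ[ℂ] (Fin (2 * n) → ℂ) →ₗ[ℂ] ℂ)
    (g : (Fin (2 * n) → ℂ) →ₗ[ℂ] (Fin (2 * n) → ℂ)) :
    pfaffian (fun v w => β (g v) (g w)) = LinearMap.det g * pfaffian (fun v w => β v w) := by
  have h : pfaffian (fun v w => β (g v) (g w)) = altForm β n (g ∘ pairBasis n) := by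
    simp only [altForm_apply, Function.comp, pairBasis_apply, pfaffian]
  rw [h, (altForm β n).eq_smul_basis_det (pairBasis n), pfaffian_eq]
  simp only [AlternatingMap.smul_apply, Module.Basis.det_comp, Module.Basis.det_self, smul_eq_mul]
  ring

theorem pfaffian_smul (β : (Fin (2 * n) → ℂ) → (Fin (2 * n) → ℂ) → ℂ) (c : ℂ) :
    pfaffian (fun v w => c * β v w) = c ^ n * pfaffian β := by
  simp only [pfaffian, Finset.mul_sum, Finset.prod_mul_distrib, Finset.prod_const,
    Finset.card_univ, Fintype.card_fin]
  exact Finset.sum_congr rfl fun σ _ => by ring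

/-- Symplectic Gram–Schmidt: a new pair is taken in the orthogonal space of the earlier ones. -/
theorem exists_hyperbolic_pairs {β : (Fin (2 * n) → ℂ) →ₗ[ℂ] (Fin (2 * n) → ℂ) →ₗ[ℂ] ℂ}
    (halt : β.IsAlt) (hnd : β.Nondegenerate) (k : ℕ) (hk : k ≤ n) :
    ∃ a c : ℕ → Fin (2 * n) → ℂ, ∀ i < k, ∀ j < k,
      β (a i) (a j) = 0 ∧ β (c i) (c j) = 0 ∧ β (a i) (c j) = if i = j then 1 else 0 := by
  induction k with
  | zero => exact ⟨0, 0, fun i hi => absurd hi (Nat.not_lt_zero i)⟩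
  | succ k ih =>
    obtain ⟨a, c, h⟩ := ih (by omega)
    have hneg : ∀ v w, β v w = -β w v := fun v w => (halt.neg w v).symm
    -- `ker T` is the orthogonal space of the `2k < 2n` vectors found so far, hence is not zero.
    let T : (Fin (2 * n) → ℂ) →ₗ[ℂ] (Fin k ⊕ Fin k → ℂ) :=
      LinearMap.pi (Sum.elim (fun i => β (a i)) (fun i => β (c i)))
    obtain ⟨m, hm, hm0⟩ := (LinearMap.ker T).ne_bot_iff.1
      (LinearMap.ker_ne_bot_of_finrank_lt (f := T) (by simp; omega))
    have hma : ∀ i < k, β (a i) m = 0 := fun i hi => congrFun hm (Sum.inl ⟨i, hi⟩)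
    have hmc : ∀ i < k, β (c i) m = 0 := fun i hi => congrFun hm (Sum.inr ⟨i, hi⟩)
    obtain ⟨w, hw⟩ : ∃ w, β m w ≠ 0 := by
      by_contra! hc
      exact hm0 (hnd.1 m hc)
    -- `w` minus its projection to the span of the earlier pairs, normalised; the subtraction does
    -- not change the pairing with `m`.
    let w' := (β m w)⁻¹ • (w - ∑ i ∈ Finset.range k, (β w (c i) • a i - β w (a i) • c i))
    have hmw : β m w' = 1 := by
      have : ∑ i ∈ Finset.range k, β m (β w (c i) • a i - β w (a i) • c i) = 0 :=
        Finset.sum_eq_zero fun i hi => by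
          have hi' := Finset.mem_range.1 hi
          rw [map_sub, map_smul, map_smul, hneg m, hneg m, hma i hi', hmc i hi']; simp
      rw [map_smul, map_sub, map_sum, this, smul_eq_mul, sub_zero]
      exact inv_mul_cancel₀ hw
    have haw : ∀ j < k, β (a j) w' = 0 := fun j hj => by
      have : ∑ i ∈ Finset.range k, β (a j) (β w (c i) • a i - β w (a i) • c i) = β (a j) w := by
        rw [Finset.sum_eq_single j]
        · simp [(h j hj j hj).1, (h j hj j hj).2.2, hneg (a j) w]
        · intro i hi hij
          have hi' := Finset.mem_range.1 hi
          simp [(h j hj i hi').1, (h j hj i hi').2.2, hij.symm]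
        · intro hj'; exact absurd (Finset.mem_range.2 hj) hj'
      rw [map_smul, map_sub, map_sum, this, sub_self, smul_zero]
    have hcw : ∀ j < k, β (c j) w' = 0 := fun j hj => by
      have : ∑ i ∈ Finset.range k, β (c j) (β w (c i) • a i - β w (a i) • c i) = β (c j) w := by
        rw [Finset.sum_eq_single j]
        · simp [(h j hj j hj).2.1, (h j hj j hj).2.2, hneg (c j) (a j), hneg (c j) w]
        · intro i hi hij
          have hi' := Finset.mem_range.1 hi
          simp [(h j hj i hi').2.1, (h i hi' j hj).2.2, hij, hneg (c j) (a i)]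
        · intro hj'; exact absurd (Finset.mem_range.2 hj) hj'
      rw [map_smul, map_sub, map_sum, this, sub_self, smul_zero]
    refine ⟨Function.update a k m, Function.update c k w', fun i hi j hj => ?_⟩
    rcases Nat.lt_succ_iff_lt_or_eq.1 hi with hi | rfl <;>
      rcases Nat.lt_succ_iff_lt_or_eq.1 hj with hj | rfl
    · rw [Function.update_of_ne hi.ne, Function.update_of_ne hj.ne, Function.update_of_ne hi.ne,
        Function.update_of_ne hj.ne]
      exact h i hi j hj
    · rw [Function.update_of_ne hi.ne, Function.update_self, Function.update_of_ne hi.ne,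
        Function.update_self, if_neg hi.ne]
      exact ⟨hma i hi, hcw i hi, haw i hi⟩
    · rw [Function.update_of_ne hj.ne, Function.update_self, Function.update_of_ne hj.ne,
        Function.update_self, if_neg hj.ne', hneg m, hneg w', hneg m, hma j hj, hcw j hj, hmc j hj]
      simp
    · simp only [Function.update_self, if_true]
      exact ⟨halt m, halt w', hmw⟩

/-- A permutation with non-zero product maps pairs to pairs, so it is a permutation `ρ` of the pairs
composed with swaps inside them. The former is even, as it acts on two copies of `Fin n`; each swap
changes the sign once in the permutation and once in `J`. -/
theorem sign_mul_prod_of_pairing {J : Fin n × Fin 2 → Fin n × Fin 2 → ℂ}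
    (hJ : ∀ i j, J (i, 0) (j, 0) = 0 ∧ J (i, 1) (j, 1) = 0 ∧
      J (i, 0) (j, 1) = (if i = j then 1 else 0) ∧ J (i, 1) (j, 0) = (if i = j then -1 else 0))
    (σ : Equiv.Perm (Fin n × Fin 2)) (h : ∏ i, J (σ (i, 0)) (σ (i, 1)) ≠ 0) :
    ((Equiv.Perm.sign σ : ℤ) : ℂ) * ∏ i, J (σ (i, 0)) (σ (i, 1)) = 1 := by
  have h1 : ∀ i, J (σ (i, 0)) (σ (i, 1)) ≠ 0 := fun i =>
    Finset.prod_ne_zero_iff.1 h i (Finset.mem_univ i)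
  have h2 : ∀ p q, J p q ≠ 0 → p.1 = q.1 := by
    rintro ⟨i, b⟩ ⟨j, c⟩ hne
    obtain ⟨e1, e2, e3, e4⟩ := hJ i j
    fin_cases b <;> fin_cases c <;> simp_all
  let ρ : Fin n → Fin n := fun i => (σ (i, 0)).1
  have hρ1 : ∀ i, (σ (i, 1)).1 = ρ i := fun i => (h2 _ _ (h1 i)).symm
  have hρ : ∀ i b, (σ (i, b)).1 = ρ i := fun i b => by
    fin_cases b
    · rfl
    · exact hρ1 i
  have hinj : Function.Injective ρ := by
    have hs : Function.Surjective ρ := fun j => by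
      refine ⟨(σ.symm (j, 0)).1, ?_⟩
      rw [← hρ _ (σ.symm (j, 0)).2]; simp
    exact Finite.injective_iff_surjective.2 hs
  let ρ' : Equiv.Perm (Fin n) := Equiv.ofBijective ρ (Finite.injective_iff_bijective.1 hinj)
  let τ : Fin n → Equiv.Perm (Fin 2) := fun i =>
    Equiv.ofBijective (fun b => (σ (i, b)).2) (Finite.injective_iff_bijective.1 fun b c hbc => by
      have : σ (i, b) = σ (i, c) := Prod.ext (by rw [hρ, hρ]) hbc
      exact (Prod.ext_iff.1 (σ.injective this)).2)
  have hσ : σ = (Equiv.prodCongr ρ' (Equiv.refl (Fin 2))) * Equiv.prodCongrRight τ := by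
    ext1 ⟨i, b⟩
    exact Prod.ext (hρ i b) rfl
  have hs1 : Equiv.Perm.sign (Equiv.prodCongr ρ' (Equiv.refl (Fin 2))) = 1 := by
    have e : Equiv.prodCongr ρ' (Equiv.refl (Fin 2)) =
        Equiv.prodCongrLeft (fun _ : Fin 2 => ρ') := by
      ext1 ⟨i, b⟩; rfl
    rw [e, Equiv.Perm.sign_prodCongrLeft]
    simp
  have hs : Equiv.Perm.sign σ = ∏ i, Equiv.Perm.sign (τ i) := by
    rw [hσ, map_mul, hs1, one_mul, Equiv.Perm.sign_prodCongrRight]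
  rw [hs]
  push_cast
  rw [← Finset.prod_mul_distrib]
  refine Finset.prod_eq_one fun i _ => ?_
  have e0 : σ (i, 0) = (ρ i, τ i 0) := Prod.ext rfl rfl
  have e1 : σ (i, 1) = (ρ i, τ i 1) := Prod.ext (hρ i 1) rfl
  rw [e0, e1]
  obtain ⟨f1, f2, f3, f4⟩ := hJ (ρ i) (ρ i)
  have : ∀ t : Equiv.Perm (Fin 2), t = 1 ∨ t = Equiv.swap 0 1 := by decide
  rcases this (τ i) with ht | ht <;> rw [ht] <;> simp [f3, f4]

/-- In a hyperbolic family every non-zero term of the sum equals `1`, so the sum counts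
permutations, among them the identity. A zero Pfaffian would make the alternating form vanish on
every family. -/
theorem pfaffian_ne_zero {β : (Fin (2 * n) → ℂ) →ₗ[ℂ] (Fin (2 * n) → ℂ) →ₗ[ℂ] ℂ}
    (halt : β.IsAlt) (hnd : β.Nondegenerate) : pfaffian (fun v w => β v w) ≠ 0 := by
  obtain ⟨a, c, h⟩ := exists_hyperbolic_pairs halt hnd n le_rfl
  let b : Fin n × Fin 2 → Fin (2 * n) → ℂ := fun k => if k.2 = 0 then a k.1 else c k.1
  have hJ : ∀ i j : Fin n, β (b (i, 0)) (b (j, 0)) = 0 ∧ β (b (i, 1)) (b (j, 1)) = 0 ∧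
      β (b (i, 0)) (b (j, 1)) = (if i = j then 1 else 0) ∧
      β (b (i, 1)) (b (j, 0)) = (if i = j then -1 else 0) := fun i j => by
    obtain ⟨h1, h2, h3⟩ := h i i.2 j j.2
    obtain ⟨-, -, h4⟩ := h j j.2 i i.2
    simp only [b, if_true, one_ne_zero, if_false]
    refine ⟨h1, h2, by simpa [Fin.ext_iff] using h3, ?_⟩
    rw [← halt.neg, h4]
    by_cases hij : i = j
    · simp [hij]
    · rw [if_neg fun hh => hij (Fin.ext hh.symm), if_neg hij, neg_zero]
  intro h0
  have hz : altForm β n b = 0 := by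
    rw [(altForm β n).eq_smul_basis_det (pairBasis n), ← pfaffian_eq, h0, zero_smul]; rfl
  rw [altForm_apply] at hz
  have key : ∀ σ : Equiv.Perm (Fin n × Fin 2), ((Equiv.Perm.sign σ : ℤ) : ℂ) *
      ∏ i, β (b (σ (i, 0))) (b (σ (i, 1))) =
      if ∏ i, β (b (σ (i, 0))) (b (σ (i, 1))) ≠ 0 then 1 else 0 := fun σ => by
    split_ifs with hne
    · exact sign_mul_prod_of_pairing (J := fun p q => β (b p) (b q)) hJ σ hne
    · rw [not_not.1 hne, mul_zero]
  simp only [key] at hz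
  rw [Finset.sum_boole, Nat.cast_eq_zero, Finset.card_eq_zero, Finset.filter_eq_empty_iff] at hz
  refine hz (Finset.mem_univ 1) ?_
  simp [(hJ _ _).2.2.1]

end Pfaffian

/-! ### The generalised cross product, which spans the kernel of a surjection `ℂᵐ⁺¹ → ℂᵐ`. -/

section Cross

variable {m : ℕ}

/-- The generalised cross product of the rows of a matrix with one more column than rows. -/
noncomputable def cross (q : (Fin (m + 1) → ℂ) →ₗ[ℂ] (Fin m → ℂ)) : Fin (m + 1) → ℂ :=
  fun k => (-1) ^ (k : ℕ) * ((LinearMap.toMatrix' q).submatrix id k.succAbove).det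

/-- The matrix with first row `ξ` and remaining rows those of `A`. -/
def consRow (ξ : Fin (m + 1) → ℂ) (A : Matrix (Fin m) (Fin (m + 1)) ℂ) :
    Matrix (Fin (m + 1)) (Fin (m + 1)) ℂ :=
  fun i => Fin.cases (motive := fun _ => Fin (m + 1) → ℂ) ξ A i

theorem consRow_zero (ξ : Fin (m + 1) → ℂ) (A : Matrix (Fin m) (Fin (m + 1)) ℂ) :
    consRow ξ A 0 = ξ := rfl

theorem consRow_succ (ξ : Fin (m + 1) → ℂ) (A : Matrix (Fin m) (Fin (m + 1)) ℂ) (i : Fin m) :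
    consRow ξ A i.succ = A i := rfl

/-- Laplace expansion along the first row. All properties of the cross product are read off from
these determinants. -/
theorem dotProduct_cross (q : (Fin (m + 1) → ℂ) →ₗ[ℂ] (Fin m → ℂ)) (ξ : Fin (m + 1) → ℂ) :
    ξ ⬝ᵥ cross q = (consRow ξ (LinearMap.toMatrix' q)).det := by
  rw [Matrix.det_succ_row_zero]
  refine Finset.sum_congr rfl fun k _ => ?_
  have : (consRow ξ (LinearMap.toMatrix' q)).submatrix Fin.succ k.succAbove =
      (LinearMap.toMatrix' q).submatrix id k.succAbove := rfl
  rw [this, cross, consRow_zero]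
  ring

theorem toMatrix'_dotProduct {r : ℕ} (q : (Fin r → ℂ) →ₗ[ℂ] (Fin m → ℂ)) (i : Fin m)
    (v : Fin r → ℂ) : LinearMap.toMatrix' q i ⬝ᵥ v = q v i := by
  conv_rhs => rw [← Matrix.toLin'_toMatrix' q]
  rfl

theorem apply_cross (q : (Fin (m + 1) → ℂ) →ₗ[ℂ] (Fin m → ℂ)) : q (cross q) = 0 := by
  funext i
  rw [← toMatrix'_dotProduct, dotProduct_cross]
  exact Matrix.det_zero_of_row_eq (i := 0) (j := i.succ) (Fin.succ_ne_zero i).symm rfl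

/-- The kernel of a surjective map `ℂᵐ⁺¹ → ℂᵐ` is spanned by any non-zero element. -/
theorem exists_smul_eq_of_ker {q : (Fin (m + 1) → ℂ) →ₗ[ℂ] (Fin m → ℂ)}
    (hq : Function.Surjective q) {e : Fin (m + 1) → ℂ} (he : q e = 0) (he0 : e ≠ 0)
    {v : Fin (m + 1) → ℂ} (hv : q v = 0) : ∃ c : ℂ, v = c • e := by
  have h1 := LinearMap.finrank_range_add_finrank_ker q
  rw [LinearMap.range_eq_top.2 hq, finrank_top] at h1
  simp only [Module.finrank_fintype_fun_eq_card, Fintype.card_fin] at h1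
  have h2 : Module.finrank ℂ (LinearMap.ker q) = 1 := by omega
  obtain ⟨c, hc⟩ := (finrank_eq_one_iff_of_nonzero' (⟨e, he⟩ : LinearMap.ker q)
    (fun h => he0 (congrArg Subtype.val h))).1 h2 ⟨v, hv⟩
  exact ⟨c, (congrArg Subtype.val hc).symm⟩

/-- Put above the rows of `q` a coordinate functional which does not vanish on the kernel line: the
resulting square matrix is injective. -/
theorem cross_ne_zero {q : (Fin (m + 1) → ℂ) →ₗ[ℂ] (Fin m → ℂ)} (hq : Function.Surjective q) :
    cross q ≠ 0 := by
  intro h0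
  obtain ⟨k, hk, hk0⟩ := (LinearMap.ker q).ne_bot_iff.1
    (LinearMap.ker_ne_bot_of_finrank_lt (f := q) (by simp))
  obtain ⟨l, hl⟩ := Function.ne_iff.1 hk0
  have hdet : (consRow (Pi.single l 1) (LinearMap.toMatrix' q)).det ≠ 0 := by
    intro hd
    obtain ⟨w, hw0, hw⟩ := Matrix.exists_mulVec_eq_zero_iff.2 hd
    have h1 : w l = 0 := by
      have := congrFun hw 0
      rw [Matrix.mulVec, consRow_zero, single_dotProduct, one_mul] at this
      exact this
    have h2 : q w = 0 := funext fun i => by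
      have := congrFun hw i.succ
      rw [Matrix.mulVec, consRow_succ, toMatrix'_dotProduct] at this
      exact this
    obtain ⟨c, rfl⟩ := exists_smul_eq_of_ker hq hk hk0 h2
    refine hw0 ?_
    rw [(mul_eq_zero.1 h1).resolve_right hl, zero_smul]
  rw [← dotProduct_cross, h0, dotProduct_zero] at hdet
  exact hdet rfl

theorem cross_comp_left (q : (Fin (m + 1) → ℂ) →ₗ[ℂ] (Fin m → ℂ))
    (g : (Fin m → ℂ) →ₗ[ℂ] (Fin m → ℂ)) : cross (g ∘ₗ q) = LinearMap.det g • cross q := by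
  funext k
  have : (LinearMap.toMatrix' (g ∘ₗ q)).submatrix id k.succAbove =
      LinearMap.toMatrix' g * (LinearMap.toMatrix' q).submatrix id k.succAbove := by
    rw [LinearMap.toMatrix'_comp]; rfl
  simp only [cross, this, Matrix.det_mul, LinearMap.det_toMatrix', Pi.smul_apply, smul_eq_mul]
  ring

/-- Together with `cross_comp_left` this is the change of frame that makes the cross product a
canonical isomorphism of `ker q` with `det V ⊗ (det E)⁻¹`. For each functional `ξ` it is
multiplicativity of the determinant. -/
theorem apply_cross_comp (q : (Fin (m + 1) → ℂ) →ₗ[ℂ] (Fin m → ℂ))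
    (h : (Fin (m + 1) → ℂ) →ₗ[ℂ] (Fin (m + 1) → ℂ)) :
    h (cross (q ∘ₗ h)) = LinearMap.det h • cross q := by
  have key : ∀ ξ : Fin (m + 1) → ℂ, ξ ⬝ᵥ h (cross (q ∘ₗ h)) = ξ ⬝ᵥ (LinearMap.det h • cross q) := by
    intro ξ
    have h1 : h (cross (q ∘ₗ h)) = Matrix.mulVec (LinearMap.toMatrix' h) (cross (q ∘ₗ h)) :=
      funext fun i => (toMatrix'_dotProduct h i _).symm
    rw [h1, Matrix.dotProduct_mulVec, dotProduct_cross, dotProduct_smul, dotProduct_cross,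
      smul_eq_mul, mul_comm, ← LinearMap.det_toMatrix' h, ← Matrix.det_mul]
    congr 1
    ext i j
    refine Fin.cases rfl (fun i => ?_) i
    rw [consRow_succ, LinearMap.toMatrix'_comp]
    rfl
  funext k
  simpa using key (Pi.single k 1)

end Cross

/-! ### Linear algebra of an endomorphism skew for a symplectic form. -/

section SkewLinearAlgebra

variable {n : ℕ} {om : (Fin (2 * n) → ℂ) →ₗ[ℂ] (Fin (2 * n) → ℂ) →ₗ[ℂ] ℂ}
  {Φ : (Fin (2 * n) → ℂ) →ₗ[ℂ] (Fin (2 * n) → ℂ)}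

/-- A non-degenerate bilinear form as an isomorphism to the dual space. -/
noncomputable def formEquivDual (hnd : om.Nondegenerate) :
    (Fin (2 * n) → ℂ) ≃ₗ[ℂ] Module.Dual ℂ (Fin (2 * n) → ℂ) :=
  LinearEquiv.ofInjectiveOfFinrankEq om
    (LinearMap.ker_eq_bot.1 (LinearMap.separatingLeft_iff_ker_eq_bot.1 hnd.1))
    (Subspace.dual_finrank_eq).symm

theorem exists_form_eq (hnd : om.Nondegenerate) (f : Module.Dual ℂ (Fin (2 * n) → ℂ)) :
    ∃ k, om k = f := ⟨(formEquivDual hnd).symm f, (formEquivDual hnd).apply_symm_apply f⟩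

/-- The form, as an isomorphism to the dual space, conjugates `A` to the transpose of `B`. -/
theorem det_eq_of_adjoint (hnd : om.Nondegenerate)
    {A B : (Fin (2 * n) → ℂ) →ₗ[ℂ] (Fin (2 * n) → ℂ)} (h : ∀ v w, om (A v) w = om v (B w)) :
    LinearMap.det A = LinearMap.det B := by
  have h1 : B.dualMap = (formEquivDual hnd : _ →ₗ[ℂ] _) ∘ₗ A ∘ₗ (formEquivDual hnd).symm := by
    refine LinearMap.ext fun f => ?_
    obtain ⟨k, rfl⟩ := (formEquivDual hnd).surjective f
    refine LinearMap.ext fun w => ?_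
    simp only [LinearMap.comp_apply, LinearEquiv.coe_coe, LinearEquiv.symm_apply_apply]
    exact (h k w).symm
  rw [← LinearMap.det_dualMap B, h1, LinearMap.det_conj]

/-- The adjoint of `t - Φ` is `t + Φ`, so in even dimension `p(-t) = p(t)` and `p'(0) = 0`. -/
theorem charpoly_coeff_one_eq_zero (hnd : om.Nondegenerate)
    (hc : ∀ v w, om (Φ v) w + om v (Φ w) = 0) : Φ.charpoly.coeff 1 = 0 := by
  have h1 : Φ.charpoly.comp (-Polynomial.X) = Φ.charpoly := by
    refine Polynomial.funext fun t => ?_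
    rw [Polynomial.eval_comp, LinearMap.eval_charpoly, LinearMap.eval_charpoly]
    have h2 : algebraMap ℂ (Module.End ℂ (Fin (2 * n) → ℂ)) (Polynomial.eval t (-Polynomial.X)) - Φ
        = (-1 : ℂ) • (algebraMap ℂ (Module.End ℂ (Fin (2 * n) → ℂ)) t + Φ) := by
      simp [sub_eq_add_neg, add_comm]
    rw [h2, LinearMap.det_smul]
    simp only [Module.finrank_fintype_fun_eq_card, Fintype.card_fin, pow_mul, neg_one_sq, one_pow,
      one_mul]
    refine det_eq_of_adjoint hnd fun v w => ?_
    have := hc v w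
    simp only [LinearMap.add_apply, LinearMap.sub_apply, Module.algebraMap_end_apply, map_add,
      map_sub, map_smul, LinearMap.smul_apply]
    linear_combination this
  have h2 := congrArg (fun p => (Polynomial.derivative p).eval 0) h1
  simp only [Polynomial.derivative_comp, Polynomial.derivative_neg, Polynomial.derivative_X,
    Polynomial.eval_mul, Polynomial.eval_comp, Polynomial.eval_neg, Polynomial.eval_X,
    Polynomial.eval_one, neg_zero] at h2
  rw [← Polynomial.coeff_zero_eq_eval_zero, Polynomial.coeff_derivative] at h2
  norm_num at h2
  linear_combination (-1 / 2) * h2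

/-- The image of a skew map is the orthogonal space of its kernel. -/
theorem exists_eq_of_orthogonal_ker (hnd : om.Nondegenerate)
    (hc : ∀ v w, om (Φ v) w + om v (Φ w) = 0) {w : Fin (2 * n) → ℂ}
    (hw : ∀ k, Φ k = 0 → om k w = 0) : ∃ v, Φ v = w := by
  by_contra hne
  -- A functional vanishing on the image but not at `w` is `ω(k, ·)` for some `k`; by skewness `k`
  -- lies in the kernel.
  obtain ⟨f, hf1, hf2⟩ := Submodule.exists_le_ker_of_notMem
    (p := LinearMap.range Φ) (v := w) hne
  obtain ⟨k, rfl⟩ := exists_form_eq hnd f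
  refine hf1 (hw k (hnd.1 _ fun v => ?_))
  have h1 : om k (Φ v) = 0 := hf2 ⟨v, rfl⟩
  linear_combination hc k v - h1

end SkewLinearAlgebra

/-! ### The adjugate, which controls the dimension of the kernel. -/

section Adjugate

variable {r : ℕ}

/-- The adjugate of an endomorphism of `ℂʳ`. -/
noncomputable def adjugateMap (Φ : (Fin r → ℂ) →ₗ[ℂ] (Fin r → ℂ)) :
    (Fin r → ℂ) →ₗ[ℂ] (Fin r → ℂ) :=
  Matrix.toLin' (LinearMap.toMatrix' Φ).adjugate

theorem adjugateMap_comp (Φ : (Fin r → ℂ) →ₗ[ℂ] (Fin r → ℂ)) (v : Fin r → ℂ) :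
    adjugateMap Φ (Φ v) = LinearMap.det Φ • v := by
  have : adjugateMap Φ ∘ₗ Φ = LinearMap.det Φ • LinearMap.id := by
    conv_lhs => rw [← Matrix.toLin'_toMatrix' Φ]
    rw [adjugateMap, LinearMap.toMatrix'_toLin', ← Matrix.toLin'_mul, Matrix.adjugate_mul,
      LinearMap.det_toMatrix', map_smul, Matrix.toLin'_one]
  exact LinearMap.congr_fun this v

theorem comp_adjugateMap (Φ : (Fin r → ℂ) →ₗ[ℂ] (Fin r → ℂ)) (v : Fin r → ℂ) :
    Φ (adjugateMap Φ v) = LinearMap.det Φ • v := by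
  have : Φ ∘ₗ adjugateMap Φ = LinearMap.det Φ • LinearMap.id := by
    conv_lhs => rw [← Matrix.toLin'_toMatrix' Φ]
    rw [adjugateMap, LinearMap.toMatrix'_toLin', ← Matrix.toLin'_mul, Matrix.mul_adjugate,
      LinearMap.det_toMatrix', map_smul, Matrix.toLin'_one]
  exact LinearMap.congr_fun this v

theorem adjugateMap_single (Φ : (Fin r → ℂ) →ₗ[ℂ] (Fin r → ℂ)) (i j : Fin r) :
    adjugateMap Φ (Pi.single j 1) i =
      ((LinearMap.toMatrix' Φ).updateRow j (Pi.single i 1)).det := by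
  rw [adjugateMap, Matrix.toLin'_apply, Matrix.mulVec_single_one, ← Matrix.adjugate_apply]
  rfl

/-- If the adjugate is non-zero, the kernel is at most one-dimensional. -/
theorem exists_smul_eq_of_adjugateMap {Φ : (Fin r → ℂ) →ₗ[ℂ] (Fin r → ℂ)} {v : Fin r → ℂ}
    (h : adjugateMap Φ v ≠ 0) {k k' : Fin r → ℂ} (hk : Φ k = 0) (hk0 : k ≠ 0) (hk' : Φ k' = 0) :
    ∃ c : ℂ, k' = c • k := by
  by_contra! hne
  refine h ?_
  have hz : adjugateMap Φ = 0 := by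
    refine (Pi.basisFun ℂ (Fin r)).ext fun j => ?_
    funext i
    rw [Pi.basisFun_apply, adjugateMap_single]
    -- Two independent kernel vectors have a non-zero combination with vanishing `i`-th coordinate.
    -- It is annihilated by the matrix with row `j` replaced by the `i`-th unit vector, so that
    -- cofactor is zero.
    have key : ∃ v : Fin r → ℂ, v ≠ 0 ∧ Φ v = 0 ∧ v i = 0 := by
      by_cases hi : k i = 0
      · exact ⟨k, hk0, hk, hi⟩
      · refine ⟨k' - (k' i / k i) • k, sub_ne_zero.2 (hne _), by simp [hk, hk'], ?_⟩
        simp [hi]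
    obtain ⟨v, hv0, hv, hvi⟩ := key
    refine Matrix.exists_mulVec_eq_zero_iff.1 ⟨v, hv0, ?_⟩
    funext l
    by_cases hl : l = j
    · subst hl
      rw [Matrix.mulVec, Matrix.updateRow_self, single_dotProduct, one_mul, hvi]; rfl
    · rw [Matrix.mulVec, Matrix.updateRow_ne hl, toMatrix'_dotProduct, hv]
  rw [hz]; rfl

theorem HolHomAt.adjugateMap {X : Type u} [TopologicalSpace X] [ChartedSpace ℂ X]
    {T : X → (Fin r → ℂ) →ₗ[ℂ] (Fin r → ℂ)} {x : X}
    (h : HolHomAt T x) : HolHomAt (fun y => HeckeHiggs.adjugateMap (T y)) x := by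
  refine HolHomAt.of_basis (Pi.basisFun ℂ (Fin r)) fun j => holAt_pi.2 fun i => ?_
  simp only [Pi.basisFun_apply, adjugateMap_single]
  refine HolAt.det fun k l => ?_
  by_cases hk : k = j
  · subst hk
    simp only [Matrix.updateRow_self]
    exact holAt_const _ x
  · simp only [Matrix.updateRow_ne hk, LinearMap.toMatrix'_apply]
    exact holAt_pi.1 (h _ (holAt_const _ x)) k

end Adjugate

section Kernel

variable {n : ℕ} {om : (Fin (2 * n) → ℂ) →ₗ[ℂ] (Fin (2 * n) → ℂ) →ₗ[ℂ] ℂ}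
  {Φ : (Fin (2 * n) → ℂ) →ₗ[ℂ] (Fin (2 * n) → ℂ)}

/-- If `ψ` were orthogonal to the kernel line it would be some `Φw`, and then `adj(Φ)ψ = det(Φ)w =
0`. -/
theorem form_ne_zero_of_adjugateMap (hnd : om.Nondegenerate)
    (hc : ∀ v w, om (Φ v) w + om v (Φ w) = 0) (hdet : LinearMap.det Φ = 0)
    {k ψ : Fin (2 * n) → ℂ} {α : ℂ} (hk : Φ k = 0) (hk0 : k ≠ 0) (hα : α ≠ 0)
    (hψ : adjugateMap Φ ψ = α • k) : om k ψ ≠ 0 := by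
  intro h0
  have hne : adjugateMap Φ ψ ≠ 0 := by rw [hψ]; exact smul_ne_zero hα hk0
  obtain ⟨w, rfl⟩ := exists_eq_of_orthogonal_ker (w := ψ) hnd hc fun k' hk' => by
    obtain ⟨c, rfl⟩ := exists_smul_eq_of_adjugateMap hne hk hk0 hk'
    simp [h0]
  rw [adjugateMap_comp, hdet, zero_smul] at hne
  exact hne rfl

end Kernel

/-! ### Pfaffians and cross products depend holomorphically on the point. -/

section HolPfaffianCross

variable {X : Type u} [TopologicalSpace X] [ChartedSpace ℂ X]

theorem HolFormAt.pfaffian {n : ℕ} {β : X → (Fin (2 * n) → ℂ) →ₗ[ℂ] (Fin (2 * n) → ℂ) →ₗ[ℂ] ℂ}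
    {x : X} (h : HolFormAt β x) : HolAt (fun y => HeckeHiggs.pfaffian (fun v w => β y v w)) x :=
  HolAt.sum fun _ _ => (holAt_const _ x).mul
    (HolAt.prod' fun _ _ => h _ _ (holAt_const _ x) (holAt_const _ x))

theorem HolHomAt.cross {m : ℕ} {q : X → (Fin (m + 1) → ℂ) →ₗ[ℂ] (Fin m → ℂ)} {x : X}
    (h : HolHomAt q x) : HolAt (fun y => HeckeHiggs.cross (q y)) x := by
  refine holAt_pi.2 fun k => (holAt_const _ x).mul (HolAt.det fun i j => ?_)
  simp only [Matrix.submatrix_apply, LinearMap.toMatrix'_apply]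
  exact holAt_pi.1 (h _ (holAt_const _ x)) _

end HolPfaffianCross

/-! ### Simple zeros of `a_{2n}`, local Hecke data and their existence. -/

section LocalHiggs

variable {X : Type u} [TopologicalSpace X] [ChartedSpace ℂ X] {L : HolBundle X ℂ}
  {n : ℕ} {E : HolBundle X (Fin (2 * n) → ℂ)}

/-- The Higgs field in the frames at `x`. -/
noncomputable def higgsAt (Φ : BundleHom E (twist L 1 E)) (x y : X) :
    (Fin (2 * n) → ℂ) →ₗ[ℂ] (Fin (2 * n) → ℂ) :=
  locHom E (twist L 1 E) Φ x y

/-- The symplectic form in the frames at `x`. -/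
noncomputable def formAt (om : BundleForm E L) (x y : X) :
    (Fin (2 * n) → ℂ) →ₗ[ℂ] (Fin (2 * n) → ℂ) →ₗ[ℂ] ℂ :=
  locForm E L om x y

/-- The characteristic coefficient `a_{2n}` in the frame at `x`. -/
noncomputable def coeffAt (Φ : BundleHom E (twist L 1 E)) (x y : X) : ℂ :=
  lineFactor L x y ^ (2 * n) * charCoeff Φ (2 * n) y

theorem higgsAt_apply (Φ : BundleHom E (twist L 1 E)) (x y : X) (v : Fin (2 * n) → ℂ) :
    higgsAt Φ x y v = lineFactor L x y • E.toFrame x y (Φ y (E.fromFrame x y v)) := by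
  rw [higgsAt, locHom_apply, toFrame_twist, zpow_one]

theorem fromFrame_higgsAt (Φ : BundleHom E (twist L 1 E)) {x y : X} (hy : y ∈ E.frameSet x)
    (v : Fin (2 * n) → ℂ) :
    E.fromFrame x y (higgsAt Φ x y v) = lineFactor L x y • Φ y (E.fromFrame x y v) := by
  rw [higgsAt_apply, map_smul, E.fromFrame_toFrame hy]

theorem formAt_apply (om : BundleForm E L) (x y : X) (v w : Fin (2 * n) → ℂ) :
    formAt om x y v w = lineFactor L x y * om y (E.fromFrame x y v) (E.fromFrame x y w) := rfl

@[simp] theorem higgsAt_self (Φ : BundleHom E (twist L 1 E)) (x : X) : higgsAt Φ x x = Φ x :=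
  locHom_self _ _ _ _

@[simp] theorem formAt_self (om : BundleForm E L) (x : X) : formAt om x x = om x :=
  locForm_self _ _ _ _

@[simp] theorem coeffAt_self (Φ : BundleHom E (twist L 1 E)) (x : X) :
    coeffAt Φ x x = charCoeff Φ (2 * n) x := by simp [coeffAt]

theorem det_toFrame_mul {r : ℕ} (B : HolBundle X (Fin r → ℂ)) {x y : X} (hy : y ∈ B.frameSet x) :
    LinearMap.det (B.toFrame x y : (Fin r → ℂ) →ₗ[ℂ] _) *
      LinearMap.det (B.fromFrame x y : (Fin r → ℂ) →ₗ[ℂ] _) = 1 := by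
  rw [← LinearMap.det_comp]
  have : (B.toFrame x y : (Fin r → ℂ) →ₗ[ℂ] _) ∘ₗ (B.fromFrame x y : (Fin r → ℂ) →ₗ[ℂ] _) =
      LinearMap.id := LinearMap.ext fun v => B.toFrame_fromFrame hy v
  rw [this, LinearMap.det_id]

theorem coeff_zero_charpoly (A : (Fin (2 * n) → ℂ) →ₗ[ℂ] (Fin (2 * n) → ℂ)) :
    A.charpoly.coeff 0 = LinearMap.det A := by
  rw [LinearMap.det_eq_sign_charpoly_coeff]
  simp [pow_mul]

theorem charCoeff_eq_det (Φ : BundleHom E (twist L 1 E)) (x : X) :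
    charCoeff Φ (2 * n) x = LinearMap.det (Φ x) := by
  rw [charCoeff, charPoly, Nat.sub_self, coeff_zero_charpoly]

theorem det_higgsAt (Φ : BundleHom E (twist L 1 E)) {x y : X} (hy : y ∈ E.frameSet x) :
    LinearMap.det (higgsAt Φ x y) = coeffAt Φ x y := by
  have : higgsAt Φ x y = lineFactor L x y • ((E.toFrame x y : (Fin (2 * n) → ℂ) →ₗ[ℂ] _) ∘ₗ
      Φ y ∘ₗ (E.fromFrame x y : (Fin (2 * n) → ℂ) →ₗ[ℂ] _)) :=
    LinearMap.ext fun v => higgsAt_apply Φ x y v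
  rw [this, LinearMap.det_smul, LinearMap.det_comp, LinearMap.det_comp, coeffAt, charCoeff_eq_det]
  simp only [Module.finrank_fintype_fun_eq_card, Fintype.card_fin]
  linear_combination (lineFactor L x y ^ (2 * n) * LinearMap.det (Φ y)) * det_toFrame_mul E hy

theorem coeffAt_eq_zero_iff (Φ : BundleHom E (twist L 1 E)) {x y : X} (hy : y ∈ L.frameSet x) :
    coeffAt Φ x y = 0 ↔ y ∈ zeroSet Φ := by
  rw [coeffAt, mul_eq_zero, or_iff_right (pow_ne_zero _ (lineFactor_ne_zero L hy))]
  rfl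

theorem formAt_isAlt {Φ : BundleHom E (twist L 1 E)} {om : BundleForm E L}
    (hE : IsSpHiggs E Φ om) (x y : X) : (formAt om x y).IsAlt := fun v => by
  rw [formAt_apply, hE.alt y, mul_zero]

theorem formAt_higgsAt {Φ : BundleHom E (twist L 1 E)} {om : BundleForm E L}
    (hE : IsSpHiggs E Φ om) {x y : X} (hy : y ∈ E.frameSet x) (v w : Fin (2 * n) → ℂ) :
    formAt om x y (higgsAt Φ x y v) w + formAt om x y v (higgsAt Φ x y w) = 0 := by
  have := hE.compat y (E.fromFrame x y v) (E.fromFrame x y w)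
  simp only [formAt_apply, fromFrame_higgsAt Φ hy, map_smul, LinearMap.smul_apply, smul_eq_mul]
  linear_combination lineFactor L x y ^ 2 * this

open Classical in
/-- The coordinate `ζ` of the local form of the Hecke modification. -/
noncomputable def heckeCoord (Φ : BundleHom E (twist L 1 E)) (x y : X) : ℂ :=
  -- The value `1`, together with `u = 0` in `heckeVec`, makes the Hecke frame the identity for `x`
  -- off `D`, so that no later statement has to distinguish the two kinds of points.
  if x ∈ zeroSet Φ then centredCoord x y else 1

open Classical in
/-- The vector `u` of the local form of the Hecke modification. -/
noncomputable def heckeVec (Φ : BundleHom E (twist L 1 E))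
    (i : X → ℂ →ₗ[ℂ] (Fin (2 * n) → ℂ)) (x : X) : Fin (2 * n) → ℂ :=
  if x ∈ zeroSet Φ then i x 1 else 0

theorem heckeCoord_of_notMem {Φ : BundleHom E (twist L 1 E)} {x : X} (hx : x ∉ zeroSet Φ) (y : X) :
    heckeCoord Φ x y = 1 := if_neg hx

theorem heckeCoord_of_mem {Φ : BundleHom E (twist L 1 E)} {x : X} (hx : x ∈ zeroSet Φ) (y : X) :
    heckeCoord Φ x y = centredCoord x y := if_pos hx

theorem heckeVec_of_notMem {Φ : BundleHom E (twist L 1 E)} {i : X → ℂ →ₗ[ℂ] (Fin (2 * n) → ℂ)}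
    {x : X} (hx : x ∉ zeroSet Φ) : heckeVec Φ i x = 0 := if_neg hx

theorem heckeVec_of_mem {Φ : BundleHom E (twist L 1 E)} {i : X → ℂ →ₗ[ℂ] (Fin (2 * n) → ℂ)}
    {x : X} (hx : x ∈ zeroSet Φ) : heckeVec Φ i x = i x 1 := if_pos hx

theorem det_ne_zero_of_notMem {Φ : BundleHom E (twist L 1 E)} {x : X} (hx : x ∉ zeroSet Φ) :
    LinearMap.det (Φ x) ≠ 0 := by
  rw [← charCoeff_eq_det]; exact hx

theorem det_eq_zero_of_mem {Φ : BundleHom E (twist L 1 E)} {x : X} (hx : x ∈ zeroSet Φ) :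
    LinearMap.det (Φ x) = 0 := by
  rw [← charCoeff_eq_det]; exact hx

theorem bijective_of_notMem {Φ : BundleHom E (twist L 1 E)} {x : X} (hx : x ∉ zeroSet Φ) :
    Function.Bijective (Φ x) :=
  (Module.End.isUnit_iff _).1 ((LinearMap.isUnit_iff_isUnit_det _).2 (det_ne_zero_of_notMem hx).isUnit)

theorem eventually_heckeCoord_ne_zero (Φ : BundleHom E (twist L 1 E)) (x : X) :
    ∀ᶠ y in 𝓝 x, y ∉ zeroSet Φ → heckeCoord Φ x y ≠ 0 := by
  by_cases hx : x ∈ zeroSet Φ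
  · filter_upwards [eventually_centredCoord_ne_zero x] with y hy hyD
    rw [heckeCoord_of_mem hx]
    exact hy fun h => hyD (h ▸ hx)
  · exact .of_forall fun y _ => by rw [heckeCoord_of_notMem hx]; exact one_ne_zero

theorem localDeriv_smul (Φ : BundleHom E (twist L 1 E)) (x : X) (c : ℂ) (k : Fin (2 * n) → ℂ) :
    (twist L 1 E).localDeriv x (fun y => Φ y (E.constSection (E.core.indexAt x) (c • k) y)) =
      c • (twist L 1 E).localDeriv x
        (fun y => Φ y (E.constSection (E.core.indexAt x) k y)) := by
  rw [HolBundle.localDeriv, HolBundle.localDeriv, ← deriv_const_smul_field]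
  congr 1
  funext z
  simp only [HolBundle.coord, HolBundle.constSection, map_smul]
  rfl

/-- Hecke data, given by the images `u x` of the basis vectors of the fibres of `L⁻ⁿ`. -/
theorem isHeckeData_of_vector {Φ : BundleHom E (twist L 1 E)} {om : BundleForm E L}
    {u : X → Fin (2 * n) → ℂ} (h : ∀ x ∈ zeroSet Φ, u x ≠ 0 ∧ Φ x (u x) = 0 ∧
      ∃ (α : ℂ) (ψ : Fin (2 * n) → ℂ), α ≠ 0 ∧ adjugateMap (Φ x) ψ = α • u x ∧ om x (u x) ψ = -α ∧
        ψ = (twist L 1 E).localDeriv x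
          (fun y => Φ y (E.constSection (E.core.indexAt x) (u x) y)) ∧
        α = (linePow L (2 * n : ℕ)).localDeriv x (charCoeff Φ (2 * n))) :
    IsHeckeData Φ om (fun x => LinearMap.toSpanSingleton ℂ _ (u x)) where
  injective x hx := smul_left_injective ℂ (h x hx).1
  range_eq x hx := by
    obtain ⟨hu0, hu, α, ψ, hα0, hψ, -⟩ := h x hx
    ext c
    constructor
    · rintro ⟨t, rfl⟩
      simp [hu]
    · intro hc
      obtain ⟨t, rfl⟩ := exists_smul_eq_of_adjugateMap (v := ψ)
        (by rw [hψ]; exact smul_ne_zero hα0 hu0) hu hu0 hc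
      exact ⟨t, by simp⟩
  residue x hx w := by
    obtain ⟨-, -, α, ψ, -, -, hres, hψ, hα⟩ := h x hx
    rw [LinearMap.toSpanSingleton_apply, localDeriv_smul, ← hψ, ← hα]
    simp only [map_smul, LinearMap.smul_apply, smul_eq_mul, hres]
    ring

variable [IsManifold 𝓘(ℂ) ω X]

theorem holHomAt_higgsAt (Φ : BundleHom E (twist L 1 E)) (x : X) : HolHomAt (higgsAt Φ x) x :=
  Φ.holHomAt x

theorem holFormAt_formAt (om : BundleForm E L) (x : X) : HolFormAt (formAt om x) x :=
  om.holFormAt x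

theorem holAt_coeffAt (Φ : BundleHom E (twist L 1 E)) (x : X) : HolAt (coeffAt Φ x) x :=
  (holHomAt_higgsAt Φ x).det.congr
    ((E.eventually_mem_frameSet x).mono fun _ hy => (det_higgsAt Φ hy).symm)

/-- On a smooth spectral curve the coefficient `a_{2n}` has only simple zeros. -/
theorem exists_coeffAt_eq {Φ : BundleHom E (twist L 1 E)} {om : BundleForm E L}
    (hE : IsSpHiggs E Φ om) (hS : SmoothSpectralCurve Φ) {x : X} (hx : x ∈ zeroSet Φ) :
    ∃ α : X → ℂ, HolAt α x ∧ α x ≠ 0 ∧ (∀ᶠ y in 𝓝 x, coeffAt Φ x y = centredCoord x y * α y) ∧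
      α x = (linePow L (2 * n : ℕ)).localDeriv x (charCoeff Φ (2 * n)) := by
  obtain ⟨α, h1, h2, h3⟩ := (holAt_coeffAt Φ x).exists_eq_smul (by rw [coeffAt_self]; exact hx)
  have hloc : ∀ y, (localCharPoly Φ x y).eval 0 = coeffAt Φ x y := fun y => by
    rw [← Polynomial.coeff_zero_eq_eval_zero, localCharPoly, coeff_zero_charpoly,
      LinearMap.det_smul, coeffAt, charCoeff_eq_det]
    simp only [Module.finrank_fintype_fun_eq_card, Fintype.card_fin]
    rfl
  have hself : localCharPoly Φ x x = (Φ x).charpoly := by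
    rw [localCharPoly]
    congr 1
    exact (congrArg (fun c : ℂ => c • Φ x) (lineFactor_self L x)).trans (one_smul ℂ _)
  refine ⟨α, h1, ?_, h2, ?_⟩
  · have h4 := hS x 0 (by rw [hloc, coeffAt_self]; exact hx)
    simp only [hloc] at h4
    rw [h3]
    -- The `λ`-derivative at `λ = 0` is `a_{2n-1}(x) = 0`, so smoothness must come from the
    -- derivative of `a_{2n}` along `X`.
    refine h4.resolve_left (not_not.2 ?_)
    rw [hself, ← Polynomial.coeff_zero_eq_eval_zero, Polynomial.coeff_derivative,
      charpoly_coeff_one_eq_zero (hE.nondegenerate x) (hE.compat x), zero_mul]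
  · rw [h3, HolBundle.localDeriv]
    congr 1

theorem eventually_mem_zeroSet {Φ : BundleHom E (twist L 1 E)} {om : BundleForm E L}
    (hE : IsSpHiggs E Φ om) (hS : SmoothSpectralCurve Φ) (x : X) :
    ∀ᶠ y in 𝓝 x, y ∈ zeroSet Φ → y = x := by
  by_cases hx : x ∈ zeroSet Φ
  · obtain ⟨α, h1, h2, h3, -⟩ := exists_coeffAt_eq hE hS hx
    filter_upwards [h3, h1.continuousAt.eventually_ne h2, eventually_centredCoord_ne_zero x,
      L.eventually_mem_frameSet x] with y e1 e2 e3 e4 hy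
    by_contra hne
    rw [← coeffAt_eq_zero_iff Φ e4, e1] at hy
    exact mul_ne_zero (e3 hne) e2 hy
  · have h : coeffAt Φ x x ≠ 0 := by rw [coeffAt_self]; exact hx
    filter_upwards [(holAt_coeffAt Φ x).continuousAt.eventually_ne h,
      L.eventually_mem_frameSet x] with y e1 e2 hy
    exact absurd ((coeffAt_eq_zero_iff Φ e2).2 hy) e1

/-- Two continuous functions which agree off the zeros of `a_{2n}` agree everywhere. -/
theorem eq_of_eventuallyEq_zeroSet {Φ : BundleHom E (twist L 1 E)} {om : BundleForm E L}
    (hE : IsSpHiggs E Φ om) (hS : SmoothSpectralCurve Φ) {A : Type*} [TopologicalSpace A]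
    [T2Space A] {f g : X → A} {x : X} (hf : ContinuousAt f x) (hg : ContinuousAt g x)
    (h : ∀ᶠ y in 𝓝 x, y ∉ zeroSet Φ → f y = g y) : f x = g x := by
  refine eq_of_eventuallyEq_off hf hg ?_
  filter_upwards [h, eventually_mem_zeroSet hE hS x] with y h1 h2 hne
  exact h1 fun hy => hne (h2 hy)

/-- At a zero of `a_{2n}`, the Higgs field applied to an element of its kernel. -/
theorem exists_higgsAt_eq {Φ : BundleHom E (twist L 1 E)} {x : X} {α : X → ℂ} (hα : HolAt α x)
    (h : ∀ᶠ y in 𝓝 x, coeffAt Φ x y = centredCoord x y * α y) {u : Fin (2 * n) → ℂ}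
    (hu : Φ x u = 0) : ∃ ψ : X → Fin (2 * n) → ℂ, HolAt ψ x ∧
      (∀ᶠ y in 𝓝 x, higgsAt Φ x y u = centredCoord x y • ψ y) ∧
      adjugateMap (Φ x) (ψ x) = α x • u ∧
      ψ x = (twist L 1 E).localDeriv x
        (fun y => Φ y (E.constSection (E.core.indexAt x) u y)) := by
  obtain ⟨ψ, h1, h2, h3⟩ := (holHomAt_higgsAt Φ x _ (holAt_const u x)).exists_eq_smul
    (by rw [higgsAt_self]; exact hu)
  refine ⟨ψ, h1, h2, ?_, h3⟩
  have h4 : HolAt (fun y => adjugateMap (higgsAt Φ x y) (ψ y)) x :=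
    (holHomAt_higgsAt Φ x).adjugateMap _ h1
  have h5 : HolAt (fun y => α y • u) x := hα.smul (holAt_const u x)
  -- Off `x` the coordinate cancels from `adj(Φ)(zψ) = adj(Φ)Φu = zαu`; continuity gives the
  -- equation at `x`.
  have := eq_of_eventuallyEq_off h4.continuousAt h5.continuousAt (by
    filter_upwards [h, h2, eventually_centredCoord_ne_zero x, E.eventually_mem_frameSet x]
      with y e1 e2 e3 e4 hne
    have h6 := adjugateMap_comp (higgsAt Φ x y) u
    rw [e2, map_smul, det_higgsAt Φ e4, e1, mul_smul] at h6
    exact smul_right_injective _ (e3 hne) h6)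
  rwa [higgsAt_self] at this

/-- The local form of the Hecke modification at `x`: there `T(c, b) = (c - b u / ζ, b / ζ)` is a
frame of the modified bundle. -/
structure LocalHecke (Φ : BundleHom E (twist L 1 E)) (om : BundleForm E L) (x : X)
    (u : Fin (2 * n) → ℂ) (ζ : X → ℂ) (ψ : X → Fin (2 * n) → ℂ) (α ρ : X → ℂ) : Prop where
  coord_ne_zero : ∀ᶠ y in 𝓝 x, y ∉ zeroSet Φ → ζ y ≠ 0
  hol_deriv : HolAt ψ x
  hol_coeff : HolAt α x
  hol_res : HolAt ρ x
  coeff_ne_zero : α x ≠ 0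
  higgs_eq : ∀ᶠ y in 𝓝 x, higgsAt Φ x y u = ζ y • ψ y
  coeff_eq : ∀ᶠ y in 𝓝 x, coeffAt Φ x y = ζ y * α y
  res_eq : ∀ᶠ y in 𝓝 x, formAt om x y u (ψ y) + α y = ζ y * ρ y
  -- The next two fields say that at `x` the form `modelForm` has no radical and the map `modelQuot`
  -- is surjective.
  inj : ∀ (c : Fin (2 * n) → ℂ) (b : ℂ), Φ x c = b • ψ x → om x c (ψ x) = b * ρ x →
    c = 0 ∧ b = 0
  surj : ∀ e, ∃ (c : Fin (2 * n) → ℂ) (b : ℂ), Φ x c - b • ψ x = e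

theorem holAt_heckeCoord (Φ : BundleHom E (twist L 1 E)) (x : X) : HolAt (heckeCoord Φ x) x := by
  by_cases hx : x ∈ zeroSet Φ
  · exact (holAt_centredCoord x).congr (.of_forall fun y => heckeCoord_of_mem hx y)
  · exact (holAt_const 1 x).congr (.of_forall fun y => heckeCoord_of_notMem hx y)

theorem exists_localHecke {Φ : BundleHom E (twist L 1 E)} {om : BundleForm E L}
    (hE : IsSpHiggs E Φ om) (hS : SmoothSpectralCurve Φ) {i : X → ℂ →ₗ[ℂ] (Fin (2 * n) → ℂ)}
    (hi : IsHeckeData Φ om i) (x : X) :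
    ∃ ψ α ρ, LocalHecke Φ om x (heckeVec Φ i x) (heckeCoord Φ x) ψ α ρ := by
  have hneg : ∀ v w, om x v w = -om x w v := fun v w => ((hE.alt x).neg w v).symm
  by_cases hx : x ∈ zeroSet Φ
  · rw [heckeVec_of_mem hx]
    set u := i x 1 with hu
    have hu0 : Φ x u = 0 := by
      have : u ∈ LinearMap.range (i x) := ⟨1, rfl⟩
      rwa [hi.range_eq x hx] at this
    have hune : u ≠ 0 := fun h => one_ne_zero (hi.injective x hx (h.trans (map_zero _).symm))
    obtain ⟨α, hα, hα0, hαe, hαd⟩ := exists_coeffAt_eq hE hS hx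
    obtain ⟨ψ, hψ, hψe, hψa, hψd⟩ := exists_higgsAt_eq hα hαe hu0
    have hres : om x u (ψ x) = -α x := by
      rw [hψd, hαd, hi.residue x hx 1, one_pow, one_mul]
    have hker : ∀ c, Φ x c = 0 → ∃ t : ℂ, c = t • u := fun c hc =>
      exists_smul_eq_of_adjugateMap (v := ψ x) (by rw [hψa]; exact smul_ne_zero hα0 hune)
        hu0 hune hc
    -- Pair `Φc = bψ` with `u`: the left side gives `0` by skewness and `Φu = 0`, the right side
    -- gives `-bα`.
    have hb : ∀ (c : Fin (2 * n) → ℂ) (b : ℂ), Φ x c = b • ψ x → b = 0 := fun c b h => by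
      have h1 := hE.compat x u c
      rw [hu0, map_zero, LinearMap.zero_apply, zero_add, h, map_smul, smul_eq_mul, hres] at h1
      exact (mul_eq_zero.1 h1).resolve_right (neg_ne_zero.2 hα0)
    -- The residue condition says that `ω(u, ψ) + α` vanishes at `x`, hence is divisible by the
    -- coordinate.
    obtain ⟨ρ, hρ, hρe, -⟩ := HolAt.exists_eq_smul (x := x)
      (f := fun y => formAt om x y u (ψ y) + α y)
      (((holFormAt_formAt om x) _ _ (holAt_const u x) hψ).add hα) (by simp [hres])
    refine ⟨ψ, α, ρ, eventually_heckeCoord_ne_zero Φ x, hψ, hα, hρ, hα0,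
      ?_, ?_, ?_, ?_, ?_⟩
    · simpa only [heckeCoord_of_mem hx] using hψe
    · simpa only [heckeCoord_of_mem hx] using hαe
    · simpa only [heckeCoord_of_mem hx, smul_eq_mul] using hρe
    · intro c b h1 h2
      obtain rfl := hb c b h1
      obtain ⟨t, rfl⟩ := hker c (by rw [h1, zero_smul])
      rw [map_smul, LinearMap.smul_apply, smul_eq_mul, hres, zero_mul] at h2
      rw [(mul_eq_zero.1 h2).resolve_right (neg_ne_zero.2 hα0), zero_smul]
      exact ⟨rfl, rfl⟩
    · intro e
      -- subtract a multiple of `ψ x` to get into the orthogonal space of the kernel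
      obtain ⟨c, hc⟩ := exists_eq_of_orthogonal_ker (hE.nondegenerate x) (hE.compat x)
        (w := e + (om x u e / α x) • ψ x) fun k hk => by
          obtain ⟨t, rfl⟩ := hker k hk
          simp only [map_smul, map_add, LinearMap.smul_apply, smul_eq_mul, hres]
          field_simp
          ring
      exact ⟨c, om x u e / α x, by rw [hc]; simp⟩
  · rw [heckeVec_of_notMem hx]
    have hbij := bijective_of_notMem hx
    have hα0 : coeffAt Φ x x ≠ 0 := by rw [coeffAt_self]; exact hx
    -- With `u = 0` and `ζ = 1` the equations force `ψ = 0` and `α = ρ = a_{2n}`.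
    refine ⟨0, coeffAt Φ x, coeffAt Φ x, eventually_heckeCoord_ne_zero Φ x,
      holAt_const 0 x, holAt_coeffAt Φ x, holAt_coeffAt Φ x, hα0, ?_, ?_, ?_, ?_, ?_⟩
    · simp
    · simp [heckeCoord_of_notMem hx]
    · simp [heckeCoord_of_notMem hx]
    · intro c b h1 h2
      refine ⟨hbij.1 (by simpa using h1), ?_⟩
      rw [Pi.zero_apply, map_zero, eq_comm] at h2
      exact (mul_eq_zero.1 h2).resolve_right hα0
    · intro e
      obtain ⟨c, rfl⟩ := hbij.2 e
      exact ⟨c, 0, by simp⟩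

/-- Hecke data exist. -/
theorem exists_isHeckeData {Φ : BundleHom E (twist L 1 E)} {om : BundleForm E L}
    (hE : IsSpHiggs E Φ om) (hS : SmoothSpectralCurve Φ) : ∃ i, IsHeckeData Φ om i := by
  have key : ∀ x, ∃ u : Fin (2 * n) → ℂ, x ∈ zeroSet Φ → u ≠ 0 ∧ Φ x u = 0 ∧
      ∃ (α : ℂ) (ψ : Fin (2 * n) → ℂ), α ≠ 0 ∧ adjugateMap (Φ x) ψ = α • u ∧ om x u ψ = -α ∧
        ψ = (twist L 1 E).localDeriv x
          (fun y => Φ y (E.constSection (E.core.indexAt x) u y)) ∧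
        α = (linePow L (2 * n : ℕ)).localDeriv x (charCoeff Φ (2 * n)) := by
    intro x
    by_cases hx : x ∈ zeroSet Φ
    swap
    · exact ⟨0, fun h => absurd h hx⟩
    obtain ⟨α, hα, hα0, hαe, hαd⟩ := exists_coeffAt_eq hE hS hx
    obtain ⟨k, hk, hk0⟩ := (LinearMap.ker (Φ x)).ne_bot_iff.1
      (LinearMap.bot_lt_ker_of_det_eq_zero (det_eq_zero_of_mem hx)).ne'
    obtain ⟨ψ, hψ, hψe, hψa, hψd⟩ := exists_higgsAt_eq hα hαe hk
    have hne : om x k (ψ x) ≠ 0 := form_ne_zero_of_adjugateMap (hE.nondegenerate x) (hE.compat x)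
      (det_eq_zero_of_mem hx) hk hk0 hα0 hψa
    -- Replacing `k` by `μk` replaces `ψ` by `μψ`, so `ω(k, ψ)` is multiplied by `μ²`, while `α` is
    -- unchanged.
    obtain ⟨μ, hμ⟩ := IsAlgClosed.exists_pow_nat_eq (-α x / om x k (ψ x)) (n := 2) two_pos
    have hμ0 : μ ≠ 0 := by
      rintro rfl
      rw [zero_pow two_ne_zero, eq_comm, div_eq_zero_iff, neg_eq_zero] at hμ
      exact hμ.elim hα0 hne
    have hμk : μ • k ≠ 0 := smul_ne_zero hμ0 hk0
    refine ⟨μ • k, fun _ => ⟨hμk, by rw [map_smul, hk, smul_zero], α x, μ • ψ x, hα0, ?_, ?_, ?_,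
      hαd⟩⟩
    · rw [map_smul, hψa, smul_comm]
    · simp only [map_smul, LinearMap.smul_apply, smul_eq_mul]
      field_simp at hμ
      linear_combination hμ
    · rw [localDeriv_smul, hψd]
  choose u hu using key
  exact ⟨_, isHeckeData_of_vector hu⟩

end LocalHiggs

/-! ### The frame of the modified bundle and its inverse. -/

section HeckeFrame

variable {F : Type} [NormedAddCommGroup F] [NormedSpace ℂ F]

/-- The frame `(c, b) ↦ (c - b u / ζ, b / ζ)`. -/
noncomputable def heckeFrame (u : F) (ζ : ℂ) : F × ℂ →ₗ[ℂ] F × ℂ where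
  toFun p := (p.1 - (ζ⁻¹ * p.2) • u, ζ⁻¹ * p.2)
  map_add' p q := by
    ext <;> simp only [Prod.fst_add, Prod.snd_add, mul_add, add_smul]
    abel
  map_smul' c p := by
    simp only [Prod.smul_fst, Prod.smul_snd, smul_eq_mul, RingHom.id_apply, Prod.smul_mk, smul_sub,
      smul_smul, mul_left_comm]

/-- The inverse `(v, w) ↦ (v + w u, ζ w)` of the frame. -/
noncomputable def heckeFrameInv (u : F) (ζ : ℂ) : F × ℂ →ₗ[ℂ] F × ℂ where
  toFun p := (p.1 + p.2 • u, ζ * p.2)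
  map_add' p q := by
    ext <;> simp only [Prod.fst_add, Prod.snd_add, mul_add, add_smul]
    abel
  map_smul' c p := by
    simp only [Prod.smul_fst, Prod.smul_snd, smul_eq_mul, RingHom.id_apply, Prod.smul_mk, smul_add,
      smul_smul, mul_left_comm]

theorem heckeFrame_apply (u : F) (ζ : ℂ) (p : F × ℂ) :
    heckeFrame u ζ p = (p.1 - (ζ⁻¹ * p.2) • u, ζ⁻¹ * p.2) := rfl

theorem heckeFrameInv_apply (u : F) (ζ : ℂ) (p : F × ℂ) :
    heckeFrameInv u ζ p = (p.1 + p.2 • u, ζ * p.2) := rfl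

theorem heckeFrame_heckeFrameInv (u : F) {ζ : ℂ} (hζ : ζ ≠ 0) (p : F × ℂ) :
    heckeFrame u ζ (heckeFrameInv u ζ p) = p := by
  simp [heckeFrame_apply, heckeFrameInv_apply, hζ]

theorem heckeFrameInv_heckeFrame (u : F) {ζ : ℂ} (hζ : ζ ≠ 0) (p : F × ℂ) :
    heckeFrameInv u ζ (heckeFrame u ζ p) = p := by
  simp [heckeFrame_apply, heckeFrameInv_apply, hζ]

theorem heckeFrame_injective (u : F) {ζ : ℂ} (hζ : ζ ≠ 0) :
    Function.Injective (heckeFrame u ζ) :=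
  Function.LeftInverse.injective (heckeFrameInv_heckeFrame u hζ)

@[simp] theorem heckeFrame_zero_one (p : F × ℂ) : heckeFrame (0 : F) 1 p = p := by
  simp [heckeFrame_apply]

variable {X : Type u} [TopologicalSpace X] [ChartedSpace ℂ X]

theorem HolAt.heckeFrame {ζ : X → ℂ} {g : X → F × ℂ} {x : X} (u : F) (hζ : HolAt ζ x)
    (h0 : ζ x ≠ 0) (hg : HolAt g x) : HolAt (fun y => HeckeHiggs.heckeFrame u (ζ y) (g y)) x := by
  have h := (hζ.inv h0).mul hg.snd
  exact (hg.fst.sub (h.smul (holAt_const u x))).pair h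

theorem HolAt.heckeFrameInv {ζ : X → ℂ} {g : X → F × ℂ} {x : X} (u : F) (hζ : HolAt ζ x)
    (hg : HolAt g x) : HolAt (fun y => HeckeHiggs.heckeFrameInv u (ζ y) (g y)) x :=
  (hg.fst.add (hg.snd.smul (holAt_const u x))).pair (hζ.mul hg.snd)

end HeckeFrame

/-! ### Sections of the modified sheaf in terms of local frames. -/

section HeckeSections

variable {X : Type u} [TopologicalSpace X] [ChartedSpace ℂ X] {L : HolBundle X ℂ}
  {n : ℕ} {E : HolBundle X (Fin (2 * n) → ℂ)}

theorem toFrame_sumBundle (x y : X) (p : (Fin (2 * n) → ℂ) × ℂ) :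
    (sumBundle L E).toFrame x y p = ((lineFactor L x y)⁻¹ • E.toFrame x y p.1,
      (lineFactor L x y ^ n)⁻¹ * p.2) := by
  rw [sumBundle, toFrame_directSum, toFrame_twist, toFrame_linePow, zpow_neg_one, zpow_neg,
    zpow_natCast]

theorem mem_frameSet_sumBundle {x y : X} (h : y ∈ (sumBundle L E).frameSet x) :
    y ∈ L.frameSet x ∧ y ∈ E.frameSet x := ⟨h.1.1, h.1.2⟩

theorem fromFrame_sumBundle {x y : X} (h : y ∈ (sumBundle L E).frameSet x)
    (p : (Fin (2 * n) → ℂ) × ℂ) :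
    (sumBundle L E).fromFrame x y p = (lineFactor L x y • E.fromFrame x y p.1,
      lineFactor L x y ^ n * p.2) := by
  have h0 := lineFactor_ne_zero L (mem_frameSet_sumBundle h).1
  apply (sumBundle L E).toFrame_injective h
  rw [(sumBundle L E).toFrame_fromFrame h, toFrame_sumBundle, map_smul,
    E.toFrame_fromFrame (mem_frameSet_sumBundle h).2, inv_smul_smul₀ h0,
    inv_mul_cancel_left₀ (pow_ne_zero _ h0)]

variable [IsManifold 𝓘(ℂ) ω X] {Φ : BundleHom E (twist L 1 E)} {om : BundleForm E L}

theorem isOpen_diff_zeroSet (hE : IsSpHiggs E Φ om) (hS : SmoothSpectralCurve Φ) {U : Set X}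
    (hU : IsOpen U) : IsOpen (U \ zeroSet Φ) := by
  refine isOpen_iff_mem_nhds.2 fun x hx => ?_
  filter_upwards [hU.mem_nhds hx.1, eventually_mem_zeroSet hE hS x] with y h1 h2
  exact ⟨h1, fun h => hx.2 (h2 h ▸ h)⟩

/-- The condition on poles says precisely that the section is `heckeFrame` of a holomorphic vector.
From here on the modification is a matter of local frames. -/
theorem isHeckeSection_iff (hE : IsSpHiggs E Φ om) (hS : SmoothSpectralCurve Φ)
    (i : X → ℂ →ₗ[ℂ] (Fin (2 * n) → ℂ)) {U : Set X} (hU : IsOpen U)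
    {t : X → (Fin (2 * n) → ℂ) × ℂ} :
    IsHeckeSection Φ i U t ↔ ∀ x ∈ U, ∃ g : X → (Fin (2 * n) → ℂ) × ℂ, HolAt g x ∧
      ∀ᶠ y in 𝓝 x, y ∉ zeroSet Φ →
        (sumBundle L E).toFrame x y (t y) = heckeFrame (heckeVec Φ i x) (heckeCoord Φ x y) (g y) := by
  have hUo := isOpen_diff_zeroSet hE hS hU
  constructor
  · rintro ⟨h1, h2⟩ x hx
    by_cases hxD : x ∈ zeroSet Φ
    · obtain ⟨N, hN, hxN, hNU, h, hh, hth, w, hw⟩ := h2 x ⟨hx, hxD⟩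
      have hH := ((sumBundle L E).isHolSection_iff hN).1 hh x hxN
      set H := fun y => (sumBundle L E).toFrame x y (h y) with hHdef
      have hiw : i x w = w • i x 1 := by rw [← map_smul, smul_eq_mul, mul_one]
      -- A residue in `Γ_x` means that `H.1 + H.2 • u` vanishes at `x`; its quotient `g` by the
      -- coordinate is the component `c`, and `b = H.2`.
      obtain ⟨g, hg, hge, -⟩ := HolAt.exists_eq_smul (x := x)
        (f := fun y => (H y).1 + (H y).2 • i x 1)
        (hH.fst.add (hH.snd.smul (holAt_const _ x))) (by simp [hHdef, hw, hiw])
      refine ⟨fun y => (g y, (H y).2), hg.pair hH.snd, ?_⟩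
      filter_upwards [hge, hN.mem_nhds hxN, eventually_heckeCoord_ne_zero Φ x] with y e1 e2 e3 hyD
      have e3' := e3 hyD
      rw [hth y ⟨e2, hyD⟩, heckeVec_of_mem hxD, heckeFrame_apply]
      rw [heckeCoord_of_mem hxD] at e3' ⊢
      rw [map_smul]
      change (centredCoord x y)⁻¹ • H y = _
      refine Prod.ext ?_ rfl
      have e4 : g y = (centredCoord x y)⁻¹ • ((H y).1 + (H y).2 • i x 1) := by
        rw [e1, inv_smul_smul₀ e3']
      simp only [e4, Prod.smul_fst, smul_add, smul_smul, add_sub_cancel_right]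
    · refine ⟨_, ((sumBundle L E).isHolSection_iff hUo).1 h1 x ⟨hx, hxD⟩, .of_forall fun y _ => ?_⟩
      rw [heckeVec_of_notMem hxD, heckeCoord_of_notMem hxD, heckeFrame_zero_one]
  · intro h
    constructor
    · rw [HolBundle.isHolSection_iff _ hUo]
      intro x hx
      obtain ⟨g, hg, hge⟩ := h x hx.1
      refine hg.congr ?_
      filter_upwards [hge, hUo.mem_nhds hx] with y e1 e2
      rw [e1 e2.2, heckeVec_of_notMem hx.2, heckeCoord_of_notMem hx.2, heckeFrame_zero_one]
    · rintro x ⟨hx, hxD⟩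
      obtain ⟨g, hg, hge⟩ := h x hx
      simp only [heckeVec_of_mem hxD, heckeCoord_of_mem hxD] at hge
      -- The frame multiplied by the coordinate: the numerator `(zc - bu, b)`, whose value at `x` is
      -- `(-bu, b)`.
      set H : X → (Fin (2 * n) → ℂ) × ℂ :=
        fun y => (centredCoord x y • (g y).1 - (g y).2 • i x 1, (g y).2) with hHdef
      have hH : HolAt H x :=
        (((holAt_centredCoord x).smul hg.fst).sub (hg.snd.smul (holAt_const _ x))).pair hg.snd
      obtain ⟨N, hN, hxN, hNs, hNf, hNh⟩ := (sumBundle L E).exists_isHolSection hH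
        (Filter.inter_mem (Filter.inter_mem (hU.mem_nhds hx)
          ((chartAt ℂ x).open_source.mem_nhds (mem_chart_source ℂ x)))
          (hge.and (eventually_heckeCoord_ne_zero Φ x)))
      refine ⟨N, hN, hxN, fun y hy => (hNs hy).1, _, hNh, ?_, (g x).2, ?_⟩
      · rintro y ⟨hyN, hyD⟩
        obtain ⟨e1, e2⟩ := (hNs hyN).2
        have e2' := e2 hyD
        rw [heckeCoord_of_mem hxD] at e2'
        apply (sumBundle L E).toFrame_injective (hNf hyN)
        rw [e1 hyD, map_smul, (sumBundle L E).toFrame_fromFrame (hNf hyN), heckeFrame_apply]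
        change _ = (centredCoord x y)⁻¹ • H y
        refine Prod.ext ?_ rfl
        simp [hHdef, smul_sub, smul_smul, inv_mul_cancel₀ e2']
      · rw [HolBundle.fromFrame_self, hHdef]
        have hiw : i x (g x).2 = (g x).2 • i x 1 := by rw [← map_smul, smul_eq_mul, mul_one]
        simp [centredCoord_self, hiw]

/-- `M` maps `V` near `x` to the local form of the Hecke modification. -/
structure IsLocalMap (Φ : BundleHom E (twist L 1 E)) (i : X → ℂ →ₗ[ℂ] (Fin (2 * n) → ℂ))
    (V : HolBundle X (Fin (2 * n + 1) → ℂ))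
    (j : X → (Fin (2 * n + 1) → ℂ) →ₗ[ℂ] (Fin (2 * n) → ℂ) × ℂ) (x : X)
    (M : X → (Fin (2 * n + 1) → ℂ) →ₗ[ℂ] (Fin (2 * n) → ℂ) × ℂ) : Prop where
  hol : HolHomAt M x
  eq : ∀ᶠ y in 𝓝 x, y ∉ zeroSet Φ → ∀ v, (sumBundle L E).toFrame x y (j y (V.fromFrame x y v)) =
    heckeFrame (heckeVec Φ i x) (heckeCoord Φ x y) (M y v)

/-- `M` identifies `V` near `x` with the local form of the Hecke modification. -/
structure IsLocalFrame (Φ : BundleHom E (twist L 1 E)) (i : X → ℂ →ₗ[ℂ] (Fin (2 * n) → ℂ))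
    (V : HolBundle X (Fin (2 * n + 1) → ℂ))
    (j : X → (Fin (2 * n + 1) → ℂ) →ₗ[ℂ] (Fin (2 * n) → ℂ) × ℂ) (x : X)
    (M : X → (Fin (2 * n + 1) → ℂ) →ₗ[ℂ] (Fin (2 * n) → ℂ) × ℂ) : Prop
    extends IsLocalMap Φ i V j x M where
  bijective : Function.Bijective (M x)

theorem bijective_of_surjective {M : (Fin (2 * n + 1) → ℂ) →ₗ[ℂ] (Fin (2 * n) → ℂ) × ℂ}
    (h : Function.Surjective M) : Function.Bijective M :=
  ⟨(LinearMap.injective_iff_surjective_of_finrank_eq_finrank (by simp)).2 h, h⟩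

theorem bijective_of_injective {M : (Fin (2 * n + 1) → ℂ) →ₗ[ℂ] (Fin (2 * n) → ℂ) × ℂ}
    (h : Function.Injective M) : Function.Bijective M :=
  ⟨h, (LinearMap.injective_iff_surjective_of_finrank_eq_finrank (by simp)).1 h⟩

/-- A vector constant in the frame at `x` gives a section of the modified sheaf: at the other points
of a small neighbourhood `ζ` is invertible and `D` is absent. -/
theorem isHeckeSection_fromFrame (hE : IsSpHiggs E Φ om) (hS : SmoothSpectralCurve Φ)
    (i : X → ℂ →ₗ[ℂ] (Fin (2 * n) → ℂ)) (x : X) (p : (Fin (2 * n) → ℂ) × ℂ) :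
    ∃ U : Set X, IsOpen U ∧ x ∈ U ∧ IsHeckeSection Φ i U (fun y => (sumBundle L E).fromFrame x y
      (heckeFrame (heckeVec Φ i x) (heckeCoord Φ x y) p)) := by
  obtain ⟨U, hU, hUo, hxU⟩ := eventually_nhds_iff.1 (((sumBundle L E).eventually_mem_frameSet x).and
    ((eventually_heckeCoord_ne_zero Φ x).and ((holAt_heckeCoord Φ x).eventually.and
      (eventually_mem_zeroSet hE hS x))))
  refine ⟨U, hUo, hxU, (isHeckeSection_iff hE hS i hUo).2 fun x' hx' => ?_⟩
  obtain ⟨h1, h2, h3, h4⟩ := hU x' hx'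
  by_cases hD : x' ∈ zeroSet Φ
  · obtain rfl := h4 hD
    refine ⟨fun _ => p, holAt_const p _, ?_⟩
    filter_upwards [(sumBundle L E).eventually_mem_frameSet x'] with y hy _
    exact (sumBundle L E).toFrame_fromFrame hy _
  · refine ⟨_, (sumBundle L E).holAt_coord (s := fun y => (sumBundle L E).fromFrame x y
        (heckeFrame (heckeVec Φ i x) (heckeCoord Φ x y) p)) (a := (sumBundle L E).core.indexAt x) h1
      ((sumBundle L E).mem_frameSet_self x') (HolAt.congr
        (HolAt.heckeFrame (heckeVec Φ i x) h3 (h2 hD) (holAt_const p x')) ?_),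
      .of_forall fun y _ => ?_⟩
    · filter_upwards [hUo.mem_nhds hx'] with y hy
      exact (sumBundle L E).toFrame_fromFrame (hU y hy).1 _
    · rw [heckeVec_of_notMem hD, heckeCoord_of_notMem hD, heckeFrame_zero_one]
      rfl

omit [IsManifold 𝓘(ℂ) ω X] in
theorem exists_isLocalMap {i : X → ℂ →ₗ[ℂ] (Fin (2 * n) → ℂ)}
    {V : HolBundle X (Fin (2 * n + 1) → ℂ)}
    {j : X → (Fin (2 * n + 1) → ℂ) →ₗ[ℂ] (Fin (2 * n) → ℂ) × ℂ} {x : X}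
    (h : ∀ v, ∃ g : X → (Fin (2 * n) → ℂ) × ℂ, HolAt g x ∧ ∀ᶠ y in 𝓝 x, y ∉ zeroSet Φ →
      (sumBundle L E).toFrame x y (j y (V.fromFrame x y v)) =
        heckeFrame (heckeVec Φ i x) (heckeCoord Φ x y) (g y)) : ∃ M, IsLocalMap Φ i V j x M := by
  let e := Pi.basisFun ℂ (Fin (2 * n + 1))
  choose g hg hge using fun k => h (e k)
  refine ⟨fun y => e.constr ℂ (fun k => g k y), HolHomAt.of_basis e fun k => ?_, ?_⟩
  · simpa only [Module.Basis.constr_basis] using hg k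
  · filter_upwards [Filter.eventually_all.2 hge] with y hy hyD v
    have : ((sumBundle L E).toFrame x y : (Fin (2 * n) → ℂ) × ℂ →ₗ[ℂ] _) ∘ₗ j y ∘ₗ
        (V.fromFrame x y : (Fin (2 * n + 1) → ℂ) →ₗ[ℂ] _) =
        heckeFrame (heckeVec Φ i x) (heckeCoord Φ x y) ∘ₗ e.constr ℂ (fun k => g k y) :=
      e.ext fun k => by
        simp only [LinearMap.comp_apply, Module.Basis.constr_basis]
        exact hy k hyD
    exact LinearMap.congr_fun this v

/-- The images of the frame of `V` are the columns of `M`. Surjectivity at `x` holds because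
sections constant in the Hecke frame lift to `V`, by the defining property of the modification. -/
theorem exists_isLocalFrame (hE : IsSpHiggs E Φ om) (hS : SmoothSpectralCurve Φ)
    {i : X → ℂ →ₗ[ℂ] (Fin (2 * n) → ℂ)} {V : HolBundle X (Fin (2 * n + 1) → ℂ)}
    {j : X → (Fin (2 * n + 1) → ℂ) →ₗ[ℂ] (Fin (2 * n) → ℂ) × ℂ}
    (hV : IsHeckeModification Φ i V j) (x : X) : ∃ M, IsLocalFrame Φ i V j x M := by
  obtain ⟨M, hM⟩ := exists_isLocalMap (Φ := Φ) (i := i) (V := V) (j := j) (x := x) fun v => by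
    obtain ⟨U, hU, hxU, -, -, hs⟩ := V.exists_isHolSection (holAt_const v x) Filter.univ_mem
    exact (isHeckeSection_iff hE hS i hU).1 (hV.maps U _ hU hs) x hxU
  refine ⟨M, hM, bijective_of_surjective ?_⟩
  let f := Module.finBasis ℂ ((Fin (2 * n) → ℂ) × ℂ)
  have h2 : ∀ k, ∃ v, M x v = f k := fun k => by
    obtain ⟨U, hU, hxU, ht⟩ := isHeckeSection_fromFrame hE hS i x (f k)
    obtain ⟨s, hs, hst⟩ := hV.surj U _ hU ht
    have hσ := (V.isHolSection_iff hU).1 hs x hxU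
    refine ⟨V.toFrame x x (s x), ?_⟩
    refine eq_of_eventuallyEq_zeroSet hE hS (hM.hol _ hσ).continuousAt
      (continuousAt_const (y := f k)) ?_
    filter_upwards [hM.eq, hU.mem_nhds hxU, V.eventually_mem_frameSet x,
      eventually_heckeCoord_ne_zero Φ x, (sumBundle L E).eventually_mem_frameSet x]
      with y e1 e2 e3 e4 e5 hyD
    apply heckeFrame_injective (heckeVec Φ i x) (e4 hyD)
    rw [← e1 hyD, V.fromFrame_toFrame e3, hst y ⟨e2, hyD⟩,
      (sumBundle L E).toFrame_fromFrame e5]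
  rw [← LinearMap.range_eq_top, eq_top_iff, ← f.span_eq, Submodule.span_le]
  rintro _ ⟨k, rfl⟩
  exact h2 k

/-- The criterion by which both the constructed bundle and a given `SO`-bundle are recognised as
modifications. -/
theorem isHeckeModification_of_isLocalFrame (hE : IsSpHiggs E Φ om) (hS : SmoothSpectralCurve Φ)
    {i : X → ℂ →ₗ[ℂ] (Fin (2 * n) → ℂ)} {V : HolBundle X (Fin (2 * n + 1) → ℂ)}
    {j : X → (Fin (2 * n + 1) → ℂ) →ₗ[ℂ] (Fin (2 * n) → ℂ) × ℂ}
    (hj : ∀ x ∉ zeroSet Φ, Function.Bijective (j x)) (hV : ∀ x, ∃ M, IsLocalFrame Φ i V j x M) :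
    IsHeckeModification Φ i V j := by
  choose M hM using hV
  refine ⟨hj, fun U s hU hs => ?_, fun U t hU ht => ?_⟩
  · rw [isHeckeSection_iff hE hS i hU]
    intro x hx
    refine ⟨_, (hM x).hol _ ((V.isHolSection_iff hU).1 hs x hx), ?_⟩
    filter_upwards [(hM x).eq, V.eventually_mem_frameSet x] with y e1 e2 hy
    rw [← e1 hy, V.fromFrame_toFrame e2]
  · rw [isHeckeSection_iff hE hS i hU] at ht
    choose! g hg hge using ht
    -- The preimage of a section is prescribed by `M` on `D`, where `j` carries no information, and
    -- by `j` elsewhere; the holomorphic inverse of `M` shows that these values fit together.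
    have key : ∀ x, ∃ v, (x ∈ zeroSet Φ → M x x v = g x x) ∧ (x ∉ zeroSet Φ → j x v = t x) :=
      fun x => by
        by_cases hx : x ∈ zeroSet Φ
        · exact ((hM x).bijective.2 (g x x)).imp fun v hv => ⟨fun _ => hv, fun h => absurd hx h⟩
        · exact ((hj x hx).2 (t x)).imp fun v hv => ⟨fun h => absurd h hx, fun _ => hv⟩
    choose s hs1 hs2 using key
    refine ⟨s, (V.isHolSection_iff hU).2 fun x hx => ?_, fun x hx => hs2 x hx.2⟩
    obtain ⟨S, hS1, hS2⟩ := (hM x).hol.exists_inverse (hM x).bijective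
    refine (hS1 _ (hg x hx)).congr ?_
    filter_upwards [hS2, hge x hx, (hM x).eq, V.eventually_mem_frameSet x,
      eventually_heckeCoord_ne_zero Φ x, eventually_mem_zeroSet hE hS x] with y e1 e2 e3 e4 e5 e6
    have h : M x y (V.toFrame x y (s y)) = g x y := by
      by_cases hy : y ∈ zeroSet Φ
      · obtain rfl := e6 hy
        rw [HolBundle.toFrame_self, hs1 y hy]
      · apply heckeFrame_injective (heckeVec Φ i x) (e5 hy)
        rw [← e3 hy, V.fromFrame_toFrame e4, hs2 y hy, e2 hy]
    rw [← h]
    exact (LinearMap.congr_fun e1.2 _).symm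

end HeckeSections

/-! ### Construction of the modified bundle by gluing local frames. -/

section HeckeBundle

variable {X : Type u} [TopologicalSpace X] [ChartedSpace ℂ X] {L : HolBundle X ℂ}
  {n : ℕ} {E : HolBundle X (Fin (2 * n) → ℂ)}

/-- An identification of the fibres of `V` and of `L⁻¹E ⊕ L⁻ⁿ`. -/
noncomputable def sumEquiv (n : ℕ) : (Fin (2 * n + 1) → ℂ) ≃L[ℂ] (Fin (2 * n) → ℂ) × ℂ :=
  ContinuousLinearEquiv.ofFinrankEq (by simp)

/-- The transition map of the Hecke modification, away from the zeros of `a_{2n}`. -/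
noncomputable def heckeTransition (Φ : BundleHom E (twist L 1 E))
    (i : X → ℂ →ₗ[ℂ] (Fin (2 * n) → ℂ)) (x x' y : X) :
    (Fin (2 * n + 1) → ℂ) →ₗ[ℂ] (Fin (2 * n + 1) → ℂ) :=
  ((sumEquiv n).symm : (Fin (2 * n) → ℂ) × ℂ →ₗ[ℂ] _) ∘ₗ
    heckeFrameInv (heckeVec Φ i x') (heckeCoord Φ x' y) ∘ₗ
    ((sumBundle L E).core.coordChange ((sumBundle L E).core.indexAt x)
      ((sumBundle L E).core.indexAt x') y : (Fin (2 * n) → ℂ) × ℂ →ₗ[ℂ] _) ∘ₗ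
    heckeFrame (heckeVec Φ i x) (heckeCoord Φ x y) ∘ₗ
    (sumEquiv n : (Fin (2 * n + 1) → ℂ) →ₗ[ℂ] _)

theorem heckeTransition_apply (Φ : BundleHom E (twist L 1 E))
    (i : X → ℂ →ₗ[ℂ] (Fin (2 * n) → ℂ)) (x x' y : X) (v : Fin (2 * n + 1) → ℂ) :
    heckeTransition Φ i x x' y v = (sumEquiv n).symm
      (heckeFrameInv (heckeVec Φ i x') (heckeCoord Φ x' y)
        ((sumBundle L E).core.coordChange ((sumBundle L E).core.indexAt x)
          ((sumBundle L E).core.indexAt x') y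
          (heckeFrame (heckeVec Φ i x) (heckeCoord Φ x y) (sumEquiv n v)))) := rfl

/-- `N x` is a neighbourhood of `x` over which the local form at `x` is a frame. -/
structure IsHeckeCover (Φ : BundleHom E (twist L 1 E)) (N : X → Set X) : Prop where
  isOpen : ∀ x, IsOpen (N x)
  mem : ∀ x, x ∈ N x
  frame : ∀ x, ∀ y ∈ N x, y ∈ (sumBundle L E).frameSet x
  zeros : ∀ x, ∀ y ∈ N x, y ∈ zeroSet Φ → y = x
  coord : ∀ x, ∀ y ∈ N x, y ∉ zeroSet Φ → heckeCoord Φ x y ≠ 0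
  hol : ∀ x, ∀ y ∈ N x, HolAt (heckeCoord Φ x) y

variable {Φ : BundleHom E (twist L 1 E)} {om : BundleForm E L}

theorem exists_isHeckeCover [IsManifold 𝓘(ℂ) ω X] (hE : IsSpHiggs E Φ om)
    (hS : SmoothSpectralCurve Φ) : ∃ N, IsHeckeCover Φ N := by
  have h : ∀ x, ∃ U : Set X, (∀ y ∈ U, _) ∧ IsOpen U ∧ x ∈ U := fun x => eventually_nhds_iff.1
    (((sumBundle L E).eventually_mem_frameSet x).and ((eventually_mem_zeroSet hE hS x).and
      ((eventually_heckeCoord_ne_zero Φ x).and (holAt_heckeCoord Φ x).eventually)))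
  choose N h1 h2 h3 using h
  exact ⟨N, h2, h3, fun x y hy => (h1 x y hy).1, fun x y hy => (h1 x y hy).2.1,
    fun x y hy => (h1 x y hy).2.2.1, fun x y hy => (h1 x y hy).2.2.2⟩

theorem heckeTransition_self {N : X → Set X} (hN : IsHeckeCover Φ N)
    (i : X → ℂ →ₗ[ℂ] (Fin (2 * n) → ℂ)) {x y : X} (hy : y ∈ N x) (hyD : y ∉ zeroSet Φ)
    (v : Fin (2 * n + 1) → ℂ) : heckeTransition Φ i x x y v = v := by
  rw [heckeTransition_apply, (sumBundle L E).core.coordChange_self _ y (hN.frame x y hy),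
    heckeFrameInv_heckeFrame _ (hN.coord x y hy hyD), ContinuousLinearEquiv.symm_apply_apply]

theorem heckeTransition_comp {N : X → Set X} (hN : IsHeckeCover Φ N)
    (i : X → ℂ →ₗ[ℂ] (Fin (2 * n) → ℂ)) {x x' x'' y : X} (hy : y ∈ N x) (hy' : y ∈ N x')
    (hy'' : y ∈ N x'') (hyD : y ∉ zeroSet Φ) (v : Fin (2 * n + 1) → ℂ) :
    heckeTransition Φ i x' x'' y (heckeTransition Φ i x x' y v) =
      heckeTransition Φ i x x'' y v := by
  rw [heckeTransition_apply, heckeTransition_apply, heckeTransition_apply,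
    ContinuousLinearEquiv.apply_symm_apply, heckeFrame_heckeFrameInv _ (hN.coord x' y hy' hyD),
    (sumBundle L E).core.coordChange_comp _ _ _ y
      ⟨⟨hN.frame x y hy, hN.frame x' y hy'⟩, hN.frame x'' y hy''⟩]

theorem holHomAt_heckeTransition {N : X → Set X} (hN : IsHeckeCover Φ N)
    (i : X → ℂ →ₗ[ℂ] (Fin (2 * n) → ℂ)) {x x' y : X} (hy : y ∈ N x) (hy' : y ∈ N x')
    (hyD : y ∉ zeroSet Φ) : HolHomAt (heckeTransition Φ i x x') y := by
  intro s hs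
  have h1 : HolAt ((sumBundle L E).core.coordChange ((sumBundle L E).core.indexAt x)
      ((sumBundle L E).core.indexAt x')) y :=
    ((sumBundle L E).hol.contMDiffOn_coordChange _ _).contMDiffAt
      ((((sumBundle L E).core.isOpen_baseSet _).inter
        ((sumBundle L E).core.isOpen_baseSet _)).mem_nhds ⟨hN.frame x y hy, hN.frame x' y hy'⟩)
  have h2 : HolAt (fun z => sumEquiv n (s z)) y := hs.clm (sumEquiv n).toContinuousLinearMap
  have h3 := HolAt.heckeFrame (heckeVec Φ i x) (hN.hol x y hy) (hN.coord x y hy hyD) h2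
  have h4 : HolAt (fun z => (sumBundle L E).core.coordChange ((sumBundle L E).core.indexAt x)
      ((sumBundle L E).core.indexAt x') z
      (heckeFrame (heckeVec Φ i x) (heckeCoord Φ x z) (sumEquiv n (s z)))) y :=
    ContMDiffAt.clm_apply h1 h3
  exact (HolAt.heckeFrameInv (heckeVec Φ i x') (hN.hol x' y hy') h4).clm
    (sumEquiv n).symm.toContinuousLinearMap

open Classical in
/-- The transition maps of the Hecke modification. -/
noncomputable def heckeCoordChange (Φ : BundleHom E (twist L 1 E))
    (i : X → ℂ →ₗ[ℂ] (Fin (2 * n) → ℂ)) (x x' y : X) :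
    (Fin (2 * n + 1) → ℂ) →L[ℂ] (Fin (2 * n + 1) → ℂ) :=
  -- The formula for the transition divides by `ζ`, which vanishes at `x` if `x ∈ D`; this case
  -- occurs only for `x = x'`.
  if x = x' then ContinuousLinearMap.id ℂ _
  else LinearMap.toContinuousLinearMap (heckeTransition Φ i x x' y)

theorem heckeCoordChange_self (i : X → ℂ →ₗ[ℂ] (Fin (2 * n) → ℂ)) (x y : X)
    (v : Fin (2 * n + 1) → ℂ) : heckeCoordChange Φ i x x y v = v := by
  rw [heckeCoordChange, if_pos rfl]; rfl

theorem heckeCoordChange_eq {N : X → Set X} (hN : IsHeckeCover Φ N)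
    (i : X → ℂ →ₗ[ℂ] (Fin (2 * n) → ℂ)) {x x' y : X} (hy : y ∈ N x)
    (hyD : y ∉ zeroSet Φ) (v : Fin (2 * n + 1) → ℂ) :
    heckeCoordChange Φ i x x' y v = heckeTransition Φ i x x' y v := by
  rw [heckeCoordChange]
  split_ifs with h
  · subst h
    rw [heckeTransition_self hN i hy hyD]; rfl
  · rfl

theorem contMDiffOn_heckeCoordChange {N : X → Set X} (hN : IsHeckeCover Φ N)
    (i : X → ℂ →ₗ[ℂ] (Fin (2 * n) → ℂ)) (x x' : X) :
    ContMDiffOn 𝓘(ℂ) 𝓘(ℂ, (Fin (2 * n + 1) → ℂ) →L[ℂ] (Fin (2 * n + 1) → ℂ)) ω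
      (heckeCoordChange Φ i x x') (N x ∩ N x') := by
  by_cases h : x = x'
  · exact contMDiffOn_const.congr fun y _ => by rw [heckeCoordChange, if_pos h]
  · rintro y ⟨hy, hy'⟩
    -- A zero in the domain at `x` is `x` itself, so a zero common to two domains would force `x =
    -- x'`.
    have hyD : y ∉ zeroSet Φ := fun hD =>
      h ((hN.zeros x y hy hD).symm.trans (hN.zeros x' y hy' hD))
    refine (HolAt.congr (holHomAt_heckeTransition hN i hy hy' hyD).clm_holAt
      (.of_forall fun z => ?_)).contMDiffWithinAt
    rw [heckeCoordChange, if_neg h]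

/-- The Hecke modification of `L⁻¹E ⊕ L⁻ⁿ`. -/
noncomputable def heckeBundle {N : X → Set X} (hN : IsHeckeCover Φ N)
    (i : X → ℂ →ₗ[ℂ] (Fin (2 * n) → ℂ)) : HolBundle X (Fin (2 * n + 1) → ℂ) where
  ι := X
  core :=
    { baseSet := N
      isOpen_baseSet := hN.isOpen
      indexAt := fun x => x
      mem_baseSet_at := hN.mem
      coordChange := heckeCoordChange Φ i
      coordChange_self := fun x y _ v => heckeCoordChange_self i x y v
      continuousOn_coordChange := fun x x' => (contMDiffOn_heckeCoordChange hN i x x').continuousOn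
      coordChange_comp := fun x x' x'' y hy v => by
        by_cases hD : y ∈ zeroSet Φ
        · obtain rfl := hN.zeros x y hy.1.1 hD
          obtain rfl := hN.zeros x' y hy.1.2 hD
          obtain rfl := hN.zeros x'' y hy.2 hD
          simp only [heckeCoordChange_self]
        · rw [heckeCoordChange_eq hN i hy.1.1 hD, heckeCoordChange_eq hN i hy.1.2 hD,
            heckeCoordChange_eq hN i hy.1.1 hD, heckeTransition_comp hN i hy.1.1 hy.1.2 hy.2 hD] }
  hol := ⟨contMDiffOn_heckeCoordChange hN i⟩

theorem toFrame_heckeBundle {N : X → Set X} (hN : IsHeckeCover Φ N)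
    (i : X → ℂ →ₗ[ℂ] (Fin (2 * n) → ℂ)) {x y : X} (hy : y ∈ N x) (hyD : y ∉ zeroSet Φ)
    (v : Fin (2 * n + 1) → ℂ) : (sumBundle L E).toFrame x y (sumEquiv n v) =
      heckeFrame (heckeVec Φ i x) (heckeCoord Φ x y)
        (sumEquiv n ((heckeBundle hN i).toFrame x y v)) := by
  have h : (heckeBundle hN i).toFrame x y v = heckeTransition Φ i y x y v :=
    heckeCoordChange_eq hN i (hN.mem y) hyD v
  rw [h, heckeTransition_apply, ContinuousLinearEquiv.apply_symm_apply,
    heckeFrame_heckeFrameInv _ (hN.coord x y hy hyD), heckeVec_of_notMem hyD,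
    heckeCoord_of_notMem hyD, heckeFrame_zero_one]
  rfl

theorem isHeckeModification_heckeBundle [IsManifold 𝓘(ℂ) ω X] (hE : IsSpHiggs E Φ om)
    (hS : SmoothSpectralCurve Φ) {N : X → Set X} (hN : IsHeckeCover Φ N)
    (i : X → ℂ →ₗ[ℂ] (Fin (2 * n) → ℂ)) :
    IsHeckeModification Φ i (heckeBundle hN i) (fun _ => (sumEquiv n : _ →ₗ[ℂ] _)) := by
  refine isHeckeModification_of_isLocalFrame hE hS (fun _ _ => (sumEquiv n).bijective)
    fun x => ⟨fun _ => (sumEquiv n : _ →ₗ[ℂ] _),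
      ⟨fun s hs => hs.clm (sumEquiv n).toContinuousLinearMap, ?_⟩, (sumEquiv n).bijective⟩
  filter_upwards [(hN.isOpen x).mem_nhds (hN.mem x), (heckeBundle hN i).eventually_mem_frameSet x]
    with y h1 h2 hy v
  refine (toFrame_heckeBundle hN i h1 hy _).trans ?_
  rw [HolBundle.toFrame_fromFrame _ h2]
  rfl

end HeckeBundle

/-! ### Determinants and characteristic polynomials of block triangular maps. -/

section Triangular

variable {r : ℕ}

/-- The endomorphism `(c, b) ↦ (A c + b w, d b)`. -/
noncomputable def triangularMap (A : (Fin r → ℂ) →ₗ[ℂ] (Fin r → ℂ)) (w : Fin r → ℂ) (d : ℂ) :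
    (Fin r → ℂ) × ℂ →ₗ[ℂ] (Fin r → ℂ) × ℂ :=
  (A ∘ₗ LinearMap.fst ℂ _ _ + (LinearMap.snd ℂ _ _).smulRight w).prod (d • LinearMap.snd ℂ _ _)

theorem triangularMap_apply (A : (Fin r → ℂ) →ₗ[ℂ] (Fin r → ℂ)) (w : Fin r → ℂ) (d : ℂ)
    (p : (Fin r → ℂ) × ℂ) : triangularMap A w d p = (A p.1 + p.2 • w, d * p.2) := rfl

theorem toMatrix_triangularMap (A : (Fin r → ℂ) →ₗ[ℂ] (Fin r → ℂ)) (w : Fin r → ℂ) (d : ℂ) :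
    LinearMap.toMatrix ((Pi.basisFun ℂ (Fin r)).prod (Module.Basis.singleton Unit ℂ))
      ((Pi.basisFun ℂ (Fin r)).prod (Module.Basis.singleton Unit ℂ)) (triangularMap A w d) =
    Matrix.fromBlocks (LinearMap.toMatrix' A) (Matrix.of fun i _ => w i) 0
      (Matrix.of fun _ _ => d) := by
  ext i k
  rcases i with i | i <;> rcases k with k | k <;>
    simp [LinearMap.toMatrix_apply, triangularMap_apply, LinearMap.toMatrix'_apply]

theorem charpoly_triangularMap (A : (Fin r → ℂ) →ₗ[ℂ] (Fin r → ℂ)) (w : Fin r → ℂ) (d : ℂ) :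
    (triangularMap A w d).charpoly = A.charpoly * (Polynomial.X - Polynomial.C d) := by
  rw [← LinearMap.charpoly_toMatrix _ ((Pi.basisFun ℂ (Fin r)).prod (Module.Basis.singleton Unit ℂ)),
    toMatrix_triangularMap, Matrix.charpoly_fromBlocks_zero₂₁,
    ← LinearMap.charpoly_toMatrix A (Pi.basisFun ℂ (Fin r)), LinearMap.toMatrix_eq_toMatrix']
  congr 1
  simp [Matrix.charpoly, Matrix.charmatrix]

theorem det_triangularMap (A : (Fin r → ℂ) →ₗ[ℂ] (Fin r → ℂ)) (w : Fin r → ℂ) (d : ℂ) :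
    LinearMap.det (triangularMap A w d) = LinearMap.det A * d := by
  rw [← LinearMap.det_toMatrix ((Pi.basisFun ℂ (Fin r)).prod (Module.Basis.singleton Unit ℂ)),
    toMatrix_triangularMap, Matrix.det_fromBlocks_zero₂₁, LinearMap.det_toMatrix']
  simp

theorem det_symm_comp {n : ℕ} (B : (Fin (2 * n) → ℂ) × ℂ →ₗ[ℂ] (Fin (2 * n) → ℂ) × ℂ)
    (M : (Fin (2 * n + 1) → ℂ) →ₗ[ℂ] (Fin (2 * n) → ℂ) × ℂ) :
    LinearMap.det (((sumEquiv n).symm : (Fin (2 * n) → ℂ) × ℂ →ₗ[ℂ] _) ∘ₗ B ∘ₗ M) =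
      LinearMap.det B * LinearMap.det (((sumEquiv n).symm : (Fin (2 * n) → ℂ) × ℂ →ₗ[ℂ] _) ∘ₗ M) := by
  rw [← LinearMap.det_conj B (sumEquiv n).symm.toLinearEquiv, ← LinearMap.det_comp]
  congr 1
  refine LinearMap.ext fun v => ?_
  simp

theorem det_symm_comp_ne_zero {n : ℕ} {M : (Fin (2 * n + 1) → ℂ) →ₗ[ℂ] (Fin (2 * n) → ℂ) × ℂ}
    (h : Function.Bijective M) :
    LinearMap.det (((sumEquiv n).symm : (Fin (2 * n) → ℂ) × ℂ →ₗ[ℂ] _) ∘ₗ M) ≠ 0 :=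
  ((LinearMap.isUnit_iff_isUnit_det _).1 ((Module.End.isUnit_iff _).2
    ((sumEquiv n).symm.bijective.comp h))).ne_zero

end Triangular

/-! ### The Higgs field and the form in the Hecke frame at one point. -/

section Model

variable {n : ℕ}

/-- The quotient map `(c, b) ↦ A c - b ψ` in the local form of the Hecke modification. -/
noncomputable def modelQuot (A : (Fin (2 * n) → ℂ) →ₗ[ℂ] (Fin (2 * n) → ℂ)) (ψ : Fin (2 * n) → ℂ) :
    (Fin (2 * n) → ℂ) × ℂ →ₗ[ℂ] (Fin (2 * n) → ℂ) :=
  A ∘ₗ LinearMap.fst ℂ _ _ - (LinearMap.snd ℂ _ _).smulRight ψ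

theorem modelQuot_apply (A : (Fin (2 * n) → ℂ) →ₗ[ℂ] (Fin (2 * n) → ℂ)) (ψ : Fin (2 * n) → ℂ)
    (p : (Fin (2 * n) → ℂ) × ℂ) : modelQuot A ψ p = A p.1 - p.2 • ψ := rfl

/-- The Higgs field in the local form of the Hecke modification. -/
noncomputable def modelHiggs (A : (Fin (2 * n) → ℂ) →ₗ[ℂ] (Fin (2 * n) → ℂ))
    (ψ : Fin (2 * n) → ℂ) : (Fin (2 * n) → ℂ) × ℂ →ₗ[ℂ] (Fin (2 * n) → ℂ) × ℂ :=
  (modelQuot A ψ).prod 0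

theorem modelHiggs_apply (A : (Fin (2 * n) → ℂ) →ₗ[ℂ] (Fin (2 * n) → ℂ)) (ψ : Fin (2 * n) → ℂ)
    (p : (Fin (2 * n) → ℂ) × ℂ) : modelHiggs A ψ p = (modelQuot A ψ p, 0) := rfl

/-- The symmetric form in the local form of the Hecke modification. -/
noncomputable def modelForm (om : (Fin (2 * n) → ℂ) →ₗ[ℂ] (Fin (2 * n) → ℂ) →ₗ[ℂ] ℂ)
    (A : (Fin (2 * n) → ℂ) →ₗ[ℂ] (Fin (2 * n) → ℂ)) (ψ : Fin (2 * n) → ℂ) (ρ : ℂ) :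
    (Fin (2 * n) → ℂ) × ℂ →ₗ[ℂ] (Fin (2 * n) → ℂ) × ℂ →ₗ[ℂ] ℂ :=
  LinearMap.mk₂ ℂ (fun p q => om p.1 (modelQuot A ψ q) - p.2 * om q.1 ψ + p.2 * q.2 * ρ)
    (fun p p' q => by simp; ring) (fun c p q => by simp; ring)
    (fun p q q' => by simp; ring) (fun c p q => by simp; ring)

theorem modelForm_apply (om : (Fin (2 * n) → ℂ) →ₗ[ℂ] (Fin (2 * n) → ℂ) →ₗ[ℂ] ℂ)
    (A : (Fin (2 * n) → ℂ) →ₗ[ℂ] (Fin (2 * n) → ℂ)) (ψ : Fin (2 * n) → ℂ) (ρ : ℂ)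
    (p q : (Fin (2 * n) → ℂ) × ℂ) : modelForm om A ψ ρ p q =
      om p.1 (modelQuot A ψ q) - p.2 * om q.1 ψ + p.2 * q.2 * ρ := rfl

variable {om : (Fin (2 * n) → ℂ) →ₗ[ℂ] (Fin (2 * n) → ℂ) →ₗ[ℂ] ℂ}
  {A : (Fin (2 * n) → ℂ) →ₗ[ℂ] (Fin (2 * n) → ℂ)} {ψ : Fin (2 * n) → ℂ} {ρ : ℂ}

theorem charpoly_modelHiggs : (modelHiggs A ψ).charpoly = Polynomial.X * A.charpoly := by
  have : modelHiggs A ψ = triangularMap A (-ψ) 0 := by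
    refine LinearMap.ext fun v => ?_
    simp [modelHiggs_apply, triangularMap_apply, modelQuot_apply, sub_eq_add_neg]
  rw [this, charpoly_triangularMap, map_zero, sub_zero, mul_comm]

theorem symm_of_compat (halt : om.IsAlt) (hc : ∀ v w, om (A v) w + om v (A w) = 0)
    (c c' : Fin (2 * n) → ℂ) : om c (A c') = om c' (A c) := by
  have h1 := hc c c'
  have h2 := halt.neg (A c) c'
  linear_combination h1 + h2

theorem modelForm_symm (halt : om.IsAlt) (hc : ∀ v w, om (A v) w + om v (A w) = 0)
    (p q : (Fin (2 * n) → ℂ) × ℂ) : modelForm om A ψ ρ p q = modelForm om A ψ ρ q p := by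
  simp only [modelForm_apply, modelQuot_apply, map_sub, map_smul, smul_eq_mul,
    symm_of_compat halt hc p.1 q.1]
  ring

theorem modelForm_modelHiggs (p q : (Fin (2 * n) → ℂ) × ℂ) :
    modelForm om A ψ ρ (modelHiggs A ψ p) q = om (modelQuot A ψ p) (modelQuot A ψ q) := by
  simp [modelForm_apply, modelHiggs_apply]

/-- Testing an element of the radical against `(c, 0)` and `(0, 1)` gives exactly the two equations
of `hinj`. -/
theorem modelForm_nondegenerate (hnd : om.Nondegenerate) (halt : om.IsAlt)
    (hc : ∀ v w, om (A v) w + om v (A w) = 0)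
    (hinj : ∀ (c : Fin (2 * n) → ℂ) (b : ℂ), A c = b • ψ → om c ψ = b * ρ → c = 0 ∧ b = 0) :
    (modelForm om A ψ ρ).Nondegenerate := by
  have h : (modelForm om A ψ ρ).SeparatingRight := fun q hq => by
    have h1 : modelQuot A ψ q = 0 := hnd.2 _ fun c => by
      simpa [modelForm_apply] using hq (c, 0)
    have h2 := hq (0, 1)
    simp only [modelForm_apply, map_zero, LinearMap.zero_apply, one_mul, zero_sub] at h2
    obtain ⟨h3, h4⟩ := hinj q.1 q.2 (sub_eq_zero.1 h1) (by linear_combination -h2)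
    exact Prod.ext h3 h4
  exact ⟨fun p hp => h p fun q => by rw [modelForm_symm halt hc]; exact hp q, h⟩

/-- The form `ω(v, A v') + w w' a` in the frame `(c, b) ↦ (c - b u / ζ, b / ζ)`. -/
theorem form_heckeFrame (halt : om.IsAlt) (hc : ∀ v w, om (A v) w + om v (A w) = 0)
    {u : Fin (2 * n) → ℂ} {ζ a α : ℂ} (hζ : ζ ≠ 0) (hu : A u = ζ • ψ) (ha : a = ζ * α)
    (hρ : om u ψ + α = ζ * ρ) (p q : (Fin (2 * n) → ℂ) × ℂ) :
    om (heckeFrame u ζ p).1 (modelQuot A ψ q) +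
      (heckeFrame u ζ p).2 * (heckeFrame u ζ q).2 * a = modelForm om A ψ ρ p q := by
  have h1 : om u (A q.1) = ζ * om q.1 ψ := by
    rw [symm_of_compat halt hc, hu, map_smul, smul_eq_mul]
  simp only [heckeFrame_apply, modelForm_apply, modelQuot_apply, map_sub, map_smul, smul_eq_mul,
    LinearMap.sub_apply, LinearMap.smul_apply, h1, ha]
  -- What remains is the coefficient of `bb'`, namely `(ω(u, ψ) + α)/ζ`, which is `ρ`.
  field_simp
  linear_combination (p.2 * q.2) * hρ

theorem apply_heckeFrame {u : Fin (2 * n) → ℂ} {ζ : ℂ} (hζ : ζ ≠ 0) (hu : A u = ζ • ψ)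
    (p : (Fin (2 * n) → ℂ) × ℂ) : A (heckeFrame u ζ p).1 = modelQuot A ψ p := by
  rw [heckeFrame_apply, modelQuot_apply, map_sub, map_smul, hu, smul_smul, mul_right_comm,
    inv_mul_cancel₀ hζ, one_mul]

end Model

/-! ### Comparison of the fibrewise data with the local model. -/

section LocalModel

variable {X : Type u} [TopologicalSpace X] [ChartedSpace ℂ X] {L : HolBundle X ℂ}
  {n : ℕ} {E : HolBundle X (Fin (2 * n) → ℂ)}
  {Φ : BundleHom E (twist L 1 E)} {om : BundleForm E L}

theorem eq_fromFrame_of_toFrame_sumBundle {x y : X} (hy : y ∈ (sumBundle L E).frameSet x)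
    {p m : (Fin (2 * n) → ℂ) × ℂ} (h : (sumBundle L E).toFrame x y p = m) :
    p = (lineFactor L x y • E.fromFrame x y m.1, lineFactor L x y ^ n * m.2) := by
  rw [← fromFrame_sumBundle hy, ← h, (sumBundle L E).fromFrame_toFrame hy]

theorem toFrame_higgs_eq {x y : X} (hy : y ∈ (sumBundle L E).frameSet x) {u ψ : Fin (2 * n) → ℂ}
    {ζ : ℂ} (hζ : ζ ≠ 0) (hu : higgsAt Φ x y u = ζ • ψ) {p m : (Fin (2 * n) → ℂ) × ℂ}
    (h : (sumBundle L E).toFrame x y p = heckeFrame u ζ m) :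
    E.toFrame x y (Φ y p.1) = modelQuot (higgsAt Φ x y) ψ m := by
  rw [← apply_heckeFrame hζ hu, eq_fromFrame_of_toFrame_sumBundle hy h, map_smul, map_smul,
    higgsAt_apply]

theorem sumForm_eq (hE : IsSpHiggs E Φ om) {x y : X} (hy : y ∈ (sumBundle L E).frameSet x)
    {u ψ : Fin (2 * n) → ℂ} {ζ α ρ : ℂ} (hζ : ζ ≠ 0) (hu : higgsAt Φ x y u = ζ • ψ)
    (ha : coeffAt Φ x y = ζ * α) (hρ : formAt om x y u ψ + α = ζ * ρ)
    {p p' m m' : (Fin (2 * n) → ℂ) × ℂ} (h : (sumBundle L E).toFrame x y p = heckeFrame u ζ m)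
    (h' : (sumBundle L E).toFrame x y p' = heckeFrame u ζ m') :
    sumForm Φ om y p p' = modelForm (formAt om x y) (higgsAt Φ x y) ψ ρ m m' := by
  have hyE := (mem_frameSet_sumBundle hy).2
  have h0 : om y p'.1 (Φ y p.1) = om y p.1 (Φ y p'.1) :=
    symm_of_compat (hE.alt y) (hE.compat y) _ _
  have h1 : om y p.1 (Φ y p'.1) =
      formAt om x y (heckeFrame u ζ m).1 (modelQuot (higgsAt Φ x y) ψ m') := by
    rw [← toFrame_higgs_eq hy hζ hu h', formAt_apply, E.fromFrame_toFrame hyE]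
    conv_lhs => rw [eq_fromFrame_of_toFrame_sumBundle hy h, map_smul]
    rfl
  rw [← form_heckeFrame (formAt_isAlt hE x y) (formAt_higgsAt hE hyE) hζ hu ha hρ, sumForm, h0, h1,
    coeffAt, eq_fromFrame_of_toFrame_sumBundle hy h, eq_fromFrame_of_toFrame_sumBundle hy h']
  ring

end LocalModel

/-! ### Extension over `D`: existence, uniqueness, non-degeneracy, characteristic polynomial and the
recovered triple. -/

section Extension

variable {X : Type u} [TopologicalSpace X] [ChartedSpace ℂ X]

theorem HolHomAt.modelQuot {n : ℕ} {A : X → (Fin (2 * n) → ℂ) →ₗ[ℂ] (Fin (2 * n) → ℂ)}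
    {ψ : X → Fin (2 * n) → ℂ} {x : X} (hA : HolHomAt A x) (hψ : HolAt ψ x) :
    HolHomAt (fun y => HeckeHiggs.modelQuot (A y) (ψ y)) x := fun _ hs =>
  (hA _ hs.fst).sub (hs.snd.smul hψ)

theorem HolHomAt.modelHiggs {n : ℕ} {A : X → (Fin (2 * n) → ℂ) →ₗ[ℂ] (Fin (2 * n) → ℂ)}
    {ψ : X → Fin (2 * n) → ℂ} {x : X} (hA : HolHomAt A x) (hψ : HolAt ψ x) :
    HolHomAt (fun y => HeckeHiggs.modelHiggs (A y) (ψ y)) x := fun s hs =>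
  (hA.modelQuot hψ s hs).pair (holAt_const 0 x)

theorem HolFormAt.modelForm {n : ℕ}
    {om : X → (Fin (2 * n) → ℂ) →ₗ[ℂ] (Fin (2 * n) → ℂ) →ₗ[ℂ] ℂ}
    {A : X → (Fin (2 * n) → ℂ) →ₗ[ℂ] (Fin (2 * n) → ℂ)} {ψ : X → Fin (2 * n) → ℂ} {ρ : X → ℂ}
    {x : X} (hom : HolFormAt om x) (hA : HolHomAt A x) (hψ : HolAt ψ x) (hρ : HolAt ρ x) :
    HolFormAt (fun y => HeckeHiggs.modelForm (om y) (A y) (ψ y) (ρ y)) x := fun _ t hs ht =>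
  ((hom _ _ hs.fst (hA.modelQuot hψ t ht)).sub (hs.snd.mul (hom _ _ ht.fst hψ))).add
    ((hs.snd.mul ht.snd).mul hρ)

variable {L : HolBundle X ℂ} {n : ℕ} {E : HolBundle X (Fin (2 * n) → ℂ)}
  {Φ : BundleHom E (twist L 1 E)} {om : BundleForm E L} {i : X → ℂ →ₗ[ℂ] (Fin (2 * n) → ℂ)}
  {V : HolBundle X (Fin (2 * n + 1) → ℂ)} {j : X → (Fin (2 * n + 1) → ℂ) →ₗ[ℂ] (Fin (2 * n) → ℂ) × ℂ}
  {x : X} {M : X → (Fin (2 * n + 1) → ℂ) →ₗ[ℂ] (Fin (2 * n) → ℂ) × ℂ}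
  {ψ : X → Fin (2 * n) → ℂ} {α ρ : X → ℂ}

theorem IsLocalFrame.eq_of_notMem (hM : IsLocalFrame Φ i V j x M) (hx : x ∉ zeroSet Φ)
    (v : Fin (2 * n + 1) → ℂ) : j x v = M x v := by
  have := hM.eq.self_of_nhds hx v
  rwa [heckeVec_of_notMem hx, heckeCoord_of_notMem hx, heckeFrame_zero_one, HolBundle.toFrame_self,
    HolBundle.fromFrame_self] at this

theorem IsLocalFrame.eventually_quot (hM : IsLocalFrame Φ i V j x M)
    (hH : LocalHecke Φ om x (heckeVec Φ i x) (heckeCoord Φ x) ψ α ρ) :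
    ∀ᶠ y in 𝓝 x, y ∉ zeroSet Φ → ∀ v, E.toFrame x y (Φ y (j y (V.fromFrame x y v)).1) =
      modelQuot (higgsAt Φ x y) (ψ y) (M y v) := by
  filter_upwards [hM.eq, hH.coord_ne_zero, hH.higgs_eq, (sumBundle L E).eventually_mem_frameSet x]
    with y e1 e2 e3 e4 hy v
  exact toFrame_higgs_eq e4 (e2 hy) e3 (e1 hy v)

theorem IsLocalMap.eventually_form (hE : IsSpHiggs E Φ om) (hM : IsLocalMap Φ i V j x M)
    (hH : LocalHecke Φ om x (heckeVec Φ i x) (heckeCoord Φ x) ψ α ρ) :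
    ∀ᶠ y in 𝓝 x, y ∉ zeroSet Φ → ∀ v w,
      sumForm Φ om y (j y (V.fromFrame x y v)) (j y (V.fromFrame x y w)) =
        modelForm (formAt om x y) (higgsAt Φ x y) (ψ y) (ρ y) (M y v) (M y w) := by
  filter_upwards [hM.eq, hH.coord_ne_zero, hH.higgs_eq, hH.coeff_eq, hH.res_eq,
    (sumBundle L E).eventually_mem_frameSet x] with y e1 e2 e3 e4 e5 e6 hy v w
  exact sumForm_eq hE e6 (e2 hy) e3 e4 e5 (e1 hy v) (e1 hy w)

theorem IsLocalFrame.eventually_higgs (hM : IsLocalFrame Φ i V j x M)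
    (hH : LocalHecke Φ om x (heckeVec Φ i x) (heckeCoord Φ x) ψ α ρ)
    {T : X → (Fin (2 * n + 1) → ℂ) →ₗ[ℂ] (Fin (2 * n + 1) → ℂ)}
    (hT : ∀ y ∉ zeroSet Φ, ∀ v, j y (T y v) = sumHiggs Φ y (j y v)) :
    ∀ᶠ y in 𝓝 x, y ∉ zeroSet Φ → ∀ v, M y (locHom V (twist L 1 V) T x y v) =
      modelHiggs (higgsAt Φ x y) (ψ y) (M y v) := by
  filter_upwards [hM.eq, hH.coord_ne_zero, hM.eventually_quot hH,
    (sumBundle L E).eventually_mem_frameSet x, V.eventually_mem_frameSet x]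
    with y e1 e2 e3 e4 e5 hy v
  apply heckeFrame_injective (heckeVec Φ i x) (e2 hy)
  have h0 := lineFactor_ne_zero L (mem_frameSet_sumBundle e4).1
  rw [← e1 hy, locHom_apply, toFrame_twist, map_smul, V.fromFrame_toFrame e5, map_smul, hT y hy,
    sumHiggs, zpow_one, map_smul, toFrame_sumBundle, e3 hy, modelHiggs_apply, heckeFrame_apply]
  simp [h0]

variable [IsManifold 𝓘(ℂ) ω X]

/-- Both sides are continuous and agree off `D`. At points of `D` this determines `φ`, because `M x`
is injective. -/
theorem ExtendsHiggs.eq (hE : IsSpHiggs E Φ om) (hS : SmoothSpectralCurve Φ)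
    (hM : IsLocalFrame Φ i V j x M)
    (hH : LocalHecke Φ om x (heckeVec Φ i x) (heckeCoord Φ x) ψ α ρ)
    {φ : BundleHom V (twist L 1 V)} (hφ : ExtendsHiggs Φ V j φ) (v : Fin (2 * n + 1) → ℂ) :
    M x (φ x v) = modelHiggs (Φ x) (ψ x) (M x v) := by
  have hv := holAt_const (X := X) v x
  have := eq_of_eventuallyEq_zeroSet hE hS (hM.hol _ (φ.holHomAt x _ hv)).continuousAt
    ((holHomAt_higgsAt Φ x).modelHiggs hH.hol_deriv _ (hM.hol _ hv)).continuousAt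
    ((hM.eventually_higgs hH hφ).mono fun y h hy => h hy v)
  simpa only [locHom_self, higgsAt_self] using this

/-- Bijectivity of `M` plays no role here, so the formula is available in the converse, where
injectivity of `M` is deduced from it. -/
theorem ExtendsForm.eq (hE : IsSpHiggs E Φ om) (hS : SmoothSpectralCurve Φ)
    (hM : IsLocalMap Φ i V j x M)
    (hH : LocalHecke Φ om x (heckeVec Φ i x) (heckeCoord Φ x) ψ α ρ)
    {Q : BundleForm V (trivialLine X)} (hQ : ExtendsForm Φ om V j Q)
    (v w : Fin (2 * n + 1) → ℂ) :
    Q x v w = modelForm (om x) (Φ x) (ψ x) (ρ x) (M x v) (M x w) := by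
  have hv := holAt_const (X := X) v x
  have hw := holAt_const (X := X) w x
  have := eq_of_eventuallyEq_zeroSet hE hS (Q.holFormAt x _ _ hv hw).continuousAt
    ((holFormAt_formAt om x).modelForm (holHomAt_higgsAt Φ x) hH.hol_deriv hH.hol_res _ _
      (hM.hol _ hv) (hM.hol _ hw)).continuousAt
    ((hM.eventually_form hE hH).mono fun y h hy => by
      rw [← h hy v w, ← hQ y hy, locForm_apply]
      exact one_mul _)
  simpa only [locForm_self, higgsAt_self, formAt_self] using this

theorem existsUnique_extendsHiggs (hE : IsSpHiggs E Φ om) (hS : SmoothSpectralCurve Φ)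
    (hi : IsHeckeData Φ om i) (hV : IsHeckeModification Φ i V j) :
    ∃! φ : BundleHom V (twist L 1 V), ExtendsHiggs Φ V j φ := by
  choose ψ α ρ hH using exists_localHecke hE hS hi
  choose M hM using exists_isLocalFrame hE hS hV
  -- On each fibre the local model is transported through the frame chosen at that very point;
  -- agreement off `D` makes the result holomorphic.
  let T : X → (Fin (2 * n + 1) → ℂ) →ₗ[ℂ] (Fin (2 * n + 1) → ℂ) := fun x =>
    ((LinearEquiv.ofBijective (M x x) (hM x).bijective).symm : _ →ₗ[ℂ] _) ∘ₗ
      modelHiggs (Φ x) (ψ x x) ∘ₗ M x x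
  have hT : ∀ x v, M x x (T x v) = modelHiggs (Φ x) (ψ x x) (M x x v) := fun x v =>
    LinearEquiv.apply_symm_apply (LinearEquiv.ofBijective (M x x) (hM x).bijective) _
  have hj : ∀ x ∉ zeroSet Φ, ∀ v, j x (T x v) = sumHiggs Φ x (j x v) := fun x hx v => by
    have := ((hM x).eventually_quot (hH x)).self_of_nhds hx v
    rw [HolBundle.toFrame_self, HolBundle.fromFrame_self, higgsAt_self] at this
    rw [(hM x).eq_of_notMem hx, hT, modelHiggs_apply, ← this, sumHiggs]
  refine ⟨⟨T, isHolSection_hom fun x => ?_⟩, hj, fun φ hφ => ?_⟩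
  · obtain ⟨S, hS1, hS2⟩ := (hM x).hol.exists_inverse (hM x).bijective
    have h1 : HolHomAt (fun y => S y ∘ₗ modelHiggs (higgsAt Φ x y) (ψ x y) ∘ₗ M x y) x :=
      hS1.comp (((holHomAt_higgsAt Φ x).modelHiggs (hH x).hol_deriv).comp (hM x).hol)
    refine h1.congr ?_
    filter_upwards [hS2, eventually_mem_zeroSet hE hS x, (hM x).eventually_higgs (hH x) hj]
      with y e1 e2 e3
    refine LinearMap.ext fun v => ?_
    have h2 : M x y (locHom V (twist L 1 V) T x y v) =
        modelHiggs (higgsAt Φ x y) (ψ x y) (M x y v) := by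
      by_cases hy : y ∈ zeroSet Φ
      · obtain rfl := e2 hy
        rw [locHom_self, higgsAt_self, hT]
      · exact e3 hy v
    rw [LinearMap.comp_apply, LinearMap.comp_apply, ← h2]
    exact (LinearMap.congr_fun e1.2 _).symm
  · refine BundleHom.ext (funext fun x => LinearMap.ext fun v => (hM x).bijective.1 ?_)
    exact (ExtendsHiggs.eq hE hS (hM x) (hH x) hφ v).trans (hT x v).symm

theorem existsUnique_extendsForm (hE : IsSpHiggs E Φ om) (hS : SmoothSpectralCurve Φ)
    (hi : IsHeckeData Φ om i) (hV : IsHeckeModification Φ i V j) :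
    ∃! Q : BundleForm V (trivialLine X), ExtendsForm Φ om V j Q := by
  choose ψ α ρ hH using exists_localHecke hE hS hi
  choose M hM using exists_isLocalFrame hE hS hV
  let β : X → (Fin (2 * n + 1) → ℂ) →ₗ[ℂ] (Fin (2 * n + 1) → ℂ) →ₗ[ℂ] ℂ := fun x =>
    (modelForm (om x) (Φ x) (ψ x x) (ρ x x)).compl₁₂ (M x x) (M x x)
  have hj : ∀ x ∉ zeroSet Φ, ∀ v w, β x v w = sumForm Φ om x (j x v) (j x w) := fun x hx v w => by
    have := ((hM x).toIsLocalMap.eventually_form hE (hH x)).self_of_nhds hx v w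
    rw [HolBundle.fromFrame_self, HolBundle.fromFrame_self, higgsAt_self, formAt_self] at this
    exact this.symm
  refine ⟨⟨β, isHolSection_form fun x s t hs ht => ?_⟩, hj, fun Q hQ => ?_⟩
  · refine ((holFormAt_formAt om x).modelForm (holHomAt_higgsAt Φ x) (hH x).hol_deriv
      (hH x).hol_res _ _ ((hM x).hol _ hs) ((hM x).hol _ ht)).congr ?_
    filter_upwards [eventually_mem_zeroSet hE hS x, (hM x).toIsLocalMap.eventually_form hE (hH x)] with y e1 e2
    by_cases hy : y ∈ zeroSet Φ
    · obtain rfl := e1 hy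
      rw [locForm_self, higgsAt_self, formAt_self]
      rfl
    · rw [← e2 hy, ← hj y hy, locForm_apply]
      exact one_mul _
  · exact BundleForm.ext (funext fun x => LinearMap.ext fun v => LinearMap.ext fun w =>
      ExtendsForm.eq hE hS (hM x).toIsLocalMap (hH x) hQ v w)

theorem ExtendsForm.nondegenerate (hE : IsSpHiggs E Φ om) (hS : SmoothSpectralCurve Φ)
    (hi : IsHeckeData Φ om i) (hV : IsHeckeModification Φ i V j)
    {Q : BundleForm V (trivialLine X)} (hQ : ExtendsForm Φ om V j Q) (x : X) :
    (Q x).Nondegenerate := by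
  obtain ⟨ψ, α, ρ, hH⟩ := exists_localHecke hE hS hi x
  obtain ⟨M, hM⟩ := exists_isLocalFrame hE hS hV x
  have h := modelForm_nondegenerate (hE.nondegenerate x) (hE.alt x) (hE.compat x) hH.inj
  have hQM := ExtendsForm.eq hE hS hM.toIsLocalMap hH hQ
  constructor
  · intro v hv
    refine hM.bijective.1 (((h.1 _) fun p => ?_).trans (map_zero _).symm)
    obtain ⟨w, rfl⟩ := hM.bijective.2 p
    rw [← hQM, hv]
  · intro v hv
    refine hM.bijective.1 (((h.2 _) fun p => ?_).trans (map_zero _).symm)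
    obtain ⟨w, rfl⟩ := hM.bijective.2 p
    rw [← hQM, hv]

theorem ExtendsHiggs.charPoly_eq (hE : IsSpHiggs E Φ om) (hS : SmoothSpectralCurve Φ)
    (hi : IsHeckeData Φ om i) (hV : IsHeckeModification Φ i V j)
    {φ : BundleHom V (twist L 1 V)} (hφ : ExtendsHiggs Φ V j φ) (x : X) :
    charPoly φ x = Polynomial.X * charPoly Φ x := by
  obtain ⟨ψ, α, ρ, hH⟩ := exists_localHecke hE hS hi x
  obtain ⟨M, hM⟩ := exists_isLocalFrame hE hS hV x
  rw [charPoly, charPoly, ← charpoly_modelHiggs (ψ := ψ x),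
    ← LinearEquiv.charpoly_conj (LinearEquiv.ofBijective (M x) hM.bijective) (φ x)]
  congr 1
  refine LinearMap.ext fun p => ?_
  obtain ⟨v, rfl⟩ := hM.bijective.2 p
  have h1 : (LinearEquiv.ofBijective (M x) hM.bijective).symm (M x v) = v :=
    LinearEquiv.symm_apply_apply (LinearEquiv.ofBijective (M x) hM.bijective) v
  rw [LinearEquiv.conj_apply_apply, h1]
  exact ExtendsHiggs.eq hE hS hM hH hφ v

/-- In the frame, `φ` is `(q, 0)` with `q = modelQuot`, so `φ` and `q` have the same kernel fibre by
fibre, and `Q(φv, w) = ω(qv, qw)` is `modelForm_modelHiggs`. -/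
theorem isAssociatedSp_of_extends (hE : IsSpHiggs E Φ om) (hS : SmoothSpectralCurve Φ)
    (hi : IsHeckeData Φ om i) (hV : IsHeckeModification Φ i V j)
    {φ : BundleHom V (twist L 1 V)} {Q : BundleForm V (trivialLine X)}
    (hφ : ExtendsHiggs Φ V j φ) (hQ : ExtendsForm Φ om V j Q) : IsAssociatedSp V φ Q Φ om := by
  choose ψ α ρ hH using exists_localHecke hE hS hi
  choose M hM using exists_isLocalFrame hE hS hV
  let q : X → (Fin (2 * n + 1) → ℂ) →ₗ[ℂ] (Fin (2 * n) → ℂ) := fun x =>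
    modelQuot (Φ x) (ψ x x) ∘ₗ M x x
  have hφq : ∀ x v, M x x (φ x v) = (q x v, 0) := fun x v =>
    ExtendsHiggs.eq hE hS (hM x) (hH x) hφ v
  refine ⟨⟨q, isHolSection_hom fun x => ?_⟩, fun x e => ?_, fun U s hU hs => ?_, fun x v => ?_,
    fun x v w => ?_⟩
  · have h1 : HolHomAt (fun y => modelQuot (higgsAt Φ x y) (ψ x y) ∘ₗ M x y) x :=
      ((holHomAt_higgsAt Φ x).modelQuot (hH x).hol_deriv).comp (hM x).hol
    refine h1.congr ?_
    filter_upwards [eventually_mem_zeroSet hE hS x, (hM x).eventually_quot (hH x)] with y e1 e2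
    refine LinearMap.ext fun v => ?_
    by_cases hy : y ∈ zeroSet Φ
    · obtain rfl := e1 hy
      rw [locHom_self, higgsAt_self]
    · have := ((hM y).eventually_quot (hH y)).self_of_nhds hy (V.fromFrame x y v)
      rw [HolBundle.toFrame_self, HolBundle.fromFrame_self, higgsAt_self] at this
      rw [LinearMap.comp_apply, ← e2 hy, locHom_apply, this]
      rfl
  · obtain ⟨c, b, h⟩ := (hH x).surj e
    obtain ⟨v, hv⟩ := (hM x).bijective.2 (c, b)
    refine ⟨v, ?_⟩
    change modelQuot (Φ x) (ψ x x) (M x x v) = e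
    rw [hv]
    exact h
  · have h0 : ∀ x v, q x v = 0 ↔ φ x v = 0 := fun x v => by
      rw [← (hM x).bijective.1.eq_iff, hφq, map_zero, Prod.mk_eq_zero, and_iff_left rfl]
    exact forall₂_congr fun x _ => h0 x (s x)
  · change modelQuot (Φ x) (ψ x x) (M x x (φ x v)) = _
    rw [hφq, modelQuot_apply, zero_smul, sub_zero]
  · rw [ExtendsForm.eq hE hS (hM x).toIsLocalMap (hH x) hQ, ExtendsHiggs.eq hE hS (hM x) (hH x) hφ,
      modelForm_modelHiggs]
    rfl

end Extension

/-! ### Triviality of `det V`. -/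

section Determinant

variable {X : Type u} [TopologicalSpace X] [ChartedSpace ℂ X]
  {L : HolBundle X ℂ} {n : ℕ} {E : HolBundle X (Fin (2 * n) → ℂ)}
  {Φ : BundleHom E (twist L 1 E)} {om : BundleForm E L} {i : X → ℂ →ₗ[ℂ] (Fin (2 * n) → ℂ)}
  {V : HolBundle X (Fin (2 * n + 1) → ℂ)} {j : X → (Fin (2 * n + 1) → ℂ) →ₗ[ℂ] (Fin (2 * n) → ℂ) × ℂ}

/-- The determinant of a linear map from a fibre of `V` to one of `L⁻¹E ⊕ L⁻ⁿ`. -/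
noncomputable def sumDet (M : (Fin (2 * n + 1) → ℂ) →ₗ[ℂ] (Fin (2 * n) → ℂ) × ℂ) : ℂ :=
  LinearMap.det (((sumEquiv n).symm : (Fin (2 * n) → ℂ) × ℂ →ₗ[ℂ] _) ∘ₗ M)

theorem sumDet_comp_left (B : (Fin (2 * n) → ℂ) × ℂ →ₗ[ℂ] (Fin (2 * n) → ℂ) × ℂ)
    (M : (Fin (2 * n + 1) → ℂ) →ₗ[ℂ] (Fin (2 * n) → ℂ) × ℂ) :
    sumDet (B ∘ₗ M) = LinearMap.det B * sumDet M := det_symm_comp B M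

theorem sumDet_comp_right (M : (Fin (2 * n + 1) → ℂ) →ₗ[ℂ] (Fin (2 * n) → ℂ) × ℂ)
    (g : (Fin (2 * n + 1) → ℂ) →ₗ[ℂ] (Fin (2 * n + 1) → ℂ)) :
    sumDet (M ∘ₗ g) = sumDet M * LinearMap.det g := by
  rw [sumDet, ← LinearMap.comp_assoc, LinearMap.det_comp, sumDet]

theorem det_heckeFrame (u : Fin (2 * n) → ℂ) (ζ : ℂ) : LinearMap.det (heckeFrame u ζ) = ζ⁻¹ := by
  have : heckeFrame u ζ = triangularMap LinearMap.id (-ζ⁻¹ • u) ζ⁻¹ := LinearMap.ext fun p => by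
    rw [heckeFrame_apply, triangularMap_apply, smul_smul, mul_neg, neg_smul, mul_comm p.2,
      sub_eq_add_neg]
    rfl
  rw [this, det_triangularMap, LinearMap.det_id, one_mul]

theorem det_toFrame_sumBundle (L : HolBundle X ℂ) (E : HolBundle X (Fin (2 * n) → ℂ)) (x y : X) :
    LinearMap.det ((sumBundle L E).toFrame x y : (Fin (2 * n) → ℂ) × ℂ →ₗ[ℂ] _) =
      (lineFactor L x y ^ (3 * n))⁻¹ *
        LinearMap.det (E.toFrame x y : (Fin (2 * n) → ℂ) →ₗ[ℂ] _) := by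
  have : ((sumBundle L E).toFrame x y : (Fin (2 * n) → ℂ) × ℂ →ₗ[ℂ] _) =
      triangularMap ((lineFactor L x y)⁻¹ • (E.toFrame x y : (Fin (2 * n) → ℂ) →ₗ[ℂ] _)) 0
        (lineFactor L x y ^ n)⁻¹ := LinearMap.ext fun p => by
    refine (toFrame_sumBundle x y p).trans ?_
    rw [triangularMap_apply, smul_zero, add_zero]
    rfl
  rw [this, det_triangularMap, LinearMap.det_smul, Module.finrank_fintype_fun_eq_card,
    Fintype.card_fin, show 3 * n = 2 * n + n by ring, pow_add, mul_inv, inv_pow]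
  ring

theorem pfaffian_formAt (om : BundleForm E L) (x y : X) :
    pfaffian (fun v w => formAt om x y v w) = lineFactor L x y ^ n *
      (LinearMap.det (E.fromFrame x y : (Fin (2 * n) → ℂ) →ₗ[ℂ] _) *
        pfaffian (fun v w => om y v w)) := by
  rw [← pfaffian_comp (om y), ← pfaffian_smul]
  rfl

theorem IsLocalFrame.eventually_sumDet {x : X}
    {M : X → (Fin (2 * n + 1) → ℂ) →ₗ[ℂ] (Fin (2 * n) → ℂ) × ℂ} (hM : IsLocalFrame Φ i V j x M) :
    ∀ᶠ y in 𝓝 x, y ∉ zeroSet Φ → (heckeCoord Φ x y)⁻¹ * sumDet (M y) =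
      LinearMap.det ((sumBundle L E).toFrame x y : (Fin (2 * n) → ℂ) × ℂ →ₗ[ℂ] _) *
        (sumDet (j y) * LinearMap.det (V.fromFrame x y : (Fin (2 * n + 1) → ℂ) →ₗ[ℂ] _)) := by
  filter_upwards [hM.eq] with y hy hyD
  rw [← det_heckeFrame (heckeVec Φ i x), ← sumDet_comp_left, ← sumDet_comp_right,
    ← sumDet_comp_left]
  congr 1
  exact LinearMap.ext fun v => (hy hyD v).symm

variable [IsManifold 𝓘(ℂ) ω X]

/-- The determinant of the Hecke modification is trivial. -/
theorem isTrivialLine_detBundle (hE : IsSpHiggs E Φ om) (hS : SmoothSpectralCurve Φ)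
    (hi : IsHeckeData Φ om i) (hV : IsHeckeModification Φ i V j) :
    IsTrivialLine (detBundle V) := by
  choose ψ α ρ hH using exists_localHecke hE hS hi
  choose M hM using exists_isLocalFrame hE hS hV
  have hpf : ∀ x, pfaffian (fun v w => om x v w) ≠ 0 := fun x =>
    pfaffian_ne_zero (hE.alt x) (hE.nondegenerate x)
  have hdet : ∀ x, sumDet (M x x) ≠ 0 := fun x => det_symm_comp_ne_zero (hM x).bijective
  -- The product of `det E ≅ Lⁿ` (Pfaffian), `𝒪(D) ≅ L²ⁿ` (`α`) and `det V ≅ L⁻³ⁿ det E (D)`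
  -- (`sumDet`). Each factor is invertible at `x`, and the powers of `L` cancel.
  let d : X → X → ℂ := fun x y => pfaffian (fun v w => formAt om x y v w) * α x y * sumDet (M x y)
  have hd : ∀ x, HolAt (d x) x := fun x =>
    ((holFormAt_formAt om x).pfaffian.mul (hH x).hol_coeff).mul
      (HolHomAt.det ((holHomAt_clm (sumEquiv n).symm.toContinuousLinearMap x).comp (hM x).hol))
  have hd0 : ∀ x, d x x ≠ 0 := fun x => by
    simp only [d, formAt_self]
    exact mul_ne_zero (mul_ne_zero (hpf x) (hH x).coeff_ne_zero) (hdet x)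
  refine ⟨fun x => (d x x)⁻¹, ((detBundle V).isHolSection_iff isOpen_univ).2 fun x _ => ?_,
    fun x => inv_ne_zero (hd0 x)⟩
  refine ((hd x).inv (hd0 x)).congr ?_
  filter_upwards [eventually_mem_zeroSet hE hS x, (hM x).eventually_sumDet, (hH x).coord_ne_zero,
    (hH x).coeff_eq, (sumBundle L E).eventually_mem_frameSet x, V.eventually_mem_frameSet x,
    (hd x).continuousAt.eventually_ne (hd0 x)] with y e1 e2 e3 e4 e5 e6 e7
  by_cases hy : y ∈ zeroSet Φ
  · obtain rfl := e1 hy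
    rw [HolBundle.toFrame_self]
  obtain ⟨hL, hyE⟩ := mem_frameSet_sumBundle e5
  have h0 := lineFactor_ne_zero L hL
  have hj : j y = M y y := LinearMap.ext fun v => (hM y).eq_of_notMem hy v
  have hα : charCoeff Φ (2 * n) y = α y y := by
    have := (hH y).coeff_eq.self_of_nhds
    rwa [coeffAt_self, heckeCoord_of_notMem hy, one_mul] at this
  rw [toFrame_detBundle, ← div_eq_mul_inv, div_eq_iff (hd0 y), inv_mul_eq_div, eq_div_iff e7]
  specialize e2 hy
  specialize e3 hy
  rw [coeffAt, hα] at e4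
  rw [hj, det_toFrame_sumBundle] at e2
  have hy1 : d y y = pfaffian (fun v w => om y v w) * α y y * sumDet (M y y) := by
    simp only [d, formAt_self]
  rw [hy1]
  simp only [d, pfaffian_formAt]
  have hVd := det_toFrame_mul V e6
  have hEd := det_toFrame_mul E hyE
  have e2' : sumDet (M x y) * lineFactor L x y ^ (3 * n) = heckeCoord Φ x y *
      (LinearMap.det (E.toFrame x y : (Fin (2 * n) → ℂ) →ₗ[ℂ] _) * (sumDet (M y y) *
        LinearMap.det (V.fromFrame x y : (Fin (2 * n + 1) → ℂ) →ₗ[ℂ] _))) := by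
    field_simp at e2
    linear_combination e2
  -- The extra power completes `Lⁿ` to `L³ⁿ`, so that `e2'` and `e4` apply without division.
  refine mul_right_cancel₀ (pow_ne_zero (2 * n) h0) ?_
  generalize LinearMap.det (V.toFrame x y : (Fin (2 * n + 1) → ℂ) →ₗ[ℂ] _) = a at *
  generalize LinearMap.det (V.fromFrame x y : (Fin (2 * n + 1) → ℂ) →ₗ[ℂ] _) = a' at *
  generalize LinearMap.det (E.toFrame x y : (Fin (2 * n) → ℂ) →ₗ[ℂ] _) = b at *
  generalize LinearMap.det (E.fromFrame x y : (Fin (2 * n) → ℂ) →ₗ[ℂ] _) = b' at *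
  generalize sumDet (M x y) = s at *
  generalize sumDet (M y y) = s' at *
  generalize pfaffian (fun v w => om y v w) = p at *
  generalize heckeCoord Φ x y = ζ at *
  have e5' : lineFactor L x y ^ (3 * n) = lineFactor L x y ^ n * lineFactor L x y ^ (2 * n) := by
    rw [← pow_add]; congr 1; ring
  rw [e5'] at e2'
  linear_combination (a * b' * p * α x y) * e2' + (ζ * a * a' * s' * p * α x y) * hEd +
    (ζ * s' * p * α x y) * hVd - (s' * p) * e4

theorem isSOHiggs_of_extends (hE : IsSpHiggs E Φ om) (hS : SmoothSpectralCurve Φ)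
    (hi : IsHeckeData Φ om i) (hV : IsHeckeModification Φ i V j)
    {φ : BundleHom V (twist L 1 V)} {Q : BundleForm V (trivialLine X)}
    (hφ : ExtendsHiggs Φ V j φ) (hQ : ExtendsForm Φ om V j Q) : IsSOHiggs V φ Q where
  det_trivial := isTrivialLine_detBundle hE hS hi hV
  symm x v w := by
    obtain ⟨ψ, α, ρ, hH⟩ := exists_localHecke hE hS hi x
    obtain ⟨M, hM⟩ := exists_isLocalFrame hE hS hV x
    rw [ExtendsForm.eq hE hS hM.toIsLocalMap hH hQ, ExtendsForm.eq hE hS hM.toIsLocalMap hH hQ,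
      modelForm_symm (hE.alt x) (hE.compat x)]
  nondegenerate := ExtendsForm.nondegenerate hE hS hi hV hQ
  compat x v w := by
    obtain ⟨ψ, α, ρ, hH⟩ := exists_localHecke hE hS hi x
    obtain ⟨M, hM⟩ := exists_isLocalFrame hE hS hV x
    rw [ExtendsForm.eq hE hS hM.toIsLocalMap hH hQ, ExtendsForm.eq hE hS hM.toIsLocalMap hH hQ,
      ExtendsHiggs.eq hE hS hM hH hφ, ExtendsHiggs.eq hE hS hM hH hφ, modelForm_modelHiggs,
      modelForm_symm (hE.alt x) (hE.compat x), modelForm_modelHiggs,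
      ← (hE.alt x).neg, neg_add_cancel]

end Determinant

/-! ### The kernel of `V → E` and its normalised section. -/

section Quotient

variable {X : Type u} [TopologicalSpace X] [ChartedSpace ℂ X]
  {L : HolBundle X ℂ} {n : ℕ} {E : HolBundle X (Fin (2 * n) → ℂ)}

/-- `q : V → E` identifies `(E, Φ, ω)` with the triple constructed from `(V, φ, Q)`. -/
structure IsSpQuotient {V : HolBundle X (Fin (2 * n + 1) → ℂ)} (φ : BundleHom V (twist L 1 V))
    (Q : BundleForm V (trivialLine X)) (Φ : BundleHom E (twist L 1 E)) (om : BundleForm E L)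
    (q : BundleHom V E) : Prop where
  so : IsSOHiggs V φ Q
  surj : ∀ x, Function.Surjective (q x)
  comm : ∀ x v, q x (φ x v) = Φ x (q x v)
  form : ∀ x v w, om x (q x v) (q x w) = Q x (φ x v) w

variable {V : HolBundle X (Fin (2 * n + 1) → ℂ)} {φ : BundleHom V (twist L 1 V)}
  {Q : BundleForm V (trivialLine X)} {Φ : BundleHom E (twist L 1 E)} {om : BundleForm E L}
  {q : BundleHom V E}

namespace IsSpQuotient

/-- `Q(φv, w) = ω(qv, qw)` vanishes for all `w`, and `Q` is non-degenerate. -/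
theorem higgs_eq_zero (hq : IsSpQuotient φ Q Φ om q) {x : X} {v : Fin (2 * n + 1) → ℂ}
    (hv : q x v = 0) : φ x v = 0 :=
  (hq.so.nondegenerate x).1 _ fun w => by
    rw [← hq.form, hv, map_zero, LinearMap.zero_apply]

theorem form_higgs (hq : IsSpQuotient φ Q Φ om q) {x : X} {e : Fin (2 * n + 1) → ℂ}
    (he : q x e = 0) (v : Fin (2 * n + 1) → ℂ) : Q x e (φ x v) = 0 := by
  have := hq.so.compat x e v
  rwa [hq.higgs_eq_zero he, map_zero, LinearMap.zero_apply, zero_add] at this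

variable {x : X} {e : Fin (2 * n + 1) → ℂ}

theorem exists_higgs_eq_smul (hq : IsSpQuotient φ Q Φ om q) (he : q x e = 0) (he0 : e ≠ 0)
    {v : Fin (2 * n + 1) → ℂ} (hv : Φ x (q x v) = 0) : ∃ μ : ℂ, φ x v = μ • e :=
  exists_smul_eq_of_ker (hq.surj x) he he0 (by rw [hq.comm, hv])

/-- A lift `v` of a non-zero element of `ker Φ_x` has `φv = μe` with `μ ≠ 0`, and `e` is orthogonal
to the image of `φ`. -/
theorem form_self_eq_zero (hE : IsSpHiggs E Φ om) (hq : IsSpQuotient φ Q Φ om q)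
    (he : q x e = 0) (he0 : e ≠ 0) (hx : x ∈ zeroSet Φ) : Q x e e = 0 := by
  obtain ⟨k, hk, hk0⟩ := (LinearMap.ker (Φ x)).ne_bot_iff.1
    (LinearMap.bot_lt_ker_of_det_eq_zero (det_eq_zero_of_mem hx)).ne'
  obtain ⟨v, rfl⟩ := hq.surj x k
  obtain ⟨μ, hμ⟩ := hq.exists_higgs_eq_smul he he0 hk
  have hμ0 : μ ≠ 0 := by
    rintro rfl
    refine hk0 ((hE.nondegenerate x).1 _ fun w => ?_)
    obtain ⟨w, rfl⟩ := hq.surj x w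
    rw [hq.form, hμ, zero_smul, map_zero, LinearMap.zero_apply]
  have := hq.form_higgs he v
  rw [hμ, map_smul, smul_eq_mul] at this
  exact (mul_eq_zero.1 this).resolve_left hμ0

/-- Off `D` the fibre is spanned by `e` and the image of `φ`, which is orthogonal to `e`; an
isotropic `e` would lie in the radical. -/
theorem form_self_ne_zero (hq : IsSpQuotient φ Q Φ om q)
    (he : q x e = 0) (he0 : e ≠ 0) (hx : x ∉ zeroSet Φ) : Q x e e ≠ 0 := by
  intro h0
  refine he0 ((hq.so.nondegenerate x).1 _ fun v => ?_)
  obtain ⟨c, hc⟩ := (bijective_of_notMem hx).2 (q x v)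
  obtain ⟨s, rfl⟩ := hq.surj x c
  obtain ⟨b, hb⟩ := exists_smul_eq_of_ker (hq.surj x) he he0 (v := v - φ x s)
    (by rw [map_sub, hq.comm, hc, sub_self])
  rw [← sub_add_cancel v (φ x s), hb, map_add, hq.form_higgs he, map_smul, h0, smul_zero, add_zero]

/-- At a zero of `a_{2n}`, the adjugate of the Higgs field factors over the form `Q(e, ·)`. -/
theorem exists_adjugateMap_eq (hE : IsSpHiggs E Φ om) (hq : IsSpQuotient φ Q Φ om q)
    (he : q x e = 0) (he0 : e ≠ 0) (hx : x ∈ zeroSet Φ) :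
    ∃ u, Φ x u = 0 ∧ ∀ v, adjugateMap (Φ x) (q x v) = -Q x e v • u := by
  have hdet := det_eq_zero_of_mem hx
  -- If `Q(e, v) = 0`, then `qv` is orthogonal to `ker Φ_x`, because `ω(qs, qv) = Q(φs, v)` with
  -- `φs` a multiple of `e`. Hence `qv` is in the image of `Φ_x`.
  have h1 : ∀ v, Q x e v = 0 → adjugateMap (Φ x) (q x v) = 0 := fun v hv => by
    obtain ⟨w, hw⟩ := exists_eq_of_orthogonal_ker (hE.nondegenerate x) (hE.compat x) (w := q x v)
      fun k hk => by
        obtain ⟨s, rfl⟩ := hq.surj x k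
        obtain ⟨μ, hμ⟩ := hq.exists_higgs_eq_smul he he0 hk
        rw [hq.form, hμ, map_smul, LinearMap.smul_apply, hv, smul_zero]
    rw [← hw, adjugateMap_comp, hdet, zero_smul]
  obtain ⟨v0, hv0⟩ : ∃ v, Q x e v ≠ 0 := by
    by_contra! h
    exact he0 ((hq.so.nondegenerate x).1 _ h)
  refine ⟨-((Q x e v0)⁻¹ • adjugateMap (Φ x) (q x v0)), ?_, fun v => ?_⟩
  · rw [map_neg, map_smul, comp_adjugateMap, hdet, zero_smul, smul_zero, neg_zero]
  · have := h1 (v - (Q x e v * (Q x e v0)⁻¹) • v0) (by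
      rw [map_sub, map_smul, smul_eq_mul, inv_mul_cancel_right₀ hv0, sub_self])
    rw [map_sub, map_sub, map_smul, map_smul, sub_eq_zero] at this
    rw [this, neg_smul, smul_neg, neg_neg, smul_smul]

end IsSpQuotient

theorem locForm_section (Q : BundleForm V (trivialLine X)) {e : X → Fin (2 * n + 1) → ℂ} {x y : X}
    (hy : y ∈ V.frameSet x) (v : Fin (2 * n + 1) → ℂ) :
    locForm V (trivialLine X) Q x y (lineFactor L x y ^ n • V.toFrame x y (e y)) v =
      lineFactor L x y ^ n * Q y (e y) (V.fromFrame x y v) := by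
  rw [locForm_apply, map_smul, V.fromFrame_toFrame hy, map_smul, LinearMap.smul_apply, smul_eq_mul]
  exact one_mul _

variable [IsManifold 𝓘(ℂ) ω X]

/-- A nowhere vanishing section of `Lⁿ ⊗ V` in the kernel of the quotient map. -/
theorem IsSpQuotient.exists_section (hE : IsSpHiggs E Φ om) (hq : IsSpQuotient φ Q Φ om q) :
    ∃ e : X → Fin (2 * n + 1) → ℂ, (∀ x, q x (e x) = 0) ∧ (∀ x, e x ≠ 0) ∧
      ∀ x, HolAt (fun y => lineFactor L x y ^ n • V.toFrame x y (e y)) x := by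
  obtain ⟨σ, hσ, hσ0⟩ := hq.so.det_trivial
  rw [HolBundle.isHolSection_iff _ isOpen_univ] at hσ
  -- The cross product gives `ker q ≅ det V ⊗ (det E)⁻¹`; `σ` trivialises `det V`, and the Pfaffian
  -- converts `det E` into `Lⁿ`.
  refine ⟨fun x => (σ x * pfaffian (fun v w => om x v w)) • cross (q x), fun x => ?_, fun x => ?_,
    fun x => ?_⟩
  · rw [map_smul, apply_cross, smul_zero]
  · exact smul_ne_zero (mul_ne_zero (hσ0 x) (pfaffian_ne_zero (hE.alt x) (hE.nondegenerate x)))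
      (cross_ne_zero (hq.surj x))
  · refine (((hσ x (mem_univ x)).mul (holFormAt_formAt om x).pfaffian).smul
      (q.holHomAt x).cross).congr ?_
    filter_upwards [E.eventually_mem_frameSet x, V.eventually_mem_frameSet x] with y h1 h2
    have hc : (V.fromFrame x y : (Fin (2 * n + 1) → ℂ) →ₗ[ℂ] _) (cross (locHom V E q x y)) =
        (LinearMap.det (V.fromFrame x y : (Fin (2 * n + 1) → ℂ) →ₗ[ℂ] _) *
          LinearMap.det (E.toFrame x y : (Fin (2 * n) → ℂ) →ₗ[ℂ] _)) • cross (q y) := by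
      rw [locHom, ← LinearMap.comp_assoc, apply_cross_comp, cross_comp_left, smul_smul]
    have hc' : cross (locHom V E q x y) =
        (LinearMap.det (V.fromFrame x y : (Fin (2 * n + 1) → ℂ) →ₗ[ℂ] _) *
          LinearMap.det (E.toFrame x y : (Fin (2 * n) → ℂ) →ₗ[ℂ] _)) •
            V.toFrame x y (cross (q y)) := by
      rw [← map_smul, ← hc]
      exact (V.toFrame_fromFrame h2 _).symm
    rw [hc', toFrame_detBundle, pfaffian_formAt, map_smul, smul_smul, smul_smul]
    congr 1
    have hV := det_toFrame_mul V h2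
    have hE' := det_toFrame_mul E h1
    generalize LinearMap.det (V.toFrame x y : (Fin (2 * n + 1) → ℂ) →ₗ[ℂ] _) = a at *
    generalize LinearMap.det (V.fromFrame x y : (Fin (2 * n + 1) → ℂ) →ₗ[ℂ] _) = a' at *
    generalize LinearMap.det (E.toFrame x y : (Fin (2 * n) → ℂ) →ₗ[ℂ] _) = b at *
    generalize LinearMap.det (E.fromFrame x y : (Fin (2 * n) → ℂ) →ₗ[ℂ] _) = b' at *
    generalize pfaffian (fun v w => om y v w) = p at *
    linear_combination (-lineFactor L x y ^ n * σ y * p) * hV -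
      (lineFactor L x y ^ n * σ y * p * (a * a')) * hE'

/-- `e` is the section of `Lⁿ ⊗ V` which corresponds to the second summand of `L⁻¹E ⊕ L⁻ⁿ`. -/
structure IsKernelSection (Q : BundleForm V (trivialLine X)) (Φ : BundleHom E (twist L 1 E))
    (q : BundleHom V E) (e : X → Fin (2 * n + 1) → ℂ) : Prop where
  ker : ∀ x, q x (e x) = 0
  ne_zero : ∀ x, e x ≠ 0
  hol : ∀ x, HolAt (fun y => lineFactor L x y ^ n • V.toFrame x y (e y)) x
  form_self : ∀ x, Q x (e x) (e x) = charCoeff Φ (2 * n) x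

theorem IsSpQuotient.exists_isKernelSection [CompactSpace X] [ConnectedSpace X]
    (hE : IsSpHiggs E Φ om) (hS : SmoothSpectralCurve Φ) (hq : IsSpQuotient φ Q Φ om q) :
    ∃ e, IsKernelSection Q Φ q e := by
  obtain ⟨e, h1, h2, h3⟩ := hq.exists_section hE
  -- Locally `Q(e, e)/a_{2n}` is holomorphic: at points of `D` the numerator vanishes and the zero
  -- of the denominator is simple.
  have key : ∀ x, ∃ F : X → ℂ, HolAt F x ∧ ∀ᶠ y in 𝓝 x, y ∉ zeroSet Φ →
      Q y (e y) (e y) = F y * charCoeff Φ (2 * n) y := by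
    intro x
    have h4 := Q.holFormAt x _ _ (h3 x) (h3 x)
    have h5 : ∀ᶠ y in 𝓝 x, locForm V (trivialLine X) Q x y
        (lineFactor L x y ^ n • V.toFrame x y (e y)) (lineFactor L x y ^ n • V.toFrame x y (e y)) =
        lineFactor L x y ^ (2 * n) * Q y (e y) (e y) := by
      filter_upwards [V.eventually_mem_frameSet x] with y hy
      rw [locForm_section Q hy, map_smul, V.fromFrame_toFrame hy, map_smul, smul_eq_mul]
      ring
    by_cases hx : x ∈ zeroSet Φ
    · obtain ⟨α, hα, hα0, hαe, -⟩ := exists_coeffAt_eq hE hS hx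
      obtain ⟨β, hβ, hβe, -⟩ := h4.exists_eq_smul (by
        simpa using hq.form_self_eq_zero hE (h1 x) (h2 x) hx)
      refine ⟨fun y => β y * (α y)⁻¹, hβ.mul (hα.inv hα0), ?_⟩
      filter_upwards [hβe, h5, hαe, hα.continuousAt.eventually_ne hα0,
        L.eventually_mem_frameSet x] with y e1 e2 e3 e4 e5 _
      have h0 := pow_ne_zero (2 * n) (lineFactor_ne_zero L e5)
      rw [e2, smul_eq_mul] at e1
      rw [coeffAt] at e3
      refine mul_left_cancel₀ h0 ?_
      rw [e1]
      field_simp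
      linear_combination -β y * e3
    · have h0 : coeffAt Φ x x ≠ 0 := by rw [coeffAt_self]; exact hx
      refine ⟨_, h4.mul ((holAt_coeffAt Φ x).inv h0), ?_⟩
      filter_upwards [h5, L.eventually_mem_frameSet x] with y e2 e5 hy
      have h6 := pow_ne_zero (2 * n) (lineFactor_ne_zero L e5)
      have h7 : charCoeff Φ (2 * n) y ≠ 0 := hy
      rw [e2, coeffAt]
      field_simp
  choose F hF1 hF2 using key
  have hF : MDifferentiable 𝓘(ℂ) 𝓘(ℂ) (fun x => F x x) := fun x => by
    refine ContMDiffAt.mdifferentiableAt (n := ω) ((hF1 x).congr ?_) (by simp)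
    filter_upwards [hF2 x, eventually_mem_zeroSet hE hS x] with y e1 e2
    by_cases hy : y ∈ zeroSet Φ
    · rw [e2 hy]
    · have h7 : charCoeff Φ (2 * n) y ≠ 0 := hy
      exact mul_right_cancel₀ h7 (((hF2 y).self_of_nhds hy).symm.trans (e1 hy))
  -- The maximum principle on the compact connected surface.
  obtain ⟨C, hC⟩ := hF.exists_eq_const_of_compactSpace
  have hC' : ∀ x, Q x (e x) (e x) = C * charCoeff Φ (2 * n) x := fun x => by
    by_cases hx : x ∈ zeroSet Φ
    · have hx' : charCoeff Φ (2 * n) x = 0 := hx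
      rw [hx', mul_zero, hq.form_self_eq_zero hE (h1 x) (h2 x) hx]
    · rw [(hF2 x).self_of_nhds hx]
      exact congrArg (· * _) (congrFun hC x)
  have hC0 : C ≠ 0 := by
    obtain ⟨x⟩ := (inferInstance : Nonempty X)
    obtain ⟨y, hy⟩ : ∃ y, y ∉ zeroSet Φ := by
      have := neBot_nhdsWithin_compl x
      obtain ⟨y, hy, hne⟩ := (((eventually_mem_zeroSet hE hS x).filter_mono nhdsWithin_le_nhds).and
        (self_mem_nhdsWithin (s := {x}ᶜ))).exists
      exact ⟨y, fun h => hne (hy h)⟩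
    rintro rfl
    exact hq.form_self_ne_zero (h1 y) (h2 y) hy (by rw [hC', zero_mul])
  -- Scaling `e` by `κ` scales `Q(e, e) = C a_{2n}` by `κ² = C⁻¹`.
  obtain ⟨κ, hκ⟩ := IsAlgClosed.exists_pow_nat_eq C⁻¹ (n := 2) two_pos
  have hκ0 : κ ≠ 0 := by
    rintro rfl
    exact inv_ne_zero hC0 (hκ.symm.trans (zero_pow two_ne_zero))
  refine ⟨fun x => κ • e x, fun x => ?_, fun x => smul_ne_zero hκ0 (h2 x), fun x => ?_, fun x => ?_⟩
  · rw [map_smul, h1, smul_zero]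
  · refine ((holAt_const κ x).smul (h3 x)).congr (.of_forall fun y => ?_)
    rw [map_smul, smul_comm]
  · simp only [map_smul, LinearMap.smul_apply, smul_eq_mul, hC']
    field_simp at hκ
    linear_combination charCoeff Φ (2 * n) x * hκ

end Quotient

/-! ### Every `SO`-bundle that yields `(E, Φ, ω)` is a Hecke modification. -/

section Converse

variable {X : Type u} [TopologicalSpace X] [ChartedSpace ℂ X]
  {L : HolBundle X ℂ} {n : ℕ} {E : HolBundle X (Fin (2 * n) → ℂ)}
  {V : HolBundle X (Fin (2 * n + 1) → ℂ)} {φ : BundleHom V (twist L 1 V)}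
  {Q : BundleForm V (trivialLine X)} {Φ : BundleHom E (twist L 1 E)} {om : BundleForm E L}
  {q : BundleHom V E} {e : X → Fin (2 * n + 1) → ℂ}

/-- The map from `V` to `L⁻¹E ⊕ L⁻ⁿ` over the complement of `D`. -/
noncomputable def splitting (Φ : BundleHom E (twist L 1 E)) (Q : BundleForm V (trivialLine X))
    (q : BundleHom V E) (e : X → Fin (2 * n + 1) → ℂ) (x : X) :
    (Fin (2 * n + 1) → ℂ) →ₗ[ℂ] (Fin (2 * n) → ℂ) × ℂ :=
  -- This is `(Φ⁻¹qv, Q(e, v)/a_{2n})`; with the adjugate in place of `Φ⁻¹` the numerator is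
  -- holomorphic across `D`.
  (charCoeff Φ (2 * n) x)⁻¹ • (adjugateMap (Φ x) ∘ₗ q x).prod (Q x (e x))

theorem splitting_apply (x : X) (v : Fin (2 * n + 1) → ℂ) : splitting Φ Q q e x v =
    ((charCoeff Φ (2 * n) x)⁻¹ • adjugateMap (Φ x) (q x v),
      (charCoeff Φ (2 * n) x)⁻¹ * Q x (e x) v) := rfl

theorem higgs_splitting {x : X} (hx : x ∉ zeroSet Φ) (v : Fin (2 * n + 1) → ℂ) :
    Φ x (splitting Φ Q q e x v).1 = q x v := by
  have h0 : charCoeff Φ (2 * n) x ≠ 0 := hx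
  rw [splitting_apply, map_smul, comp_adjugateMap, ← charCoeff_eq_det, inv_smul_smul₀ h0]

theorem extendsHiggs_splitting (hq : IsSpQuotient φ Q Φ om q) (he : IsKernelSection Q Φ q e) :
    ExtendsHiggs Φ V (splitting Φ Q q e) φ := fun x hx v => by
  have h0 : charCoeff Φ (2 * n) x ≠ 0 := hx
  rw [sumHiggs, higgs_splitting hx, splitting_apply, hq.form_higgs (he.ker x), mul_zero, hq.comm,
    adjugateMap_comp, ← charCoeff_eq_det, inv_smul_smul₀ h0]

/-- Write `v = φs + ce` with `qs = Φ⁻¹qv`. Then `Q(φs, w) = ω(Φ⁻¹qv, qw)`, and `Q(e, e) = a_{2n}`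
gives `c = Q(e, v)/a_{2n}`. -/
theorem extendsForm_splitting (hE : IsSpHiggs E Φ om) (hq : IsSpQuotient φ Q Φ om q)
    (he : IsKernelSection Q Φ q e) : ExtendsForm Φ om V (splitting Φ Q q e) Q := fun x hx v w => by
  have h0 : charCoeff Φ (2 * n) x ≠ 0 := hx
  obtain ⟨s, hs⟩ := hq.surj x (splitting Φ Q q e x v).1
  obtain ⟨c, hc⟩ := exists_smul_eq_of_ker (hq.surj x) (he.ker x) (he.ne_zero x) (v := v - φ x s)
    (by rw [map_sub, hq.comm, hs, higgs_splitting hx, sub_self])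
  have h1 : Q x (e x) v = c * charCoeff Φ (2 * n) x := by
    rw [← sub_add_cancel v (φ x s), hc, map_add, hq.form_higgs (he.ker x), map_smul, he.form_self,
      add_zero, smul_eq_mul]
  have h2 : Q x v w = om x (splitting Φ Q q e x v).1 (q x w) + c * Q x (e x) w := by
    conv_lhs => rw [← sub_add_cancel v (φ x s), hc]
    rw [map_add, LinearMap.add_apply, ← hq.form, hs, map_smul, LinearMap.smul_apply, smul_eq_mul,
      add_comm]
  rw [sumForm, symm_of_compat (hE.alt x) (hE.compat x) (splitting Φ Q q e x w).1,
    higgs_splitting hx, h2]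
  simp only [splitting_apply, h1]
  field_simp
  ring

/-- The kernel lies in the radical of `Q`, because `Q` is a pullback under the map. -/
theorem bijective_splitting (hE : IsSpHiggs E Φ om) (hq : IsSpQuotient φ Q Φ om q)
    (he : IsKernelSection Q Φ q e) {x : X} (hx : x ∉ zeroSet Φ) :
    Function.Bijective (splitting Φ Q q e x) :=
  bijective_of_injective ((injective_iff_map_eq_zero _).2 fun v hv =>
    (hq.so.nondegenerate x).1 _ fun w => by
      rw [extendsForm_splitting hE hq he x hx, hv]
      simp [sumForm])

theorem toFrame_splitting (Q : BundleForm V (trivialLine X)) (q : BundleHom V E)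
    (e : X → Fin (2 * n + 1) → ℂ) {x y : X} (hW : y ∈ (sumBundle L E).frameSet x)
    (hV : y ∈ V.frameSet x) (hy : y ∉ zeroSet Φ) (v : Fin (2 * n + 1) → ℂ) :
    (sumBundle L E).toFrame x y (splitting Φ Q q e y (V.fromFrame x y v)) =
      (coeffAt Φ x y)⁻¹ • (adjugateMap (higgsAt Φ x y) (locHom V E q x y v),
        locForm V (trivialLine X) Q x y (lineFactor L x y ^ n • V.toFrame x y (e y)) v) := by
  obtain ⟨hL, hyE⟩ := mem_frameSet_sumBundle hW
  have h0 := lineFactor_ne_zero L hL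
  have h1 : charCoeff Φ (2 * n) y ≠ 0 := hy
  have h2 : coeffAt Φ x y ≠ 0 := mul_ne_zero (pow_ne_zero _ h0) h1
  have h3 := higgs_splitting (Q := Q) (q := q) (e := e) hy (V.fromFrame x y v)
  rw [toFrame_sumBundle]
  refine Prod.ext ?_ ?_
  · have h4 : higgsAt Φ x y ((lineFactor L x y)⁻¹ • E.toFrame x y
        (splitting Φ Q q e y (V.fromFrame x y v)).1) = locHom V E q x y v := by
      rw [map_smul, higgsAt_apply, E.fromFrame_toFrame hyE, h3, inv_smul_smul₀ h0, locHom_apply]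
    rw [Prod.smul_fst, ← h4, adjugateMap_comp, det_higgsAt Φ hyE, inv_smul_smul₀ h2]
  · rw [Prod.smul_snd, locForm_section Q hV, splitting_apply, coeffAt, smul_eq_mul]
    field_simp
    ring

variable [IsManifold 𝓘(ℂ) ω X]

/-- The Hecke data at a zero of `a_{2n}` which are determined by `V`. -/
theorem IsSpQuotient.exists_vector (hE : IsSpHiggs E Φ om) (hS : SmoothSpectralCurve Φ)
    (hq : IsSpQuotient φ Q Φ om q) (he : IsKernelSection Q Φ q e) {x : X} (hx : x ∈ zeroSet Φ) :
    ∃ u, (∀ v, adjugateMap (Φ x) (q x v) = -Q x (e x) v • u) ∧ u ≠ 0 ∧ Φ x u = 0 ∧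
      ∃ (α : ℂ) (ψ : Fin (2 * n) → ℂ), α ≠ 0 ∧ adjugateMap (Φ x) ψ = α • u ∧ om x u ψ = -α ∧
        ψ = (twist L 1 E).localDeriv x
          (fun y => Φ y (E.constSection (E.core.indexAt x) u y)) ∧
        α = (linePow L (2 * n : ℕ)).localDeriv x (charCoeff Φ (2 * n)) := by
  obtain ⟨u, hu, hadj⟩ := hq.exists_adjugateMap_eq hE (he.ker x) (he.ne_zero x) hx
  obtain ⟨α, hα, hα0, hαe, hαd⟩ := exists_coeffAt_eq hE hS hx
  -- For `u = 0` the adjugate of `Φ_x` would vanish, contradicting `adj(Φ_x)ψ = αk ≠ 0` for a kernel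
  -- vector `k`.
  have hu0 : u ≠ 0 := by
    rintro rfl
    obtain ⟨k, hk, hk0⟩ := (LinearMap.ker (Φ x)).ne_bot_iff.1
      (LinearMap.bot_lt_ker_of_det_eq_zero (det_eq_zero_of_mem hx)).ne'
    obtain ⟨ψ, -, -, hψ, -⟩ := exists_higgsAt_eq hα hαe hk
    obtain ⟨v, hv⟩ := hq.surj x (ψ x)
    rw [← hv, hadj, smul_zero] at hψ
    exact smul_ne_zero hα0 hk0 hψ.symm
  obtain ⟨ψ, -, -, hψ, hψd⟩ := exists_higgsAt_eq hα hαe hu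
  refine ⟨u, hadj, hu0, hu, α x, ψ x, hα0, hψ, ?_, hψd, hαd⟩
  obtain ⟨s, rfl⟩ := hq.surj x u
  obtain ⟨v, hv⟩ := hq.surj x (ψ x)
  obtain ⟨μ, hμ⟩ := hq.exists_higgs_eq_smul (he.ker x) (he.ne_zero x) hu
  have hQv : Q x (e x) v = -α x := by
    rw [← hv, hadj] at hψ
    exact neg_eq_iff_eq_neg.1 (smul_left_injective ℂ hu0 hψ)
  -- Since `ω(u, ψ) = Q(φs, v) = μQ(e, v) = -μα`, the residue condition amounts to `μ = 1`. Write
  -- `φs = μe + zh` near `x`. Then `Q(e, φs) = 0` gives `Q(e, h) = -μα`, and `adj(Φ)qφs = a_{2n}qs`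
  -- gives `adj(Φ_x)qh = αu`; but `adj(Φ_x)qh = -Q(e, h)u = μαu`.
  have hμ1 : μ = 1 := by
    have hel := he.hol x
    set el : X → Fin (2 * n + 1) → ℂ := fun y => lineFactor L x y ^ n • V.toFrame x y (e y)
      with hel_def
    have helx : el x = e x := by simp [hel_def]
    have hs := φ.holHomAt x _ (holAt_const s x)
    obtain ⟨h, hh, hhe, -⟩ := HolAt.exists_eq_smul (x := x)
      (f := fun y => locHom V (twist L 1 V) φ x y s - μ • el y)
      (hs.sub ((holAt_const μ x).smul hel)) (by rw [locHom_self, helx, hμ, sub_self])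
    have hfacts : ∀ᶠ y in 𝓝 x, locHom V E q x y (el y) = 0 ∧
        locForm V (trivialLine X) Q x y (el y) (el y) = coeffAt Φ x y ∧
        locForm V (trivialLine X) Q x y (el y) (locHom V (twist L 1 V) φ x y s) = 0 ∧
        adjugateMap (higgsAt Φ x y) (locHom V E q x y (locHom V (twist L 1 V) φ x y s)) =
          coeffAt Φ x y • locHom V E q x y s := by
      filter_upwards [V.eventually_mem_frameSet x, E.eventually_mem_frameSet x] with y h1 h2
      have h3 : locHom V (twist L 1 V) φ x y s =
          lineFactor L x y • V.toFrame x y (φ y (V.fromFrame x y s)) := by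
        rw [locHom_apply, toFrame_twist, zpow_one]
      refine ⟨?_, ?_, ?_, ?_⟩
      · simp only [hel_def, locHom_apply, map_smul, V.fromFrame_toFrame h1, he.ker, map_zero,
          smul_zero]
      · simp only [hel_def]
        rw [locForm_section Q h1, map_smul, V.fromFrame_toFrame h1, map_smul, he.form_self, coeffAt,
          smul_eq_mul]
        ring
      · simp only [hel_def]
        rw [locForm_section Q h1, h3, map_smul, V.fromFrame_toFrame h1, map_smul,
          hq.form_higgs (he.ker y), smul_zero, mul_zero]
      · have h4 : locHom V E q x y (locHom V (twist L 1 V) φ x y s) =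
            higgsAt Φ x y (locHom V E q x y s) := by
          rw [h3, map_smul, locHom_apply, V.fromFrame_toFrame h1, hq.comm, higgsAt_apply,
            locHom_apply, E.fromFrame_toFrame h2]
        rw [h4, adjugateMap_comp, det_higgsAt Φ h2]
    have hQh : Q x (e x) (h x) = -(μ * α x) := by
      have := eq_of_eventuallyEq_off (Q.holFormAt x _ _ hel hh).continuousAt
        ((holAt_const (-μ) x).mul hα).continuousAt (by
          filter_upwards [hfacts, hhe, hαe, eventually_centredCoord_ne_zero x]
            with y ⟨_, h2, h3, _⟩ h5 h6 h7 hne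
          refine mul_left_cancel₀ (h7 hne) ?_
          rw [← smul_eq_mul, ← map_smul, ← h5, map_sub, h3, map_smul, h2, h6, smul_eq_mul]
          ring)
      rw [locForm_self, helx] at this
      rw [this]
      ring
    have hadjh : adjugateMap (Φ x) (q x (h x)) = α x • q x s := by
      have := eq_of_eventuallyEq_off
        ((holHomAt_higgsAt Φ x).adjugateMap _ (q.holHomAt x _ hh)).continuousAt
        (hα.smul (q.holHomAt x _ (holAt_const s x))).continuousAt (by
          filter_upwards [hfacts, hhe, hαe, eventually_centredCoord_ne_zero x]
            with y ⟨h1, _, _, h4⟩ h5 h6 h7 hne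
          refine smul_right_injective _ (h7 hne) ?_
          beta_reduce
          rw [← map_smul, ← map_smul, ← h5, map_sub, map_smul, h1, smul_zero, sub_zero, h4, h6,
            mul_smul])
      simpa only [locHom_self, higgsAt_self] using this
    rw [hadj, hQh, neg_neg] at hadjh
    exact mul_right_cancel₀ hα0 ((smul_left_injective ℂ hu0 hadjh).trans (one_mul _).symm)
  rw [← hv, hq.form, hμ, hμ1, one_smul, hQv]

/-- An `SO_{2n+1}`-Higgs bundle from which `(E, Φ, ω)` is constructed is a Hecke modification. -/
theorem IsSpQuotient.exists_isHeckeModification [CompactSpace X] [ConnectedSpace X]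
    (hE : IsSpHiggs E Φ om) (hS : SmoothSpectralCurve Φ) (hq : IsSpQuotient φ Q Φ om q) :
    ∃ i j, IsHeckeData Φ om i ∧ IsHeckeModification Φ i V j ∧ ExtendsHiggs Φ V j φ ∧
      ExtendsForm Φ om V j Q := by
  obtain ⟨e, he⟩ := hq.exists_isKernelSection hE hS
  choose! u hadj hu using fun x hx => hq.exists_vector hE hS he (x := x) hx
  have hi := isHeckeData_of_vector hu
  set i : X → ℂ →ₗ[ℂ] (Fin (2 * n) → ℂ) := fun x => LinearMap.toSpanSingleton ℂ _ (u x) with hi_def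
  have hQ := extendsForm_splitting hE hq he
  refine ⟨i, _, hi, isHeckeModification_of_isLocalFrame hE hS
    (fun x hx => bijective_splitting hE hq he hx) fun x => ?_, extendsHiggs_splitting hq he, hQ⟩
  obtain ⟨M, hM⟩ := exists_isLocalMap (Φ := Φ) (i := i) (V := V) (j := splitting Φ Q q e) (x := x)
    fun v => by
      have h1 : HolAt (fun y => adjugateMap (higgsAt Φ x y) (locHom V E q x y v)) x :=
        (holHomAt_higgsAt Φ x).adjugateMap _ (q.holHomAt x _ (holAt_const v x))
      have h2 := Q.holFormAt x _ _ (he.hol x) (holAt_const v x)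
      by_cases hx : x ∈ zeroSet Φ
      · obtain ⟨α, hα, hα0, hαe, -⟩ := exists_coeffAt_eq hE hS hx
        -- The choice of `u` makes `adj(Φ)qv + Q(e, v)u` vanish at `x`; this is the statement that
        -- the residue of the splitting lies in `Γ_x`.
        obtain ⟨g, hg, hge, -⟩ := HolAt.exists_eq_smul (h1.add (h2.smul (holAt_const (u x) x))) (by
          simp [hadj x hx])
        refine ⟨_, (hα.inv hα0).smul (hg.pair h2), ?_⟩
        filter_upwards [hge, hαe, (sumBundle L E).eventually_mem_frameSet x,
          V.eventually_mem_frameSet x, eventually_heckeCoord_ne_zero Φ x] with y e1 e2 e3 e4 e5 hy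
        have hz := e5 hy
        have hux : heckeVec Φ i x = u x := by
          rw [heckeVec_of_mem hx, hi_def, LinearMap.toSpanSingleton_apply, one_smul]
        rw [toFrame_splitting Q q e e3 e4 hy, LinearMap.map_smul (heckeFrame _ _), hux, e2, mul_inv,
          mul_comm (centredCoord x y)⁻¹, mul_smul]
        congr 1
        rw [heckeCoord_of_mem hx] at hz ⊢
        rw [heckeFrame_apply]
        refine Prod.ext ?_ rfl
        rw [Prod.smul_fst, eq_sub_of_add_eq e1, smul_sub, inv_smul_smul₀ hz, smul_smul]
      · have h0 : coeffAt Φ x x ≠ 0 := by rw [coeffAt_self]; exact hx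
        refine ⟨_, ((holAt_coeffAt Φ x).inv h0).smul (h1.pair h2), ?_⟩
        filter_upwards [(sumBundle L E).eventually_mem_frameSet x, V.eventually_mem_frameSet x]
          with y e3 e4 hy
        rw [toFrame_splitting Q q e e3 e4 hy, heckeVec_of_notMem hx, heckeCoord_of_notMem hx,
          heckeFrame_zero_one]
  obtain ⟨ψ, α, ρ, hH⟩ := exists_localHecke hE hS hi x
  -- In the local model `Q` is pulled back along `M x`, so the kernel of `M x` lies in the radical
  -- of `Q`; injectivity suffices for equal dimensions.
  refine ⟨M, hM, bijective_of_injective ((injective_iff_map_eq_zero _).2 fun v hv =>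
    (hq.so.nondegenerate x).1 _ fun w => ?_)⟩
  rw [ExtendsForm.eq hE hS hM hH hQ, hv, map_zero, LinearMap.zero_apply]

end Converse

end HeckeHiggs

theorem mainTheorem5 {X : Type*} [TopologicalSpace X] [T2Space X] [CompactSpace X]
    [ConnectedSpace X] [ChartedSpace ℂ X] [IsManifold 𝓘(ℂ) ω X]
    (L : HolBundle X ℂ) (n : ℕ) (hn : 1 ≤ n)
    (E : HolBundle X (Fin (2 * n) → ℂ))
    (Φ : BundleHom E (twist L 1 E)) (om : BundleForm E L)
    (hE : IsSpHiggs E Φ om)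
    (hS : SmoothSpectralCurve Φ)
    (hD : ∀ x, ¬(charCoeff Φ (2 * n - 2) x = 0 ∧
      charCoeff Φ (2 * n) x = 0)) :
    (∃ i, IsHeckeData Φ om i) ∧
    (∀ i, IsHeckeData Φ om i →
      (∃ V j, IsHeckeModification Φ i V j) ∧
      (∀ V j, IsHeckeModification Φ i V j →
        (∃! φ : BundleHom V (twist L 1 V),
          ExtendsHiggs Φ V j φ) ∧
        (∃! Q : BundleForm V (trivialLine X),
          ExtendsForm Φ om V j Q) ∧
        (∀ φ Q, ExtendsHiggs Φ V j φ → ExtendsForm Φ om V j Q →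
          (∀ x ∈ zeroSet Φ, (Q x).Nondegenerate) ∧
          IsSOHiggs V φ Q ∧
          (∀ x, charPoly φ x = Polynomial.X * charPoly Φ x) ∧
          IsAssociatedSp V φ Q Φ om))) ∧
    (∀ (V : HolBundle X (Fin (2 * n + 1) → ℂ))
        (φ : BundleHom V (twist L 1 V))
        (Q : BundleForm V (trivialLine X)),
      IsSOHiggs V φ Q → IsAssociatedSp V φ Q Φ om →
      ∃ i j, IsHeckeData Φ om i ∧ IsHeckeModification Φ i V j ∧
        ExtendsHiggs Φ V j φ ∧ ExtendsForm Φ om V j Q) := by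
  refine ⟨exists_isHeckeData hE hS, fun i hi => ⟨?_, fun V j hV => ⟨?_, ?_, ?_⟩⟩, ?_⟩
  · obtain ⟨N, hN⟩ := exists_isHeckeCover hE hS
    exact ⟨_, _, isHeckeModification_heckeBundle hE hS hN i⟩
  · exact existsUnique_extendsHiggs hE hS hi hV
  · exact existsUnique_extendsForm hE hS hi hV
  · exact fun φ Q hφ hQ => ⟨fun x _ => hQ.nondegenerate hE hS hi hV x,
      isSOHiggs_of_extends hE hS hi hV hφ hQ, hφ.charPoly_eq hE hS hi hV,
      isAssociatedSp_of_extends hE hS hi hV hφ hQ⟩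
  · rintro V φ Q hSO ⟨q, h1, -, h2, h3⟩
    exact IsSpQuotient.exists_isHeckeModification hE hS ⟨hSO, h1, h2, h3⟩
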